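/- **Setting.** Let $n,d\ge 0$, $k\ge 1$, let $\mu_P$ be the (Borel, joint) probability distribution on $(\mathbb R^d)^n$ of a set $P$ of $n$ uncertain points in $\mathbb R^d$ (for instance the product $\prod_i\mu_{p_i}$ of the distributions of the individual points), and let $f:(\mathbb R^{d})^n\to\mathbb R^k$ be measurable. Put $$f^{\preceq}_{\mu_P}(v)=\Pr_{Q\sim\mu_P}[f(Q)\preceq v],\qquad v\in\mathbb R^k,$$ where $\preceq$ is the coordinatewise order. A *$k$-variate $\varepsilon$-quantization* of $f^{\preceq}_{\mu_P}$ is a non-empty finite family $R$ of points of $\mathbb R^k$ (counted with multiplicity) such that, with $R(v)=\frac1{|R|}\#\{q\in R: q\preceq v\}$, we have $|R(v)-f^{\preceq}_{\mu_P}(v)|\le\varepsilon$ for all $v\in\mathbb R^k$. Its *size* is the number $k|R|$ of real coordinates that are stored. Logarithms have base $2$. The model of computation is a real RAM (unit-cost arithmetic, comparisons and indirect memory access on real and natural numbers, no rounding of reals), with access to $\mu_P$ and $f$ only through an instruction that draws a fresh independent random point set $Q\sim\mu_P$ (each of its $n$ points in unit time) and evaluates $f(Q)$ in time $T_f(n)$.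 As evaluating $f$ includes reading its input, $T_f(n)\ge n$. **Theorem.** There are an absolute constant $C>0$ and a single real-RAM program with input $(k,n,\varepsilon,\delta)$ such that for every $k\ge1$ there is $\varepsilon_0=\varepsilon_0(k)\in(0,1)$ for which the following holds for all $0<\varepsilon\le\varepsilon_0$ and all $n$, $d$, $\mu_P$, $f$ as above. 1. There exists a $k$-variate $\varepsilon$-quantization of $f^{\preceq}_{\mu_P}$ of size at most $C\,\frac{k^2}{\varepsilon}\log^{2k}\frac1\varepsilon$. 2. For all $0<\delta<1$ and $T_f(n)\ge n$, the program always halts within time $$C\left(T_f(n)\,\frac{k}{\varepsilon^2}\log\frac{k}{\varepsilon\delta}+\frac{k^2}{\varepsilon^5}\log^{6k}\frac1\varepsilon\;\log\frac1{\varepsilon\delta}\right),$$ its output always has size at most $C\,\frac{k^2}{\varepsilon}\log^{2k}\frac1\varepsilon$, and with probability at least $1-\delta$ over the random draws its output is a $k$-variate $\varepsilon$-quantization of $f^{\preceq}_{\mu_P}$. In both parts, if the distribution of $f(Q)$ has no atoms (e.g. if it has a density), the points of the quantization can be taken, respectively are with the same probability $1-\delta$ simultaneously, pairwise distinct, so that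 it is a set. -/

import Mathlib

open MeasureTheory

/-! ### Quantizations -/

/-- The function `v ↦ Pr[f(Q) ⪯ v]`, where the point set `Q` (`n` points of `ℝ^d`) is drawn from
`μP` and `⪯` is the coordinatewise order of `ℝ^k` (which is the order `≤` of `Fin k → ℝ`). -/
noncomputable def orthantCDF {n d k : ℕ} (μP : Measure (Fin n → EuclideanSpace ℝ (Fin d)))
    (f : (Fin n → EuclideanSpace ℝ (Fin d)) → (Fin k → ℝ)) (v : Fin k → ℝ) : ℝ :=
  (μP {Q | f Q ≤ v}).toReal

open Classical in
/-- `R(v) = (1 / |R|) * #{q ∈ R | q ⪯ v}`, points counted with multiplicity. -/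
noncomputable def orthantFraction {k : ℕ} (R : Multiset (Fin k → ℝ)) (v : Fin k → ℝ) : ℝ :=
  ((R.filter (fun q => q ≤ v)).card : ℝ) / (R.card : ℝ)

/-- `R` is a `k`-variate `ε`-quantization of `h : ℝ^k → [0,1]`. -/
def IsQuantization {k : ℕ} (ε : ℝ) (h : (Fin k → ℝ) → ℝ) (R : Multiset (Fin k → ℝ)) : Prop :=
  R ≠ 0 ∧ ∀ v : Fin k → ℝ, |orthantFraction R v - h v| ≤ ε

/-- The storage of a finite family of points of `ℝ^k`: the number of real coordinates stored. -/
def storage {k : ℕ} (R : Multiset (Fin k → ℝ)) : ℕ := R.card * k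

/-! ### A real RAM with a sampling instruction

Two memories, one of natural numbers and one of real numbers, both addressed by natural numbers.
Arithmetic on one or two operands, a comparison, a memory access, and a jump decision cost one unit
each.  The only way a real number enters a program text is as the image of a natural number. -/

namespace RealRAM

/-- Expressions with a natural-number value; `get a` reads the cell whose address is `a`. -/
inductive NExp : Type
  | lit (c : ℕ)
  | get (a : NExp)
  | add (x y : NExp)
  | sub (x y : NExp)
  | mul (x y : NExp)

/-- Expressions with a real value; `get a` reads the real cell whose address is `a`. -/
inductive RExp : Type
  | ofNat (e : NExp)
  | get (a : NExp)
  | add (x y : RExp)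
  | sub (x y : RExp)
  | mul (x y : RExp)
  | div (x y : RExp)

/-- Tests. -/
inductive BExp : Type
  | natLT (x y : NExp)
  | realLT (x y : RExp)
  | not (b : BExp)
  | and (b c : BExp)

/-- Programs.  `setN a e` and `setR a e` write the value of `e` to the natural, resp. real, cell
with address `a`.  `sample a` draws a fresh random point set `Q`, evaluates `f Q`, and writes its
`k` coordinates to the real cells `a, …, a + k - 1`. -/
inductive Prog : Type
  | skip
  | setN (a e : NExp)
  | setR (a : NExp) (e : RExp)
  | sample (a : NExp)
  | seq (p q : Prog)
  | ite (b : BExp) (p q : Prog)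
  | loop (b : BExp) (p : Prog)

/-- A memory content, together with the number of point sets drawn so far. -/
structure State where
  nat : ℕ → ℕ
  real : ℕ → ℝ
  drawn : ℕ

/-- The value of a natural-number expression. -/
def NExp.eval (s : State) : NExp → ℕ
  | lit c => c
  | get a => s.nat (a.eval s)
  | add x y => x.eval s + y.eval s
  | sub x y => x.eval s - y.eval s
  | mul x y => x.eval s * y.eval s

/-- The value of a real expression. -/
noncomputable def RExp.eval (s : State) : RExp → ℝ
  | ofNat e => (e.eval s : ℝ)
  | get a => s.real (a.eval s)
  | add x y => x.eval s + y.eval s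
  | sub x y => x.eval s - y.eval s
  | mul x y => x.eval s * y.eval s
  | div x y => x.eval s / y.eval s

/-- Whether a test succeeds. -/
def BExp.holds (s : State) : BExp → Prop
  | natLT x y => x.eval s < y.eval s
  | realLT x y => x.eval s < y.eval s
  | not b => ¬ b.holds s
  | and b c => b.holds s ∧ c.holds s

/-- The number of elementary operations needed to evaluate an expression. -/
def NExp.cost : NExp → ℕ
  | lit _ => 1
  | get a => a.cost + 1
  | add x y => x.cost + y.cost + 1
  | sub x y => x.cost + y.cost + 1
  | mul x y => x.cost + y.cost + 1

/-- The number of elementary operations needed to evaluate an expression. -/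
def RExp.cost : RExp → ℕ
  | ofNat e => e.cost + 1
  | get a => a.cost + 1
  | add x y => x.cost + y.cost + 1
  | sub x y => x.cost + y.cost + 1
  | mul x y => x.cost + y.cost + 1
  | div x y => x.cost + y.cost + 1

/-- The number of elementary operations needed to evaluate a test. -/
def BExp.cost : BExp → ℕ
  | natLT x y => x.cost + y.cost + 1
  | realLT x y => x.cost + y.cost + 1
  | not b => b.cost + 1
  | and b c => b.cost + c.cost + 1

/-- Write the coordinates of `v` to the real cells `a, …, a + k - 1`. -/
def storeVec {k : ℕ} (mem : ℕ → ℝ) (a : ℕ) (v : Fin k → ℝ) : ℕ → ℝ := fun i =>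
  if h : a ≤ i ∧ i < a + k then v ⟨i - a, by omega⟩ else mem i

section Semantics

variable {X : Type*} {k : ℕ}

/-- `Exec f n T ω p s t s'`: the program `p`, started in `s`, halts in `s'` after `t` time units.
The `i`-th point set drawn is `ω i`; drawing its `n` points costs `n` units, and evaluating `f` on
it costs `T` units. -/
inductive Exec (f : X → (Fin k → ℝ)) (n T : ℕ) (ω : ℕ → X) :
    Prog → State → ℕ → State → Prop
  | skip (s : State) : Exec f n T ω Prog.skip s 1 s
  | setN (a e : NExp) (s : State) :
      Exec f n T ω (Prog.setN a e) s (a.cost + e.cost + 1)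
        { s with nat := Function.update s.nat (a.eval s) (e.eval s) }
  | setR (a : NExp) (e : RExp) (s : State) :
      Exec f n T ω (Prog.setR a e) s (a.cost + e.cost + 1)
        { s with real := Function.update s.real (a.eval s) (e.eval s) }
  | sample (a : NExp) (s : State) :
      Exec f n T ω (Prog.sample a) s (a.cost + n + T + 1)
        { s with
          real := storeVec s.real (a.eval s) (f (ω s.drawn))
          drawn := s.drawn + 1 }
  | seq {p q : Prog} {s s' s'' : State} {t t' : ℕ} :
      Exec f n T ω p s t s' → Exec f n T ω q s' t' s'' →
      Exec f n T ω (Prog.seq p q) s (t + t') s''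
  | iteTrue {b : BExp} {p q : Prog} {s s' : State} {t : ℕ} :
      b.holds s → Exec f n T ω p s t s' →
      Exec f n T ω (Prog.ite b p q) s (b.cost + t + 1) s'
  | iteFalse {b : BExp} {p q : Prog} {s s' : State} {t : ℕ} :
      ¬ b.holds s → Exec f n T ω q s t s' →
      Exec f n T ω (Prog.ite b p q) s (b.cost + t + 1) s'
  | loopDone {b : BExp} {p : Prog} {s : State} :
      ¬ b.holds s → Exec f n T ω (Prog.loop b p) s (b.cost + 1) s
  | loopStep {b : BExp} {p : Prog} {s s' s'' : State} {t t' : ℕ} :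
      b.holds s → Exec f n T ω p s t s' → Exec f n T ω (Prog.loop b p) s' t' s'' →
      Exec f n T ω (Prog.loop b p) s (b.cost + t + t' + 1) s''

/-- A run is determined by the program, the initial state and the point sets drawn. -/
theorem Exec.deterministic {f : X → (Fin k → ℝ)} {n T : ℕ} {ω : ℕ → X} {p : Prog}
    {s s₁ s₂ : State} {t₁ t₂ : ℕ} (h₁ : Exec f n T ω p s t₁ s₁) (h₂ : Exec f n T ω p s t₂ s₂) :
    t₁ = t₂ ∧ s₁ = s₂ := by
  induction h₁ generalizing t₂ s₂ with
  | skip | setN | setR | sample => cases h₂; exact ⟨rfl, rfl⟩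
  | seq _ _ ih ih' =>
    cases h₂ with
    | seq a b => obtain ⟨rfl, rfl⟩ := ih a; obtain ⟨rfl, rfl⟩ := ih' b; exact ⟨rfl, rfl⟩
  | iteTrue hb _ ih =>
    cases h₂ with
    | iteTrue _ a => obtain ⟨rfl, rfl⟩ := ih a; exact ⟨rfl, rfl⟩
    | iteFalse hb' _ => exact absurd hb hb'
  | iteFalse hb _ ih =>
    cases h₂ with
    | iteFalse _ a => obtain ⟨rfl, rfl⟩ := ih a; exact ⟨rfl, rfl⟩
    | iteTrue hb' _ => exact absurd hb' hb
  | loopDone hb =>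
    cases h₂ with
    | loopDone _ => exact ⟨rfl, rfl⟩
    | loopStep hb' _ _ => exact absurd hb' hb
  | loopStep hb _ _ ih ih' =>
    cases h₂ with
    | loopDone hb' => exact absurd hb hb'
    | loopStep _ a b => obtain ⟨rfl, rfl⟩ := ih a; obtain ⟨rfl, rfl⟩ := ih' b; exact ⟨rfl, rfl⟩

end Semantics

/-- The initial state: natural cells `0, 1` hold `k, n`, real cells `0, 1` hold `ε, δ`, and every
other cell holds `0`. -/
noncomputable def initial (k n : ℕ) (ε δ : ℝ) : State where
  nat := fun i => if i = 0 then k else if i = 1 then n else 0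
  real := fun i => if i = 0 then ε else if i = 1 then δ else 0
  drawn := 0

/-- The family of points of `ℝ^k` that a final state represents: natural cell `0` holds the number
of points, and coordinate `j` of point `i` is in real cell `i * k + j`. -/
def output (k : ℕ) (s : State) : Multiset (Fin k → ℝ) :=
  (Multiset.range (s.nat 0)).map (fun i => fun j : Fin k => s.real (i * k + (j : ℕ)))

/-- On input `(k, n, ε, δ)` and random point sets `ω 0, ω 1, …`, the program `p` halts after
exactly `t` time units and outputs `R`. -/
def Outputs {X : Type*} {k : ℕ} (p : Prog) (f : X → (Fin k → ℝ)) (n T : ℕ) (ε δ : ℝ) (ω : ℕ → X)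
    (t : ℕ) (R : Multiset (Fin k → ℝ)) : Prop :=
  ∃ s : State, Exec f n T ω p (initial k n ε δ) t s ∧ output k s = R

end RealRAM

/-!
The program draws `N = 16 ^ r * 2 ^ a` values of `f` and then discards all but `2 ^ a` of them
deterministically.  Half of `ε` pays for the sampling error, the other half for the thinning.

*Sampling.*  Each marginal of the law of `f` is cut into `M` quantile intervals, so that every
orthant lies between two boxes with sides in `upperBracket` and `lowerBracket` whose measures differ
by at most `k / M`.  There are `(M + 1) ^ k` pairs of boxes; Hoeffding's inequality for each of them
and a union bound give uniform convergence (`measure_exists_deviation_le`), with `N` of the order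
`k / ε ^ 2 * log (k / (ε δ))`.

*Halving a block of `g = 2 ^ c` points.*  Replace the points by their ranks in each coordinate, and
let `L = c + 1`.  An initial segment of the ranks is a disjoint union of at most `L` dyadic
intervals, so an orthant is a disjoint union of at most `L ^ k` dyadic boxes, one for each vector of
levels (`abs_sum_orthant_le`).  For each vector of levels the boxes partition the block, which is
why the argument of Beck and Fiala applies to the family of all boxes: starting from the weights
`1 / 2`, only the boxes with more than `2 L ^ k` floating weights are kept as constraints.  By double
counting there are at most half as many of them as floating weights (`card_heavy_le`), and a basic
solution found by simplex steps has at most as many floating weights as constraints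
(`SimplexInv.card_floats_le`).  So every phase halves the number of floating weights
(`wp_phaseProg`), and after `L` phases all weights are `0` or `1`.  A box keeps its total weight
until at most `2 L ^ k` of its weights float (`NearHalf`), hence the weights of an orthant are off by
at most `2 L ^ (2 k)`.  Selecting exactly half of the points costs the same once more
(`abs_card_selected_sub_le`), and so each block is halved with error `4 L ^ (2 k)` in every orthant.

*Thinning the sample.*  A round that halves the sample in blocks of `2 ^ c` points changes the
fraction of the sample in an orthant by at most `roundError k c = 8 (c + 1) ^ (2 k) / 2 ^ c`, at a
cost of `roundCost k c = (c + 1) ^ (k + 1) 8 ^ c` for each block, up to a factor of order `k`.  The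
blocks start with `c = a`, and `c` grows by one after three rounds.  The sample then shrinks by a
factor of `8`, the number of blocks by a factor of `16`, and both the error and the cost of a step
decrease geometrically (`wp_shrinkProg`).  When the whole sample is a single block of
`2 ^ (a + r)` points, `r` more rounds reduce it to `2 ^ a` points (`wp_halveProg`); their errors
increase geometrically, their costs decrease.  Altogether the error is at most `16 roundError k a`,
and `a` is chosen as the least number for which this is at most `ε / 2`.  For small `ε`, in the sense
of `Large`, this makes `2 ^ a` of the order `log (1 / ε) ^ (2 k) / ε`.

The output is a subfamily of the sample, hence without repetition if the draws are distinct, which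
they almost surely are if there are no atoms (`measure_exists_eq`).  A small quantization exists
because the program finds one with positive probability.

The programs are verified with weakest preconditions `Wp` that keep account of the running time, on
a memory that is divided into named arrays.
-/

set_option linter.constructorNameAsVariable false

namespace RealRAM

/-! ### Symbolic execution of programs with their running time -/

/-- The data on which a run depends besides the program and its initial state: the function `f`,
the prices `n` and `T` of a draw and of an evaluation, and the point sets drawn. -/
structure Env (X : Type*) (k : ℕ) where
  f : X → (Fin k → ℝ)
  n : ℕ
  T : ℕ
  ω : ℕ → X

section Wp

variable {X : Type*} {k : ℕ} (e : Env X k)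

/-- The program `p`, started in `s`, halts after some time `t` in some state `s'` such that
`Q t s'` holds. -/
def Wp (p : Prog) (s : State) (Q : ℕ → State → Prop) : Prop :=
  ∃ t s', Exec e.f e.n e.T e.ω p s t s' ∧ Q t s'

variable {e}

theorem Wp.mono {p : Prog} {s : State} {Q Q' : ℕ → State → Prop} (h : Wp e p s Q)
    (hQ : ∀ t s', Q t s' → Q' t s') : Wp e p s Q' := by
  obtain ⟨t, s', hx, hq⟩ := h
  exact ⟨t, s', hx, hQ _ _ hq⟩

@[simp] theorem wp_skip {s : State} {Q : ℕ → State → Prop} : Wp e .skip s Q ↔ Q 1 s := by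
  constructor
  · rintro ⟨t, s', hx, hq⟩
    cases hx
    exact hq
  · exact fun h => ⟨_, _, .skip s, h⟩

theorem wp_setN {a x : NExp} {s : State} {Q : ℕ → State → Prop} :
    Wp e (.setN a x) s Q ↔ Q (a.cost + x.cost + 1)
      { s with nat := Function.update s.nat (a.eval s) (x.eval s) } := by
  constructor
  · rintro ⟨t, s', hx, hq⟩
    cases hx
    exact hq
  · exact fun h => ⟨_, _, .setN a x s, h⟩

theorem wp_setR {a : NExp} {x : RExp} {s : State} {Q : ℕ → State → Prop} :
    Wp e (.setR a x) s Q ↔ Q (a.cost + x.cost + 1)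
      { s with real := Function.update s.real (a.eval s) (x.eval s) } := by
  constructor
  · rintro ⟨t, s', hx, hq⟩
    cases hx
    exact hq
  · exact fun h => ⟨_, _, .setR a x s, h⟩

theorem wp_sample {a : NExp} {s : State} {Q : ℕ → State → Prop} :
    Wp e (.sample a) s Q ↔ Q (a.cost + e.n + e.T + 1)
      { s with
        real := storeVec s.real (a.eval s) (e.f (e.ω s.drawn))
        drawn := s.drawn + 1 } := by
  constructor
  · rintro ⟨t, s', hx, hq⟩
    cases hx
    exact hq
  · exact fun h => ⟨_, _, .sample a s, h⟩

@[simp] theorem wp_ite {b : BExp} {p q : Prog} {s : State} {Q : ℕ → State → Prop} :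
    Wp e (.ite b p q) s Q ↔ (b.holds s → Wp e p s (fun t s' => Q (b.cost + t + 1) s')) ∧
      (¬ b.holds s → Wp e q s (fun t s' => Q (b.cost + t + 1) s')) := by
  constructor
  · rintro ⟨t, s', hx, hq⟩
    cases hx with
    | iteTrue hb hx => exact ⟨fun _ => ⟨_, _, hx, hq⟩, fun h => absurd hb h⟩
    | iteFalse hb hx => exact ⟨fun h => absurd h hb, fun _ => ⟨_, _, hx, hq⟩⟩
  · rintro ⟨h1, h2⟩
    by_cases hb : b.holds s
    · obtain ⟨t, s', hx, hq⟩ := h1 hb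
      exact ⟨_, _, .iteTrue hb hx, hq⟩
    · obtain ⟨t, s', hx, hq⟩ := h2 hb
      exact ⟨_, _, .iteFalse hb hx, hq⟩

/-- Sequential composition of a list of programs. -/
def block : List Prog → Prog
  | [] => .skip
  | p :: l => .seq p (block l)

@[simp] theorem wp_nil {s : State} {Q : ℕ → State → Prop} : Wp e (block []) s Q ↔ Q 1 s := wp_skip

@[simp] theorem wp_cons {p : Prog} {l : List Prog} {s : State} {Q : ℕ → State → Prop} :
    Wp e (block (p :: l)) s Q ↔
      Wp e p s (fun t s' => Wp e (block l) s' (fun t' s'' => Q (t + t') s'')) := by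
  constructor
  · rintro ⟨t, s', hx, hq⟩
    cases hx with
    | seq h1 h2 => exact ⟨_, _, h1, _, _, h2, hq⟩
  · rintro ⟨t, s', h1, t', s'', h2, hq⟩
    exact ⟨_, _, .seq h1 h2, hq⟩

/-- A loop whose test succeeds exactly in the first `m` rounds.  The potential `V` pays for the
running time. -/
theorem wp_loop_potential {b : BExp} {p : Prog} {s : State} (m : ℕ) (V : ℕ → ℕ)
    (P : ℕ → State → Prop) (h0 : P 0 s)
    (hstep : ∀ x < m, ∀ s', P x s' →
      b.holds s' ∧ Wp e p s' (fun t s'' => t + b.cost + 1 + V (x + 1) ≤ V x ∧ P (x + 1) s''))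
    (hend : ∀ s', P m s' → ¬ b.holds s') :
    Wp e (.loop b p) s (fun t s' => t ≤ V 0 + b.cost + 1 ∧ P m s') := by
  have key : ∀ y x s', x + y = m → P x s' →
      Wp e (.loop b p) s' (fun t s' => t ≤ V x + b.cost + 1 ∧ P m s') := by
    intro y
    induction y with
    | zero =>
      intro x s' hx hP
      obtain rfl : x = m := by omega
      exact ⟨_, _, .loopDone (hend _ hP), by omega, hP⟩
    | succ y ih =>
      intro x s' hx hP
      obtain ⟨hb, t, s'', h1, ht, hP'⟩ := hstep x (by omega) s' hP
      obtain ⟨t', s''', h2, ht', hP''⟩ := ih (x + 1) s'' (by omega) hP'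
      exact ⟨_, _, .loopStep hb h1 h2, by omega, hP''⟩
  exact key m 0 s (by omega) h0

/-- A loop whose test succeeds exactly in the first `m` rounds, each of which takes time at most
`tb`. -/
theorem wp_loop {b : BExp} {p : Prog} {s : State} (m tb : ℕ) (P : ℕ → State → Prop) (h0 : P 0 s)
    (hstep : ∀ x < m, ∀ s', P x s' →
      b.holds s' ∧ Wp e p s' (fun t s'' => t ≤ tb ∧ P (x + 1) s''))
    (hend : ∀ s', P m s' → ¬ b.holds s') :
    Wp e (.loop b p) s (fun t s' => t ≤ m * (tb + b.cost + 1) + b.cost + 1 ∧ P m s') := by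
  refine wp_loop_potential m (fun x => (m - x) * (tb + b.cost + 1)) P h0 (fun x hx s' hP => ?_) hend
  obtain ⟨hb, hw⟩ := hstep x hx s' hP
  refine ⟨hb, hw.mono fun t s'' h => ⟨?_, h.2⟩⟩
  have h1 : m - x = m - (x + 1) + 1 := by omega
  rw [h1, Nat.succ_mul]
  have := h.1
  omega

end Wp

/-! ### Memory layout: named arrays -/

/-- The names of the arrays of natural numbers; a scalar variable is the entry `0` of its array.
The names `k` and `n` come first because the input is expected in the cells `0` and `1`. -/
inductive NV : Type
  | k | n | L | g | h | w | pw | p | N | r | kk | z | s | lk | base | wp | off | cj | dup | cnt | A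
  | pr | q | L1 | j | i | i2 | l | c | ph | col | u | t | sh | rk | key | bas
  deriving DecidableEq

/-- The names of the arrays of real numbers.  The names `eps` and `delta` come first because the
input is expected in the cells `0` and `1`. -/
inductive RV : Type
  | eps | delta | th | d | y | u | pt | x | tb
  deriving DecidableEq

theorem NV.ctorIdx_lt (c : NV) : c.ctorIdx < 64 := by cases c <;> decide

theorem RV.ctorIdx_lt (c : RV) : c.ctorIdx < 64 := by cases c <;> decide

theorem NV.ctorIdx_inj {a b : NV} (h : a.ctorIdx = b.ctorIdx) : a = b := by
  rw [← NV.ofNat_ctorIdx a, h, NV.ofNat_ctorIdx b]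

theorem RV.ctorIdx_inj {a b : RV} (h : a.ctorIdx = b.ctorIdx) : a = b := by
  rw [← RV.ofNat_ctorIdx a, h, RV.ofNat_ctorIdx b]

/-- The entry `i` of the array `c` is stored at the address `64 * i + c`, where `c` stands for the
position of the name `c` in the list of all names. -/
def State.N (s : State) (c : NV) (i : ℕ) : ℕ := s.nat (64 * i + c.ctorIdx)

/-- The entry `i` of the real array `c`, stored at the address `64 * i + c`. -/
def State.R (s : State) (c : RV) (i : ℕ) : ℝ := s.real (64 * i + c.ctorIdx)

/-- Write `v` to the entry `i` of the array `c`. -/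
def State.wN (s : State) (c : NV) (i v : ℕ) : State :=
  { s with nat := Function.update s.nat (64 * i + c.ctorIdx) v }

/-- Write `v` to the entry `i` of the real array `c`. -/
noncomputable def State.wR (s : State) (c : RV) (i : ℕ) (v : ℝ) : State :=
  { s with real := Function.update s.real (64 * i + c.ctorIdx) v }

@[simp] theorem State.wN_N_same (s : State) (c : NV) (i v : ℕ) :
    (s.wN c i v).N c = Function.update (s.N c) i v := by
  funext i'
  simp only [State.wN, State.N, Function.update_apply]
  congr 1
  simp only [eq_iff_iff]
  omega

@[simp] theorem State.wR_R_same (s : State) (c : RV) (i : ℕ) (v : ℝ) :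
    (s.wR c i v).R c = Function.update (s.R c) i v := by
  funext i'
  simp only [State.wR, State.R, Function.update_apply]
  congr 1
  simp only [eq_iff_iff]
  omega

@[simp] theorem State.wN_N_ne (s : State) {c c' : NV} (i v : ℕ) (h : c' ≠ c) :
    (s.wN c i v).N c' = s.N c' := by
  funext i'
  simp only [State.wN, State.N, Function.update_apply]
  rw [if_neg]
  intro h'
  have h1 := c.ctorIdx_lt
  have h2 := c'.ctorIdx_lt
  exact h (NV.ctorIdx_inj (by omega))

@[simp] theorem State.wR_R_ne (s : State) {c c' : RV} (i : ℕ) (v : ℝ) (h : c' ≠ c) :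
    (s.wR c i v).R c' = s.R c' := by
  funext i'
  simp only [State.wR, State.R, Function.update_apply]
  rw [if_neg]
  intro h'
  have h1 := c.ctorIdx_lt
  have h2 := c'.ctorIdx_lt
  exact h (RV.ctorIdx_inj (by omega))

@[simp] theorem State.wN_R (s : State) (c : NV) (i v : ℕ) : (s.wN c i v).R = s.R := rfl

@[simp] theorem State.wR_N (s : State) (c : RV) (i : ℕ) (v : ℝ) : (s.wR c i v).N = s.N := rfl

@[simp] theorem State.wN_drawn (s : State) (c : NV) (i v : ℕ) :
    (s.wN c i v).drawn = s.drawn := rfl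

@[simp] theorem State.wR_drawn (s : State) (c : RV) (i : ℕ) (v : ℝ) :
    (s.wR c i v).drawn = s.drawn := rfl

instance : Add NExp := ⟨NExp.add⟩
instance : Sub NExp := ⟨NExp.sub⟩
instance : Mul NExp := ⟨NExp.mul⟩
instance : Add RExp := ⟨RExp.add⟩
instance : Sub RExp := ⟨RExp.sub⟩
instance : Mul RExp := ⟨RExp.mul⟩
instance : Div RExp := ⟨RExp.div⟩

section Eval

variable (s : State) (x y : NExp) (a b : RExp)

@[simp] theorem NExp.eval_add : (x + y).eval s = x.eval s + y.eval s := rfl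
@[simp] theorem NExp.eval_sub : (x - y).eval s = x.eval s - y.eval s := rfl
@[simp] theorem NExp.eval_mul : (x * y).eval s = x.eval s * y.eval s := rfl
@[simp] theorem NExp.cost_add : (x + y).cost = x.cost + y.cost + 1 := rfl
@[simp] theorem NExp.cost_sub : (x - y).cost = x.cost + y.cost + 1 := rfl
@[simp] theorem NExp.cost_mul : (x * y).cost = x.cost + y.cost + 1 := rfl
@[simp] theorem NExp.eval_lit (c : ℕ) : (NExp.lit c).eval s = c := rfl
@[simp] theorem NExp.cost_lit (c : ℕ) : (NExp.lit c).cost = 1 := rfl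
@[simp] theorem RExp.eval_add : (a + b).eval s = a.eval s + b.eval s := rfl
@[simp] theorem RExp.eval_sub : (a - b).eval s = a.eval s - b.eval s := rfl
@[simp] theorem RExp.eval_mul : (a * b).eval s = a.eval s * b.eval s := rfl
@[simp] theorem RExp.eval_div : (a / b).eval s = a.eval s / b.eval s := rfl
@[simp] theorem RExp.cost_add : (a + b).cost = a.cost + b.cost + 1 := rfl
@[simp] theorem RExp.cost_sub : (a - b).cost = a.cost + b.cost + 1 := rfl
@[simp] theorem RExp.cost_mul : (a * b).cost = a.cost + b.cost + 1 := rfl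
@[simp] theorem RExp.cost_div : (a / b).cost = a.cost + b.cost + 1 := rfl
@[simp] theorem RExp.eval_ofNat : (RExp.ofNat x).eval s = (x.eval s : ℝ) := rfl
@[simp] theorem RExp.cost_ofNat : (RExp.ofNat x).cost = x.cost + 1 := rfl
@[simp] theorem BExp.holds_natLT : (BExp.natLT x y).holds s ↔ x.eval s < y.eval s := Iff.rfl
@[simp] theorem BExp.holds_realLT : (BExp.realLT a b).holds s ↔ a.eval s < b.eval s := Iff.rfl
@[simp] theorem BExp.holds_not (p : BExp) : (BExp.not p).holds s ↔ ¬ p.holds s := Iff.rfl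
@[simp] theorem BExp.holds_and (p q : BExp) :
    (BExp.and p q).holds s ↔ p.holds s ∧ q.holds s := Iff.rfl
@[simp] theorem BExp.cost_natLT : (BExp.natLT x y).cost = x.cost + y.cost + 1 := rfl
@[simp] theorem BExp.cost_realLT : (BExp.realLT a b).cost = a.cost + b.cost + 1 := rfl
@[simp] theorem BExp.cost_not (p : BExp) : (BExp.not p).cost = p.cost + 1 := rfl
@[simp] theorem BExp.cost_and (p q : BExp) : (BExp.and p q).cost = p.cost + q.cost + 1 := rfl

/-- The value of the scalar variable `c`. -/
def NV.v (c : NV) : NExp := .get (.lit c.ctorIdx)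

/-- The entry of the array `c` with index `i`. -/
def NV.at (c : NV) (i : NExp) : NExp := .get (.lit 64 * i + .lit c.ctorIdx)

/-- The value of the real scalar variable `c`. -/
def RV.v (c : RV) : RExp := .get (.lit c.ctorIdx)

/-- The entry of the real array `c` with index `i`. -/
def RV.at (c : RV) (i : NExp) : RExp := .get (.lit 64 * i + .lit c.ctorIdx)

@[simp] theorem NV.eval_v (c : NV) : c.v.eval s = s.N c 0 := by
  simp [NV.v, State.N, NExp.eval]
@[simp] theorem NV.cost_v (c : NV) : c.v.cost = 2 := rfl
@[simp] theorem NV.eval_at (c : NV) : (c.at x).eval s = s.N c (x.eval s) := rfl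
@[simp] theorem NV.cost_at (c : NV) : (c.at x).cost = x.cost + 5 := by
  simp [NV.at, NExp.cost]; omega
@[simp] theorem RV.eval_v (c : RV) : c.v.eval s = s.R c 0 := by
  simp [RV.v, State.R, RExp.eval]
@[simp] theorem RV.cost_v (c : RV) : c.v.cost = 2 := rfl
@[simp] theorem RV.eval_at (c : RV) : (c.at x).eval s = s.R c (x.eval s) := rfl
@[simp] theorem RV.cost_at (c : RV) : (c.at x).cost = x.cost + 5 := by
  simp [RV.at, RExp.cost]; omega

end Eval

/-- Assignment to a scalar variable. -/
def NV.set (c : NV) (x : NExp) : Prog := .setN (.lit c.ctorIdx) x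

/-- Assignment to an array entry. -/
def NV.setAt (c : NV) (i x : NExp) : Prog := .setN (.lit 64 * i + .lit c.ctorIdx) x

/-- Assignment to a real scalar variable. -/
def RV.set (c : RV) (x : RExp) : Prog := .setR (.lit c.ctorIdx) x

/-- Assignment to an entry of a real array. -/
def RV.setAt (c : RV) (i : NExp) (x : RExp) : Prog := .setR (.lit 64 * i + .lit c.ctorIdx) x

/-- `for c = 0, …, bd - 1 do body`. -/
def forN (c bd : NV) (body : Prog) : Prog :=
  block [c.set (.lit 0), .loop (.natLT c.v bd.v) (block [body, c.set (c.v + .lit 1)])]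

section Rules

variable {X : Type*} {k : ℕ} {e : Env X k}

@[simp] theorem wp_set {c : NV} {x : NExp} {s : State} {Q : ℕ → State → Prop} :
    Wp e (c.set x) s Q ↔ Q (x.cost + 2) (s.wN c 0 (x.eval s)) := by
  rw [NV.set, wp_setN, NExp.cost_lit, show 1 + x.cost + 1 = x.cost + 2 by omega]
  simp [State.wN]

@[simp] theorem wp_setAt {c : NV} {i x : NExp} {s : State} {Q : ℕ → State → Prop} :
    Wp e (c.setAt i x) s Q ↔ Q (i.cost + x.cost + 5) (s.wN c (i.eval s) (x.eval s)) := by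
  rw [NV.setAt, wp_setN]
  simp only [NExp.cost_add, NExp.cost_mul, NExp.cost_lit, NExp.eval_add, NExp.eval_mul,
    NExp.eval_lit, State.wN]
  rw [show 1 + i.cost + 1 + 1 + 1 + x.cost + 1 = i.cost + x.cost + 5 by omega]

@[simp] theorem wp_rset {c : RV} {x : RExp} {s : State} {Q : ℕ → State → Prop} :
    Wp e (c.set x) s Q ↔ Q (x.cost + 2) (s.wR c 0 (x.eval s)) := by
  rw [RV.set, wp_setR, NExp.cost_lit, show 1 + x.cost + 1 = x.cost + 2 by omega]
  simp [State.wR]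

@[simp] theorem wp_rsetAt {c : RV} {i : NExp} {x : RExp} {s : State} {Q : ℕ → State → Prop} :
    Wp e (c.setAt i x) s Q ↔ Q (i.cost + x.cost + 5) (s.wR c (i.eval s) (x.eval s)) := by
  rw [RV.setAt, wp_setR]
  simp only [NExp.cost_add, NExp.cost_mul, NExp.cost_lit, NExp.eval_add, NExp.eval_mul,
    NExp.eval_lit, State.wR]
  rw [show 1 + i.cost + 1 + 1 + 1 + x.cost + 1 = i.cost + x.cost + 5 by omega]

/-- The frame condition: `s'` arises from `s` by changing only the arrays named in `ns` and `rs`,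
and without drawing points. -/
structure Fr (ns : List NV) (rs : List RV) (s s' : State) : Prop where
  n : ∀ c, c ∉ ns → s'.N c = s.N c
  r : ∀ c, c ∉ rs → s'.R c = s.R c
  drawn : s'.drawn = s.drawn

@[simp] theorem Fr.refl (ns : List NV) (rs : List RV) (s : State) : Fr ns rs s s :=
  ⟨fun _ _ => rfl, fun _ _ => rfl, rfl⟩

theorem Fr.comp {ns ns' : List NV} {rs rs' : List RV} {s s' s'' : State}
    (h2 : Fr ns' rs' s' s'') (hn : ∀ c ∈ ns', c ∈ ns) (hr : ∀ c ∈ rs', c ∈ rs)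
    (h1 : Fr ns rs s s') : Fr ns rs s s'' :=
  ⟨fun c hc => (h2.n c fun h => hc (hn c h)).trans (h1.n c hc),
    fun c hc => (h2.r c fun h => hc (hr c h)).trans (h1.r c hc), h2.drawn.trans h1.drawn⟩

theorem Fr.mono {ns ns' : List NV} {rs rs' : List RV} {s s' : State}
    (h2 : Fr ns' rs' s s') (hn : ∀ c ∈ ns', c ∈ ns) (hr : ∀ c ∈ rs', c ∈ rs) : Fr ns rs s s' :=
  h2.comp hn hr (Fr.refl _ _ _)

@[simp] theorem Fr.wN_iff {ns : List NV} {rs : List RV} {s s' : State} {c : NV} {i v : ℕ}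
    (hc : c ∈ ns) : Fr ns rs s (s'.wN c i v) ↔ Fr ns rs s s' := by
  have key : ∀ c', c' ∉ ns → (s'.wN c i v).N c' = s'.N c' := fun c' hc' =>
    State.wN_N_ne _ _ _ (fun h => hc' (h ▸ hc))
  exact ⟨fun h => ⟨fun c' hc' => (key c' hc').symm.trans (h.n c' hc'), h.r, h.drawn⟩,
    fun h => ⟨fun c' hc' => (key c' hc').trans (h.n c' hc'), h.r, h.drawn⟩⟩

@[simp] theorem Fr.wR_iff {ns : List NV} {rs : List RV} {s s' : State} {c : RV} {i : ℕ} {v : ℝ}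
    (hc : c ∈ rs) : Fr ns rs s (s'.wR c i v) ↔ Fr ns rs s s' := by
  have key : ∀ c', c' ∉ rs → (s'.wR c i v).R c' = s'.R c' := fun c' hc' =>
    State.wR_R_ne _ _ _ (fun h => hc' (h ▸ hc))
  exact ⟨fun h => ⟨h.n, fun c' hc' => (key c' hc').symm.trans (h.r c' hc'), h.drawn⟩,
    fun h => ⟨h.n, fun c' hc' => (key c' hc').trans (h.r c' hc'), h.drawn⟩⟩

/-- The rule for a counting loop whose body changes only the arrays `ns` and `rs`. -/
theorem wp_for {c bd : NV} {body : Prog} {s : State} (n tb : ℕ) (ns : List NV) (rs : List RV)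
    (P : ℕ → State → Prop) (hn : s.N bd 0 = n) (hc : c ∉ ns) (hbd : bd ∉ c :: ns)
    (hP : ∀ x s' v, P x s' → P x (s'.wN c 0 v)) (h0 : P 0 s)
    (hstep : ∀ x < n, ∀ s', Fr (c :: ns) rs s s' → s'.N c 0 = x → P x s' →
      Wp e body s' (fun t s'' => t ≤ tb ∧ Fr ns rs s' s'' ∧ P (x + 1) s'')) :
    Wp e (forN c bd body) s
      (fun t s' => t ≤ n * (tb + 13) + 10 ∧ Fr (c :: ns) rs s s' ∧ P n s') := by
  rw [forN, wp_cons, wp_set, wp_cons]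
  refine Wp.mono (wp_loop n (tb + 7)
    (fun x s' => Fr (c :: ns) rs s s' ∧ s'.N c 0 = x ∧ P x s') ?_ ?_ ?_) ?_
  · exact ⟨by simp, by simp, hP _ _ _ h0⟩
  · rintro x hx s' ⟨hfr, hcx, hPx⟩
    have hb : s'.N bd 0 = n := by rw [hfr.n bd hbd, hn]
    refine ⟨by simp [hcx, hb, hx], ?_⟩
    rw [wp_cons]
    refine Wp.mono (hstep x hx s' hfr hcx hPx) ?_
    rintro t s'' ⟨ht, hf, hP'⟩
    rw [wp_cons, wp_set, wp_nil]
    refine ⟨by simp only [NExp.cost_add, NV.cost_v, NExp.cost_lit]; omega, ?_, ?_, hP _ _ _ hP'⟩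
    · rw [Fr.wN_iff (by simp)]
      exact hf.comp (fun a ha => List.mem_cons_of_mem _ ha) (fun _ h => h) hfr
    · simp [hf.n c hc, hcx]
  · rintro s' ⟨hfr, hcx, -⟩
    have hb : s'.N bd 0 = n := by rw [hfr.n bd hbd, hn]
    simp [hcx, hb]
  · rintro t s' ⟨ht, hfr, -, hPn⟩
    rw [wp_nil]
    refine ⟨?_, hfr, hPn⟩
    simp only [BExp.cost_natLT, NV.cost_v, NExp.cost_lit] at ht ⊢
    rw [show tb + 7 + (2 + 2 + 1) + 1 = tb + 13 by omega] at ht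
    omega

end Rules

open Finset

/-! ### Ranks and dyadic boxes -/

open Classical in
/-- The rank of `q i` among `q 0, …, q (g - 1)`; of equal values the earlier one comes first. -/
noncomputable def rankIn (g : ℕ) (q : ℕ → ℝ) (i : ℕ) : ℕ :=
  #{i2 ∈ range g | q i2 < q i ∨ (i2 < i ∧ ¬ q i < q i2)}

open Classical in
/-- The first ranks belong to the points of a half-line, also if there are equal values. -/
theorem rankIn_lt_iff {g : ℕ} {q : ℕ → ℝ} {i : ℕ} (hi : i < g) (v : ℝ) :
    rankIn g q i < #{i2 ∈ range g | q i2 ≤ v} ↔ q i ≤ v := by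
  constructor
  · intro h
    by_contra! hv
    refine absurd h (not_lt.mpr (card_le_card fun i2 h2 => ?_))
    rw [mem_filter] at h2 ⊢
    exact ⟨h2.1, Or.inl (h2.2.trans_lt hv)⟩
  · intro hv
    refine card_lt_card ⟨fun i2 h2 => ?_, fun hsub => ?_⟩
    · rw [mem_filter] at h2 ⊢
      refine ⟨h2.1, ?_⟩
      rcases h2.2 with h | ⟨-, h⟩
      · exact h.le.trans hv
      · exact (not_lt.mp h).trans hv
    · have := hsub (mem_filter.mpr ⟨mem_range.mpr hi, hv⟩)
      rw [mem_filter] at this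
      rcases this.2 with h | h
      · exact lt_irrefl _ h
      · exact lt_irrefl _ h.1

theorem rankIn_lt {g : ℕ} {q : ℕ → ℝ} {i : ℕ} (hi : i < g) : rankIn g q i < g := by
  classical
  exact ((rankIn_lt_iff hi (q i)).mpr le_rfl).trans_le
    ((card_filter_le _ _).trans (card_range g).le)

/-- An initial segment of the natural numbers is the disjoint union of dyadic intervals, at most
one of each length. -/
theorem indicator_lt_eq_sum_dyadic (L : ℕ) : ∀ x R : ℕ, R < 2 ^ L →
    (if x < R then 1 else 0 : ℝ) =
      ∑ l ∈ range L, if (R / 2 ^ l) % 2 = 1 ∧ x / 2 ^ l + 1 = R / 2 ^ l then 1 else 0 := by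
  induction L with
  | zero => intro x R h; simp at h; simp [h]
  | succ L ih =>
    intro x R h
    rw [sum_range_succ']
    -- The interval of length `1` takes care of the last binary digit of `R`; halve the others.
    have h2 : R / 2 < 2 ^ L := by rw [pow_succ] at h; omega
    have := ih (x / 2) (R / 2) h2
    simp only [Nat.div_div_eq_div_mul, ← pow_succ'] at this
    rw [← this]
    simp only [pow_zero, Nat.div_one]
    split_ifs <;> first | (exfalso; omega) | norm_num

/-- The codes `c < L ^ j` enumerate the vectors of levels `l 0, …, l (j - 1) < L`.  The points `i`
with the same key lie in the same dyadic box, whose side in direction `j'` consists of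
`2 ^ l j'` consecutive ranks. -/
def boxKey (g L : ℕ) (r : ℕ → ℕ → ℕ) : ℕ → ℕ → ℕ → ℕ
  | 0, _, _ => 0
  | j + 1, c, i => boxKey g L r j (c / L) i * g + r j i / 2 ^ (c % L)

/-- Every vector of levels has a code, and the classes of its keys are the dyadic boxes. -/
theorem exists_code {g L : ℕ} {r : ℕ → ℕ → ℕ} (hr : ∀ j i, i < g → r j i < g) (j : ℕ)
    (l : ℕ → ℕ) (hl : ∀ j' < j, l j' < L) :
    ∃ c < L ^ j, ∀ i < g, ∀ i' < g, boxKey g L r j c i = boxKey g L r j c i' ↔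
      ∀ j' < j, r j' i / 2 ^ l j' = r j' i' / 2 ^ l j' := by
  induction j with
  | zero => exact ⟨0, by simp, by simp [boxKey]⟩
  | succ j ih =>
    obtain ⟨c, hc, h⟩ := ih fun j' hj' => hl j' (by omega)
    have hlj := hl j (by omega)
    have hd : (c * L + l j) / L = c := by
      rw [mul_comm, Nat.mul_add_div (by omega), Nat.div_eq_of_lt hlj, add_zero]
    have hm : (c * L + l j) % L = l j := by
      rw [mul_comm, Nat.mul_add_mod, Nat.mod_eq_of_lt hlj]
    refine ⟨c * L + l j, ?_, fun i hi i' hi' => ?_⟩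
    · calc c * L + l j < (c + 1) * L := by rw [add_mul]; omega
        _ ≤ L ^ j * L := Nat.mul_le_mul_right _ hc
        _ = L ^ (j + 1) := (pow_succ _ _).symm
    · have hlt : ∀ i'' < g, r j i'' / 2 ^ l j < g := fun i'' h'' =>
        (Nat.div_le_self _ _).trans_lt (hr j i'' h'')
      simp only [boxKey, hd, hm]
      have inj : ∀ a b u v : ℕ, u < g → v < g → (a * g + u = b * g + v ↔ a = b ∧ u = v) := by
        intro a b u v hu hv
        constructor
        · intro hab
          have h1 : (a * g + u) / g = (b * g + v) / g := by rw [hab]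
          rw [mul_comm a, mul_comm b, Nat.mul_add_div (by omega), Nat.mul_add_div (by omega),
            Nat.div_eq_of_lt hu, Nat.div_eq_of_lt hv] at h1
          obtain rfl : a = b := by omega
          exact ⟨rfl, by omega⟩
        · rintro ⟨rfl, rfl⟩
          rfl
      rw [inj _ _ _ _ (hlt i hi) (hlt i' hi'), h i hi i' hi']
      constructor
      · rintro ⟨h1, h2⟩ j' hj'
        rcases Nat.lt_succ_iff_lt_or_eq.mp hj' with h3 | rfl
        · exact h1 j' h3
        · exact h2
      · exact fun h1 => ⟨fun j' hj' => h1 j' (by omega), h1 j (by omega)⟩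

/-- If the weights `y` nearly cancel in every dyadic box, then they nearly cancel in every set of
points whose ranks are bounded from above. -/
theorem abs_sum_orthant_le {k g L s : ℕ} {r : ℕ → ℕ → ℕ} (hr : ∀ j i, i < g → r j i < g)
    {y : ℕ → ℝ}
    (H : ∀ c < L ^ k, ∀ i0 < g,
      |∑ i ∈ range g with boxKey g L r k c i = boxKey g L r k c i0, y i| ≤ s)
    (R : Fin k → ℕ) (hR : ∀ j, R j < 2 ^ L) :
    |∑ i ∈ range g with ∀ j : Fin k, r j i < R j, y i| ≤ (L ^ k * s : ℕ) := by
  -- Multiply the dyadic decompositions in the `k` coordinates.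
  have h1 : ∀ i, (if ∀ j : Fin k, r j i < R j then y i else 0) =
      ∑ l ∈ Fintype.piFinset (fun _ : Fin k => range L),
        if ∀ j : Fin k, (R j / 2 ^ l j) % 2 = 1 ∧ r j i / 2 ^ l j + 1 = R j / 2 ^ l j
          then y i else 0 := by
    intro i
    have e1 : (if ∀ j : Fin k, r j i < R j then y i else 0) =
        (∏ j : Fin k, if r j i < R j then (1 : ℝ) else 0) * y i := by
      rw [Finset.prod_ite_zero]
      simp
    rw [e1, Finset.prod_congr rfl fun (j : Fin k) _ =>
      indicator_lt_eq_sum_dyadic L (r j i) (R j) (hR j),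
      Finset.prod_univ_sum, Finset.sum_mul]
    refine Finset.sum_congr rfl fun l _ => ?_
    rw [Finset.prod_ite_zero]
    simp
  rw [sum_filter, sum_congr rfl fun i _ => h1 i, sum_comm]
  refine (abs_sum_le_sum_abs _ _).trans ?_
  have h2 : ∀ l ∈ Fintype.piFinset (fun _ : Fin k => range L),
      |∑ i ∈ range g, if ∀ j : Fin k, (R j / 2 ^ l j) % 2 = 1 ∧ r j i / 2 ^ l j + 1 = R j / 2 ^ l j
          then y i else 0| ≤ s := by
    intro l hl
    rw [Fintype.mem_piFinset] at hl
    by_cases hex : ∃ i0 < g, ∀ j : Fin k,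
      (R j / 2 ^ l j) % 2 = 1 ∧ r j i0 / 2 ^ l j + 1 = R j / 2 ^ l j
    · obtain ⟨i0, hi0, h0⟩ := hex
      obtain ⟨c, hc, hkey⟩ := exists_code hr k (fun j => if h : j < k then l ⟨j, h⟩ else 0)
        (fun j hj => by simpa [hj] using hl ⟨j, hj⟩)
      rw [← sum_filter]
      convert H c hc i0 hi0 using 3
      ext i
      simp only [mem_filter, mem_range, and_congr_right_iff]
      intro hi
      rw [hkey i hi i0 hi0]
      constructor
      · intro h j hj
        have a1 := (h ⟨j, hj⟩).2
        have a2 := (h0 ⟨j, hj⟩).2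
        simp only [hj, dite_true] at a1 a2 ⊢
        omega
      · intro h j
        have a1 := h j j.2
        have a2 := h0 j
        simp only [j.2, dite_true] at a1
        exact ⟨a2.1, by simp only [Fin.eta] at a1; omega⟩
    · push Not at hex
      rw [sum_eq_zero fun i hi => ?_]
      · simp
      · rw [if_neg]
        intro h
        obtain ⟨j, hj⟩ := hex i (mem_range.mp hi)
        exact hj (h j).1 (h j).2
  refine (sum_le_sum h2).trans ?_
  rw [sum_const, Fintype.card_piFinset]
  simp

/-! ### Beck–Fiala rounding -/

/-- A weight strictly between `0` and `1`, which is still to be rounded. -/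
def Floats (x : ℝ) : Prop := 0 < x ∧ x < 1

open Classical in
/-- The weights `x` in the class `C` were changed from `1 / 2` without changing their sum as long
as more than `s` of them were floating. -/
def NearHalf (C : Finset ℕ) (s : ℕ) (x : ℕ → ℝ) : Prop :=
  ∃ y : ℕ → ℝ, (∀ i ∈ C, 0 ≤ y i ∧ y i ≤ 1) ∧ ∑ i ∈ C, (y i - 1 / 2) = 0 ∧
    ((∀ i ∈ C, x i = y i) ∨ #{i ∈ C | Floats (x i) ∨ x i ≠ y i} ≤ s)

open Classical in
/-- A phase preserves `NearHalf`: it moves floating weights only, and a class with more than `s` of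
them keeps its sum. -/
theorem NearHalf.step {C : Finset ℕ} {s : ℕ} {x x' : ℕ → ℝ} (h : NearHalf C s x)
    (hx' : ∀ i ∈ C, 0 ≤ x' i ∧ x' i ≤ 1) (hfix : ∀ i ∈ C, ¬ Floats (x i) → x' i = x i)
    (hsum : s < #{i ∈ C | Floats (x i)} → ∑ i ∈ C, x' i = ∑ i ∈ C, x i) : NearHalf C s x' := by
  obtain ⟨y, hy, hy0, hor⟩ := h
  by_cases hs : s < #{i ∈ C | Floats (x i)}
  · have hxy : ∀ i ∈ C, x i = y i := by
      refine hor.resolve_right fun hle => absurd (hs.trans_le ((card_le_card ?_).trans hle))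
        (lt_irrefl _)
      exact fun i hi => mem_filter.mpr ⟨(mem_filter.mp hi).1, Or.inl (mem_filter.mp hi).2⟩
    refine ⟨x', hx', ?_, Or.inl fun _ _ => rfl⟩
    rw [sum_sub_distrib] at hy0 ⊢
    rw [hsum hs, sum_congr rfl hxy, hy0]
  · refine ⟨y, hy, hy0, Or.inr ?_⟩
    rcases hor with hxy | hle
    · refine (card_le_card fun i hi => ?_).trans (not_lt.mp hs)
      rw [mem_filter] at hi ⊢
      refine ⟨hi.1, ?_⟩
      by_contra hf
      have := hfix i hi.1 hf
      rcases hi.2 with h1 | h1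
      · exact hf (this ▸ h1)
      · exact h1 (this.trans (hxy i hi.1))
    · refine (card_le_card fun i hi => ?_).trans hle
      rw [mem_filter] at hi ⊢
      refine ⟨hi.1, ?_⟩
      by_contra! hf
      have := hfix i hi.1 hf.1
      rcases hi.2 with h1 | h1
      · exact hf.1 (this ▸ h1)
      · exact h1 (this.trans hf.2)

/-- The at most `s` weights that floated when the class was given up account for the deviation. -/
theorem NearHalf.abs_sum_le {C : Finset ℕ} {s : ℕ} {x : ℕ → ℝ} (h : NearHalf C s x)
    (hx : ∀ i ∈ C, 0 ≤ x i ∧ x i ≤ 1) : |∑ i ∈ C, (x i - 1 / 2)| ≤ s := by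
  classical
  obtain ⟨y, hy, hy0, hor⟩ := h
  have e : ∑ i ∈ C, (x i - 1 / 2) = ∑ i ∈ C, (x i - y i) := by
    have : ∑ i ∈ C, (x i - 1 / 2) = ∑ i ∈ C, (x i - y i) + ∑ i ∈ C, (y i - 1 / 2) := by
      rw [← sum_add_distrib]
      exact sum_congr rfl fun i _ => by ring
    rw [this, hy0, add_zero]
  rw [e]
  rcases hor with hxy | hle
  · rw [sum_congr rfl fun i hi => by rw [hxy i hi, sub_self]]
    simp
  · have hb : ∀ i ∈ C, |x i - y i| ≤ if Floats (x i) ∨ x i ≠ y i then 1 else 0 := by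
      intro i hi
      obtain ⟨h1, h2⟩ := hx i hi
      obtain ⟨h3, h4⟩ := hy i hi
      split_ifs with hc
      · rw [abs_le]; constructor <;> linarith
      · push Not at hc
        simp [hc.2]
    refine (abs_sum_le_sum_abs _ _).trans ((sum_le_sum hb).trans ?_)
    rw [← sum_filter, sum_const, nsmul_eq_mul, mul_one]
    exact_mod_cast hle

open Classical in
/-- Double counting: if every point lies in one class for each of `M` codes, there are at most
`F M / (s + 1)` classes with more than `s` of the `F` floating points. -/
theorem card_heavy_le {M g s : ℕ} (key : ℕ → ℕ → ℕ) (fl : ℕ → Prop) :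
    (∑ c ∈ range M, #{i ∈ range g | (∀ i2 < i, key c i2 ≠ key c i) ∧
      s < #{i2 ∈ range g | key c i2 = key c i ∧ fl i2}}) * (s + 1) ≤
      M * #{i ∈ range g | fl i} := by
  rw [sum_mul, ← card_range M, card_range M, ← smul_eq_mul M, ← card_range M, ← sum_const,
    card_range]
  refine sum_le_sum fun c _ => ?_
  rw [← smul_eq_mul, ← sum_const]
  set H := {i ∈ range g | (∀ i2 < i, key c i2 ≠ key c i) ∧
      s < #{i2 ∈ range g | key c i2 = key c i ∧ fl i2}} with hH
  calc ∑ _i ∈ H, (s + 1) ≤ ∑ i ∈ H, #{i2 ∈ range g | key c i2 = key c i ∧ fl i2} :=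
        sum_le_sum fun i hi => (mem_filter.mp hi).2.2
    _ = #(H.biUnion fun i => {i2 ∈ range g | key c i2 = key c i ∧ fl i2}) := by
        rw [card_biUnion]
        intro a ha b hb hab
        rw [Function.onFun, disjoint_left]
        intro i2 h1 h2
        rw [mem_filter] at h1 h2
        have heq : key c a = key c b := h1.2.1.symm.trans h2.2.1
        rcases lt_or_gt_of_ne hab with h | h
        · exact (mem_filter.mp hb).2.1 a h heq
        · exact (mem_filter.mp ha).2.1 b h heq.symm
    _ ≤ #{i ∈ range g | fl i} := by
        refine card_le_card fun i2 h2 => ?_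
        rw [mem_biUnion] at h2
        obtain ⟨i, -, h⟩ := h2
        rw [mem_filter] at h ⊢
        exact ⟨h.1, h.2.2⟩

/-! ### Tableaus -/

section Tableau

variable {g A : ℕ} {T : ℕ → ℕ → ℝ} {bas : ℕ → ℕ}

/-- The basic columns of the tableau `T` with `A` rows are unit vectors.  The row `r` has the
basic column `bas r - 1` if `0 < bas r`, and no basic column if `bas r = 0`. -/
def UnitCols (A : ℕ) (T : ℕ → ℕ → ℝ) (bas : ℕ → ℕ) : Prop :=
  ∀ r < A, ∀ r' < A, bas r' ≠ 0 → T r (bas r' - 1) = if r = r' then 1 else 0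

theorem UnitCols.inj (h : UnitCols A T bas) {r r' : ℕ} (hr : r < A) (hr' : r' < A)
    (h0 : bas r ≠ 0) (he : bas r = bas r') : r = r' := by
  by_contra hne
  have h1 := h r hr r hr h0
  have h2 := h r hr r' hr' (he ▸ h0)
  rw [he, h2, if_neg hne, if_pos rfl] at h1
  exact zero_ne_one h1

/-- The effect of increasing the variable of the column `j` by `θ`, the basic variables being
changed so as to preserve the equations. -/
noncomputable def moved (A : ℕ) (T : ℕ → ℕ → ℝ) (bas : ℕ → ℕ) (j : ℕ) (θ : ℝ) (x : ℕ → ℝ) :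
    ℕ → ℝ :=
  fun i => x i - θ * (∑ r ∈ range A, if bas r = i then T r j else 0) + if i = j + 1 then θ else 0

theorem moved_basic (h : UnitCols A T bas) {j : ℕ} {θ : ℝ} {x : ℕ → ℝ} {r : ℕ} (hr : r < A)
    (hj : ∀ r < A, bas r ≠ j + 1) (h0 : bas r ≠ 0) :
    moved A T bas j θ x (bas r) = x (bas r) - θ * T r j := by
  rw [moved, if_neg (hj r hr), sum_eq_single_of_mem r (mem_range.mpr hr), if_pos rfl, add_zero]
  intro r' hr' hne
  rw [if_neg]
  intro he
  exact hne (h.inj hr (mem_range.mp hr') h0 he.symm).symm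

theorem moved_of_notMem {j : ℕ} {θ : ℝ} {x : ℕ → ℝ} {i : ℕ} (hi : ∀ r < A, bas r ≠ i)
    (hj : i ≠ j + 1) : moved A T bas j θ x i = x i := by
  rw [moved, if_neg hj, sum_eq_zero fun r hr => if_neg (hi r (mem_range.mp hr))]
  ring

theorem moved_self {j : ℕ} {θ : ℝ} {x : ℕ → ℝ} (hj : ∀ r < A, bas r ≠ j + 1) :
    moved A T bas j θ x (j + 1) = x (j + 1) + θ := by
  rw [moved, if_pos rfl, sum_eq_zero fun r hr => if_neg (hj r (mem_range.mp hr))]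
  ring

theorem moved_zero {j : ℕ} {θ : ℝ} {x : ℕ → ℝ} (hθ : ∀ r < A, bas r = 0 → θ * T r j = 0) :
    moved A T bas j θ x 0 = x 0 := by
  rw [moved, if_neg (by omega), mul_sum, sum_eq_zero fun r hr => ?_]
  · ring
  · split_ifs with h
    · exact hθ r (mem_range.mp hr) h
    · simp

/-- A move along a column of the tableau preserves all equations, provided that it is a null move
whenever the column has a non-zero entry in a row without a basic column. -/
theorem sum_mul_moved (h : UnitCols A T bas) (hg : ∀ r < A, bas r ≤ g) {j : ℕ} (hj : j < g)
    {θ : ℝ} (hθ : ∀ r < A, bas r = 0 → θ * T r j = 0) (x : ℕ → ℝ) {r : ℕ} (hr : r < A) :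
    ∑ i ∈ range g, T r i * (moved A T bas j θ x (i + 1) - x (i + 1)) = 0 := by
  have e : ∀ i, T r i * (moved A T bas j θ x (i + 1) - x (i + 1)) =
      (if i = j then T r i * θ else 0) -
        ∑ r' ∈ range A, if bas r' = i + 1 then θ * (T r i * T r' j) else 0 := by
    intro i
    have : (if i + 1 = j + 1 then θ else 0) = if i = j then θ else 0 := by simp
    have h2 : ∑ r' ∈ range A, (if bas r' = i + 1 then θ * (T r i * T r' j) else 0) =
        T r i * (θ * ∑ r' ∈ range A, if bas r' = i + 1 then T r' j else 0) := by
      rw [mul_sum, mul_sum]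
      refine sum_congr rfl fun r' _ => ?_
      split_ifs
      · ring
      · ring
    rw [moved, this, h2]
    split_ifs <;> ring
  rw [sum_congr rfl fun i _ => e i, sum_sub_distrib, sum_comm,
    sum_ite_eq' (range g) j, if_pos (mem_range.mpr hj)]
  have h3 : ∀ r' ∈ range A,
      (∑ i ∈ range g, if bas r' = i + 1 then θ * (T r i * T r' j) else 0) =
        if r' = r then θ * T r j else 0 := by
    intro r' hr'
    rw [mem_range] at hr'
    by_cases h0 : bas r' = 0
    · rw [sum_eq_zero fun i _ => if_neg (by omega)]
      split_ifs with hrr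
      · rw [← hrr]; exact (hθ r' hr' h0).symm
      · rfl
    · have hb := hg r' hr'
      rw [sum_eq_single_of_mem (bas r' - 1) (mem_range.mpr (by omega)) fun i _ hi =>
        if_neg (by omega), if_pos (by omega), h r hr r' hr' h0]
      by_cases hrr : r' = r
      · rw [if_pos hrr, if_pos hrr.symm, hrr, one_mul]
      · rw [if_neg hrr, if_neg (Ne.symm hrr)]; ring
  rw [sum_congr rfl h3, sum_ite_eq' (range A) r, if_pos (mem_range.mpr hr)]
  ring

/-- The tableau after the pivot step with pivot entry `(p, j)`. -/
noncomputable def pivoted (T : ℕ → ℕ → ℝ) (p j : ℕ) : ℕ → ℕ → ℝ :=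
  fun r i => if r = p then T p i / T p j else T r i - T r j * (T p i / T p j)

theorem UnitCols.pivoted (h : UnitCols A T bas) {p j : ℕ} (hp : p < A) (hd : T p j ≠ 0) :
    UnitCols A (pivoted T p j) (Function.update bas p (j + 1)) := by
  intro r hr r' hr' h0
  by_cases hp' : r' = p
  · subst hp'
    simp only [Function.update_self, Nat.add_sub_cancel, RealRAM.pivoted]
    by_cases hrp : r = r'
    · simp [hrp, hd]
    · simp [hrp, hd]
  · rw [Function.update_of_ne hp'] at h0 ⊢
    have e1 := h r hr r' hr' h0
    have e2 := h p hp r' hr' h0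
    rw [if_neg (Ne.symm hp')] at e2
    simp only [RealRAM.pivoted, e2, zero_div, mul_zero, sub_zero]
    by_cases hrp : r = p
    · subst hrp
      simp [Ne.symm hp']
    · rw [if_neg hrp, e1]

/-- A pivot step does not enlarge the null space. -/
theorem sum_mul_of_pivoted {p j : ℕ} (hp : p < A) (hd : T p j ≠ 0) {y : ℕ → ℝ}
    (hy : ∀ r < A, ∑ i ∈ range g, pivoted T p j r i * y i = 0) :
    ∀ r < A, ∑ i ∈ range g, T r i * y i = 0 := by
  have hp0 : ∑ i ∈ range g, T p i / T p j * y i = 0 := by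
    simpa [pivoted] using hy p hp
  intro r hr
  by_cases hrp : r = p
  · subst hrp
    have : ∑ i ∈ range g, T r i * y i = T r j * ∑ i ∈ range g, T r i / T r j * y i := by
      rw [mul_sum]
      refine sum_congr rfl fun i _ => ?_
      field_simp
    rw [this, hp0, mul_zero]
  · have h1 := hy r hr
    simp only [pivoted, hrp, if_false, sub_mul, sum_sub_distrib] at h1
    have : ∑ i ∈ range g, T r j * (T p i / T p j) * y i =
        T r j * ∑ i ∈ range g, T p i / T p j * y i := by
      rw [mul_sum]
      exact sum_congr rfl fun i _ => by ring
    rw [this, hp0, mul_zero, sub_zero] at h1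
    exact h1

end Tableau

/-! ### The tables of a round -/

section Tables

variable {X : Type*} {K : ℕ} {e : Env X K}

/-- Compute `lk = L ^ k`. -/
def powProg : Prog := block [NV.lk.set (.lit 1), forN .i .k (NV.lk.set (NV.lk.v * NV.L.v))]

theorem wp_powProg (s : State) : Wp e powProg s (fun t s' => t ≤ s.N .k 0 * 40 + 40 ∧
    Fr [.i, .lk] [] s s' ∧ s'.N .lk 0 = s.N .L 0 ^ s.N .k 0) := by
  simp only [powProg, wp_cons, wp_set]
  refine Wp.mono (wp_for (s.N .k 0) 7 [.lk] [] (fun x s' => s'.N .lk 0 = s.N .L 0 ^ x)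
    (by simp) (by simp) (by simp) (by simp) (by simp) ?_) ?_
  · intro x hx s' hfr hi hP
    have hL := hfr.n .L (by simp)
    simp at hL
    simp [hL, hP, pow_succ]
  · rintro t s' ⟨ht, hfr, hP⟩
    simp at ht ⊢
    refine ⟨by omega, hfr.comp (by simp) (by simp) (by simp), hP⟩

/-- Compute `g = 2 ^ (L - 1)` and `h = g / 2`. -/
def sizeProg : Prog := block [NV.L1.set (NV.L.v - .lit 1), NV.g.set (.lit 1),
  forN .i .L1 (block [NV.h.set NV.g.v, NV.g.set (NV.g.v + NV.g.v)])]

theorem wp_sizeProg (s : State) {a : ℕ} (hL : s.N .L 0 = a + 2) :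
    Wp e sizeProg s (fun t s' => t ≤ s.N .L 0 * 40 + 40 ∧
      Fr [.i, .L1, .g, .h] [] s s' ∧ s'.N .g 0 = 2 ^ (a + 1) ∧ s'.N .h 0 = 2 ^ a) := by
  simp only [sizeProg, wp_cons, wp_set]
  refine Wp.mono (wp_for (a + 1) 15 [.g, .h] []
    (fun x s' => s'.N .g 0 = 2 ^ x ∧ (0 < x → s'.N .h 0 = 2 ^ (x - 1)))
    (by simp [hL]) (by simp) (by simp) (by simp) (by simp) ?_) ?_
  · intro x hx s' hfr hi hP
    simp [hP.1, pow_succ, mul_two]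
  · rintro t s' ⟨ht, hfr, hP⟩
    simp at ht hP ⊢
    refine ⟨by omega, hfr.comp (by simp) (by simp) (by simp), hP⟩

/-- Compute the table `sh[l * g + x] = x / 2 ^ l` for `l < L` and `x < g`. -/
def shiftProg : Prog := block [NV.pw.set (.lit 1),
  forN .l .L (block [
    forN .i .g (.ite (.natLT NV.i.v NV.pw.v)
      (NV.sh.setAt (NV.l.v * NV.g.v + NV.i.v) (.lit 0))
      (NV.sh.setAt (NV.l.v * NV.g.v + NV.i.v)
        (NV.sh.at (NV.l.v * NV.g.v + NV.i.v - NV.pw.v) + .lit 1))),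
    NV.pw.set (NV.pw.v + NV.pw.v)])]

theorem wp_shiftProg (s : State) {g L : ℕ} (hg : s.N .g 0 = g) (hL : s.N .L 0 = L) :
    Wp e shiftProg s (fun t s' => t ≤ L * (g * 60 + 60) + 40 ∧
      Fr [.l, .i, .pw, .sh] [] s s' ∧ ∀ l < L, ∀ x < g, s'.N .sh (l * g + x) = x / 2 ^ l) := by
  simp only [shiftProg, wp_cons, wp_set]
  refine Wp.mono (wp_for L (g * 60 + 40) [.i, .pw, .sh] []
    (fun y s' => s'.N .pw 0 = 2 ^ y ∧ ∀ l < y, ∀ x < g, s'.N .sh (l * g + x) = x / 2 ^ l)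
    (by simpa using hL) (by simp) (by simp) (by simp) (by simp) ?_) ?_
  · intro y hy s' hfr hi hP
    have hg' : s'.N .g 0 = g := by rw [hfr.n .g (by simp)]; simpa using hg
    rw [wp_cons]
    refine Wp.mono (wp_for g 44 [.sh] []
      (fun z s'' => (∀ l < y, ∀ x < g, s''.N .sh (l * g + x) = x / 2 ^ l) ∧
        ∀ x < z, s''.N .sh (y * g + x) = x / 2 ^ y)
      hg' (by simp) (by simp) (by simp) ⟨hP.2, by simp⟩ ?_) ?_
    · intro z hz s'' hfr'' hi'' hP''
      have e1 : s''.N .g 0 = g := by rw [hfr''.n .g (by simp), hg']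
      have e2 : s''.N .pw 0 = 2 ^ y := by rw [hfr''.n .pw (by simp), hP.1]
      have e3 : s''.N .l 0 = y := by rw [hfr''.n .l (by simp), hi]
      have key : ∀ v, v = z / 2 ^ y → (∀ l < y, ∀ x < g,
          (s''.wN .sh (y * g + z) v).N .sh (l * g + x) = x / 2 ^ l) ∧
          ∀ x < z + 1, (s''.wN .sh (y * g + z) v).N .sh (y * g + x) = x / 2 ^ y := by
        intro v hv
        simp only [State.wN_N_same, Function.update_apply]
        refine ⟨fun l hl x hx => ?_, fun x hx => ?_⟩
        · rw [if_neg, hP''.1 l hl x hx]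
          have : (l + 1) * g ≤ y * g := Nat.mul_le_mul_right _ hl
          rw [add_mul] at this
          omega
        · split_ifs with h
          · rw [hv]; congr 1; omega
          · exact hP''.2 x (by omega)
      rw [wp_ite]
      refine ⟨fun h => ?_, fun h => ?_⟩
      · simp only [BExp.holds_natLT, NV.eval_v, hi'', e2] at h
        rw [wp_setAt]
        simp only [NExp.eval_add, NExp.eval_mul, NV.eval_v, e1, e3, hi'', NExp.eval_lit]
        exact ⟨by simp, by simp, key 0 (Nat.div_eq_of_lt h).symm⟩
      · simp only [BExp.holds_natLT, NV.eval_v, hi'', e2, not_lt] at h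
        rw [wp_setAt]
        simp only [NExp.eval_add, NExp.eval_sub, NExp.eval_mul, NV.eval_v, e1, e2, e3, hi'',
          NExp.eval_lit, NV.eval_at]
        refine ⟨by simp, by simp, key _ ?_⟩
        have hpos : 0 < 2 ^ y := by positivity
        rw [show y * g + z - 2 ^ y = y * g + (z - 2 ^ y) by omega, hP''.2 _ (by omega),
          Nat.div_eq z, if_pos ⟨hpos, h⟩]
    · rintro t s'' ⟨ht, hfr'', hP''⟩
      have e2 : s''.N .pw 0 = 2 ^ y := by rw [hfr''.n .pw (by simp), hP.1]
      simp only [wp_cons, wp_set, wp_nil, NExp.eval_add, NV.eval_v, e2]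
      refine ⟨by simp; omega, ?_, by simp [pow_succ, mul_two], fun l hl x hx => ?_⟩
      · rw [Fr.wN_iff (by simp)]
        exact hfr''.mono (by simp) (by simp)
      · rw [State.wN_N_ne _ _ _ (by simp)]
        rcases Nat.lt_succ_iff_lt_or_eq.mp hl with h | rfl
        · exact hP''.1 l h x hx
        · exact hP''.2 x hx
  · rintro t s' ⟨ht, hfr, hP⟩
    simp at ht ⊢
    refine ⟨?_, hfr.comp (by simp) (by simp) (by simp), hP.2⟩
    have : L * (g * 60 + 40 + 13) ≤ L * (g * 60 + 60) := Nat.mul_le_mul_left _ (by omega)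
    omega

end Tables

/-! ### The keys of a block -/

theorem card_filter_range_succ (p : ℕ → Prop) [DecidablePred p] (x : ℕ) :
    #{i ∈ range (x + 1) | p i} = #{i ∈ range x | p i} + if p x then 1 else 0 := by
  rw [range_add_one, filter_insert]
  split_ifs with h
  · rw [card_insert_of_notMem (by simp)]
  · rfl

section Keys

variable {X : Type*} {K : ℕ} {e : Env X K}

/-- Coordinate `j` of the `i`-th point of the block that starts at the point number `base`. -/
def ptAt (i : NExp) : RExp := RV.pt.at ((NV.base.v + i) * NV.k.v + NV.j.v)

/-- Compute in `rk` the ranks of the points of a block in the coordinate `j`. -/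
def rankProg : Prog := forN .i .g (block [NV.t.set (.lit 0),
  forN .i2 .g (.ite (.realLT (ptAt NV.i2.v) (ptAt NV.i.v)) (NV.t.set (NV.t.v + .lit 1))
    (.ite (.and (.natLT NV.i2.v NV.i.v) (.not (.realLT (ptAt NV.i.v) (ptAt NV.i2.v))))
      (NV.t.set (NV.t.v + .lit 1)) .skip)),
  NV.rk.setAt NV.i.v NV.t.v])

theorem wp_rankProg (s : State) {g k b j : ℕ} (hg : s.N .g 0 = g) (hk : s.N .k 0 = k)
    (hb : s.N .base 0 = b) (hj : s.N .j 0 = j) :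
    Wp e rankProg s (fun t s' => t ≤ g * (g * 150 + 150) + 40 ∧ Fr [.i, .t, .i2, .rk] [] s s' ∧
      ∀ i < g, s'.N .rk i = rankIn g (fun i => s.R .pt ((b + i) * k + j)) i) := by
  classical
  simp only [rankProg]
  refine Wp.mono (wp_for g (g * 150 + 60) [.t, .i2, .rk] []
    (fun x s' => ∀ i < x, s'.N .rk i = rankIn g (fun i => s.R .pt ((b + i) * k + j)) i)
    hg (by simp) (by simp) (by simp) (by simp) ?_) ?_
  · intro x hx s' hfr hi hP
    have eg : s'.N .g 0 = g := by rw [hfr.n .g (by simp), hg]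
    rw [wp_cons, wp_set, wp_cons]
    refine Wp.mono (wp_for g 100 [.t] [] (fun y s'' => s''.N .t 0 = #{i2 ∈ range y |
        s.R .pt ((b + i2) * k + j) < s.R .pt ((b + x) * k + j) ∨
          (i2 < x ∧ ¬ s.R .pt ((b + x) * k + j) < s.R .pt ((b + i2) * k + j))})
      (by simpa using eg) (by simp) (by simp) (by simp) (by simp) ?_) ?_
    · intro y hy s'' hfr' hi2 hP'
      rw [card_filter_range_succ]
      have e1 : s''.N .k 0 = k := by
        rw [hfr'.n .k (by simp), State.wN_N_ne _ _ _ (by simp), hfr.n .k (by simp), hk]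
      have e2 : s''.N .base 0 = b := by
        rw [hfr'.n .base (by simp), State.wN_N_ne _ _ _ (by simp), hfr.n .base (by simp), hb]
      have e3 : s''.N .j 0 = j := by
        rw [hfr'.n .j (by simp), State.wN_N_ne _ _ _ (by simp), hfr.n .j (by simp), hj]
      have e4 : s''.N .i 0 = x := by
        rw [hfr'.n .i (by simp), State.wN_N_ne _ _ _ (by simp), hi]
      have e5 : s''.R .pt = s.R .pt := by
        rw [hfr'.r .pt (by simp), State.wN_R, hfr.r .pt (by simp)]
      simp only [ptAt, wp_ite, wp_set, wp_skip, BExp.holds_and, BExp.holds_not,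
        BExp.holds_realLT, BExp.holds_natLT, RV.eval_at, NExp.eval_add, NExp.eval_mul, NV.eval_v,
        NExp.eval_lit, e1, e2, e3, e4, e5, hi2]
      refine ⟨fun h => ⟨by simp, by simp, by simp [hP', h]⟩,
        fun h => ⟨fun h' => ⟨by simp, by simp, by simp [hP', h'.1, h'.2]⟩,
          fun h' => ⟨by simp, by simp, ?_⟩⟩⟩
      rw [if_neg (by tauto), hP', add_zero]
    · rintro t s'' ⟨ht, hfr', hP'⟩
      have e4 : s''.N .i 0 = x := by
        rw [hfr'.n .i (by simp), State.wN_N_ne _ _ _ (by simp), hi]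
      have e5 : s''.N .rk = s'.N .rk := by
        rw [hfr'.n .rk (by simp), State.wN_N_ne _ _ _ (by simp)]
      simp only [wp_cons, wp_setAt, wp_nil, NV.eval_v, e4]
      refine ⟨by simp; omega, ?_, fun i hi => ?_⟩
      · rw [Fr.wN_iff (by simp)]
        exact hfr'.comp (by simp) (by simp) (by simp)
      · rw [State.wN_N_same, Function.update_apply, e5]
        split_ifs with h
        · rw [h, hP', rankIn]
        · exact hP i (by omega)
  · rintro t s' ⟨ht, hfr, hP⟩
    refine ⟨?_, hfr, hP⟩
    have : g * (g * 150 + 60 + 13) ≤ g * (g * 150 + 150) := Nat.mul_le_mul_left _ (by omega)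
    omega

/-- Extend the keys of the codes of `j` levels by all levels
of the coordinate `j`. -/
def extendProg : Prog := forN .c .cj (forN .l .L (forN .i .g
  (NV.key.setAt ((NV.off.v + NV.cj.v + (NV.c.v * NV.L.v + NV.l.v)) * NV.g.v + NV.i.v)
    (NV.key.at ((NV.off.v + NV.c.v) * NV.g.v + NV.i.v) * NV.g.v +
      NV.sh.at (NV.l.v * NV.g.v + NV.rk.at NV.i.v)))))

/-- The codes of `j` levels have keys at `off`, `off + 1`, …; those of `j + 1` levels are appended. -/
theorem wp_extendProg (s : State) {g L cj off j : ℕ} {r : ℕ → ℕ → ℕ} (hg : s.N .g 0 = g)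
    (hL : s.N .L 0 = L) (hcj : s.N .cj 0 = cj) (hoff : s.N .off 0 = off)
    (hsh : ∀ l < L, ∀ x < g, s.N .sh (l * g + x) = x / 2 ^ l)
    (hr : ∀ i < g, r j i < g) (hrk : ∀ i < g, s.N .rk i = r j i)
    (hkey : ∀ c < cj, ∀ i < g, s.N .key ((off + c) * g + i) = boxKey g L r j c i) :
    Wp e extendProg s (fun t s' => t ≤ cj * (L * (g * 100 + 100) + 100) + 100 ∧
      Fr [.c, .l, .i, .key] [] s s' ∧
      ∀ c < cj * L, ∀ i < g,
        s'.N .key ((off + cj + c) * g + i) = boxKey g L r (j + 1) c i) := by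
  -- The entries of the new table with position below `pos` are correct, the old table is intact.
  set P : ℕ → State → Prop := fun pos s' =>
    (∀ c < cj, ∀ i < g, s'.N .key ((off + c) * g + i) = boxKey g L r j c i) ∧
    ∀ c, ∀ i < g, c * g + i < pos →
      s'.N .key ((off + cj + c) * g + i) = boxKey g L r (j + 1) c i with hPdef
  have hP0 : ∀ pos s' v (c : NV), c ≠ .key → P pos s' → P pos (s'.wN c 0 v) := by
    intro pos s' v c hc h
    simp only [hPdef, State.wN_N_ne s' 0 v (Ne.symm hc)]
    exact h
  simp only [extendProg]
  refine Wp.mono (wp_for cj (L * (g * 100 + 50) + 50) [.l, .i, .key] [] (fun x => P (x * L * g))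
    hcj (by simp) (by simp) (fun x s' v => hP0 _ _ _ _ (by simp))
    ⟨hkey, fun c i _ h => by simp at h⟩ ?_) ?_
  · intro c hc s1 hfr1 hc1 hP1
    have eL : s1.N .L 0 = L := by rw [hfr1.n .L (by simp), hL]
    refine Wp.mono (wp_for L (g * 100 + 10) [.i, .key] [] (fun l => P ((c * L + l) * g))
      eL (by simp) (by simp) (fun x s' v => hP0 _ _ _ _ (by simp)) (by simpa using hP1) ?_) ?_
    · intro l hl s2 hfr2 hl2 hP2
      have eg2 : s2.N .g 0 = g := by rw [hfr2.n .g (by simp), hfr1.n .g (by simp), hg]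
      refine Wp.mono (wp_for g 87 [.key] [] (fun i => P ((c * L + l) * g + i))
        eg2 (by simp) (by simp) (fun x s' v => hP0 _ _ _ _ (by simp)) hP2 ?_) ?_
      · intro i hi s3 hfr3 hi3 hP3
        have eg : s3.N .g 0 = g := by rw [hfr3.n .g (by simp), eg2]
        have eL3 : s3.N .L 0 = L := by rw [hfr3.n .L (by simp), hfr2.n .L (by simp), eL]
        have el : s3.N .l 0 = l := by rw [hfr3.n .l (by simp), hl2]
        have ec : s3.N .c 0 = c := by rw [hfr3.n .c (by simp), hfr2.n .c (by simp), hc1]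
        have eo : s3.N .off 0 = off := by
          rw [hfr3.n .off (by simp), hfr2.n .off (by simp), hfr1.n .off (by simp), hoff]
        have ecj : s3.N .cj 0 = cj := by
          rw [hfr3.n .cj (by simp), hfr2.n .cj (by simp), hfr1.n .cj (by simp), hcj]
        have erk : s3.N .rk = s.N .rk := by
          rw [hfr3.n .rk (by simp), hfr2.n .rk (by simp), hfr1.n .rk (by simp)]
        have esh : s3.N .sh = s.N .sh := by
          rw [hfr3.n .sh (by simp), hfr2.n .sh (by simp), hfr1.n .sh (by simp)]
        simp only [wp_setAt, NExp.eval_add, NExp.eval_mul, NV.eval_v, NV.eval_at, eg, eL3, el, ec,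
          eo, ecj, erk, esh, hi3, hrk i hi, hsh l hl _ (hr i hi), hP3.1 c hc i hi]
        refine ⟨by simp, by simp, ?_, ?_⟩
        · intro c' hc' i' hi'
          rw [State.wN_N_same, Function.update_apply, if_neg, hP3.1 c' hc' i' hi']
          have h1 : (off + c' + 1) * g ≤ (off + cj + (c * L + l)) * g :=
            Nat.mul_le_mul_right _ (by omega)
          rw [add_mul _ 1, one_mul] at h1
          exact (((Nat.add_lt_add_left hi' _).trans_le h1).trans_le (Nat.le_add_right _ _)).ne
        · intro c' i' hi' hpos
          rw [State.wN_N_same, Function.update_apply]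
          have hLpos : 0 < L := by omega
          split_ifs with h
          · have h1 : (off + cj + c') * g + i' = (off + cj + (c * L + l)) * g + i := h
            have hc' : off + cj + c' = off + cj + (c * L + l) := by
              have h2 : ((off + cj + c') * g + i') / g = ((off + cj + (c * L + l)) * g + i) / g := by
                rw [h1]
              rwa [mul_comm _ g, mul_comm _ g, Nat.mul_add_div (by omega),
                Nat.mul_add_div (by omega), Nat.div_eq_of_lt hi', Nat.div_eq_of_lt hi] at h2
            rw [hc'] at h1
            obtain rfl : c' = c * L + l := Nat.add_left_cancel hc'
            obtain rfl : i' = i := Nat.add_left_cancel h1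
            rw [boxKey, mul_comm c L, Nat.mul_add_div hLpos, Nat.div_eq_of_lt hl, Nat.mul_add_mod,
              Nat.mod_eq_of_lt hl, add_zero]
          · refine hP3.2 c' i' hi' ?_
            by_contra hge
            have h3 : c' * g + i' = (c * L + l) * g + i :=
              le_antisymm (Nat.lt_succ_iff.mp hpos) (not_lt.mp hge)
            refine h ?_
            rw [add_mul _ c', add_mul _ (c * L + l), add_assoc, add_assoc, h3]
      · rintro t s3 ⟨ht, hfr3, hP3⟩
        exact ⟨by omega, hfr3, by rw [← add_assoc, add_mul _ 1, one_mul]; exact hP3⟩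
    · rintro t s2 ⟨ht, hfr2, hP2⟩
      refine ⟨ht.trans ?_, hfr2, by rw [add_mul _ 1, one_mul]; exact hP2⟩
      have : L * (g * 100 + 10 + 13) ≤ L * (g * 100 + 50) := Nat.mul_le_mul_left _ (by omega)
      omega
  · rintro t s' ⟨ht, hfr, hP⟩
    refine ⟨?_, hfr, fun c hc i hi => hP.2 c i hi ?_⟩
    · have h1 : L * (g * 100 + 50) ≤ L * (g * 100 + 100) := Nat.mul_le_mul_left _ (by omega)
      have h2 : cj * (L * (g * 100 + 50) + 50 + 13) ≤ cj * (L * (g * 100 + 100) + 100) :=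
        Nat.mul_le_mul_left _ (by omega)
      exact ht.trans (Nat.add_le_add h2 (by norm_num))
    · have h1 : (c + 1) * g ≤ cj * L * g := Nat.mul_le_mul_right _ hc
      rw [add_mul c 1, one_mul] at h1
      exact (Nat.add_lt_add_left hi _).trans_le h1

/-- Compute the keys of all points of a block for all codes of `k` levels. -/
def keysProg : Prog := block [NV.off.set (.lit 0), NV.cj.set (.lit 1),
  forN .i .g (NV.key.setAt NV.i.v (.lit 0)),
  forN .j .k (block [rankProg, extendProg, NV.off.set (NV.off.v + NV.cj.v),
    NV.cj.set (NV.cj.v * NV.L.v)])]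

/-- The keys computed are those of the dyadic boxes in the space of ranks. -/
theorem wp_keysProg (s : State) {g L k b : ℕ} (hg : s.N .g 0 = g)
    (hL : s.N .L 0 = L) (hk : s.N .k 0 = k) (hb : s.N .base 0 = b)
    (hsh : ∀ l < L, ∀ x < g, s.N .sh (l * g + x) = x / 2 ^ l) (hg0 : 0 < g) (hL0 : 0 < L) :
    Wp e keysProg s (fun t s' => t ≤ k * (L ^ k * (g * g) * 1000) + g * 100 + 100 ∧
      Fr [.off, .cj, .i, .j, .t, .i2, .rk, .c, .l, .key] [] s s' ∧
      ∀ c < L ^ k, ∀ i < g, s'.N .key ((s'.N .off 0 + c) * g + i) =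
        boxKey g L (fun j => rankIn g (fun i => s.R .pt ((b + i) * k + j))) k c i) := by
  set r := fun j => rankIn g (fun i => s.R .pt ((b + i) * k + j)) with hr
  simp only [keysProg, wp_cons, wp_set]
  refine Wp.mono (wp_for g 20 [.key] [] (fun x s' => ∀ i < x, s'.N .key i = 0)
    (by simpa using hg) (by simp) (by simp) (by simp) (by simp) ?_) ?_
  · intro x hx s' hfr hi hP
    simp only [wp_setAt, NV.eval_v, hi, NExp.eval_lit]
    refine ⟨by simp, by simp, fun i hi' => ?_⟩
    rw [State.wN_N_same, Function.update_apply]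
    split_ifs with h
    · rfl
    · exact hP i (by omega)
  · rintro t1 s1 ⟨ht1, hfr1, hP1⟩
    have e1 : ∀ c, c ∉ [NV.i, .key, .off, .cj] → s1.N c = s.N c := by
      intro c hc
      simp only [List.mem_cons, List.not_mem_nil, or_false, not_or] at hc
      rw [hfr1.n c (by simp [hc]), State.wN_N_ne _ _ _ hc.2.2.2, State.wN_N_ne _ _ _ hc.2.2.1]
    have eR : s1.R = s.R := by
      funext c
      rw [hfr1.r c (by simp)]
      simp
    refine Wp.mono (wp_for k (L ^ k * (g * g) * 900)
      [.off, .cj, .i, .t, .i2, .rk, .c, .l, .key] []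
      (fun j s' => s'.N .cj 0 = L ^ j ∧ ∀ c < L ^ j, ∀ i < g,
        s'.N .key ((s'.N .off 0 + c) * g + i) = boxKey g L r j c i)
      (by rw [e1 _ (by simp), hk]) (by simp) (by simp) (by simp) ?_ ?_) ?_
    · refine ⟨by rw [hfr1.n _ (by simp)]; simp, fun c hc i hi => ?_⟩
      have eo : s1.N .off 0 = 0 := by rw [hfr1.n _ (by simp)]; simp
      obtain rfl : c = 0 := by simpa using hc
      rw [eo, add_zero, zero_mul, zero_add, hP1 i hi, boxKey]
    · intro j hj s2 hfr2 hj2 hP2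
      have e2 : ∀ c, c ∉ [NV.j, .off, .cj, .i, .t, .i2, .rk, .c, .l, .key] →
          s2.N c = s.N c := by
        intro c hc
        rw [hfr2.n c hc, e1 c]
        simp only [List.mem_cons, List.not_mem_nil, or_false, not_or] at hc ⊢
        simp [hc]
      have eR2 : s2.R = s.R := by
        rw [← eR]
        funext c
        rw [hfr2.r c (by simp)]
      rw [wp_cons]
      refine Wp.mono (wp_rankProg s2 (g := g) (k := k) (b := b) (j := j)
        (by rw [e2 _ (by simp), hg]) (by rw [e2 _ (by simp), hk]) (by rw [e2 _ (by simp), hb])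
        hj2) ?_
      rintro t3 s3 ⟨ht3, hfr3, hrk3⟩
      have e3 : ∀ c, c ∉ [NV.j, .off, .cj, .i, .t, .i2, .rk, .c, .l, .key] →
          s3.N c = s.N c := by
        intro c hc
        rw [hfr3.n c, e2 c hc]
        simp only [List.mem_cons, List.not_mem_nil, or_false, not_or] at hc ⊢
        simp [hc]
      rw [wp_cons]
      refine Wp.mono (wp_extendProg s3 (g := g) (L := L) (cj := L ^ j) (off := s2.N .off 0) (j := j)
        (r := r) (by rw [e3 _ (by simp), hg]) (by rw [e3 _ (by simp), hL])
        (by rw [hfr3.n _ (by simp), hP2.1]) (by rw [hfr3.n _ (by simp)])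
        (by rw [e3 _ (by simp)]; exact hsh) (fun i hi => rankIn_lt hi)
        (by intro i hi; rw [hrk3 i hi, eR2]) (by rw [hfr3.n _ (by simp)]; exact hP2.2)) ?_
      rintro t4 s4 ⟨ht4, hfr4, hkey4⟩
      have eo : s4.N .off 0 = s2.N .off 0 := by
        rw [hfr4.n _ (by simp), hfr3.n _ (by simp)]
      have ecj : s4.N .cj 0 = L ^ j := by
        rw [hfr4.n _ (by simp), hfr3.n _ (by simp), hP2.1]
      have eL : s4.N .L 0 = L := by
        rw [hfr4.n _ (by simp), e3 _ (by simp), hL]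
      simp only [wp_cons, wp_set, wp_nil]
      refine ⟨?_, ?_, ?_, ?_⟩
      · have hpw : L ^ j * L ≤ L ^ k := by
          rw [← pow_succ]
          exact Nat.pow_le_pow_right hL0 hj
        have hpos : 0 < L ^ j := by positivity
        have h1 : L ^ j * (L * (g * 100 + 100) + 100) =
          100 * (L ^ j * L * g) + 100 * (L ^ j * L) + 100 * L ^ j := by ring
        have h2 : L ^ j * L * g ≤ L ^ k * (g * g) :=
          Nat.mul_le_mul hpw (Nat.le_mul_of_pos_left _ hg0)
        have h3 : L ^ j * L ≤ L ^ j * L * g := Nat.le_mul_of_pos_right _ hg0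
        have h4 : L ^ j ≤ L ^ j * L := Nat.le_mul_of_pos_right _ hL0
        have h5 : g * (g * 150 + 150) = 150 * (g * g) + 150 * g := by ring
        have h6 : g ≤ g * g := Nat.le_mul_of_pos_left _ hg0
        have h7 : g * g ≤ L ^ k * (g * g) := Nat.le_mul_of_pos_left _ (by positivity)
        simp
        omega
      · rw [Fr.wN_iff (by simp), Fr.wN_iff (by simp)]
        refine hfr4.comp (by simp) (by simp) (hfr3.comp (by simp) (by simp) ?_)
        exact (Fr.refl _ _ _)
      · simp [ecj, eL, pow_succ]
      · intro c hc i hi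
        simp only [State.wN_N_ne _ (c := NV.cj) (c' := NV.key) _ _ (by simp),
          State.wN_N_ne _ (c := NV.off) (c' := NV.key) _ _ (by simp),
          State.wN_N_ne _ (c := NV.cj) (c' := NV.off) _ _ (by simp), State.wN_N_same,
          Function.update_self, NExp.eval_add, NV.eval_v, eo, ecj]
        exact hkey4 c (by rwa [← pow_succ]) i hi
    · rintro t s2 ⟨ht2, hfr2, hP2⟩
      rw [wp_nil]
      refine ⟨?_, ?_, hP2.2⟩
      · have h7 : 0 < L ^ k * (g * g) := by positivity
        have h8 : k * (L ^ k * (g * g) * 900 + 13) ≤ k * (L ^ k * (g * g) * 1000) :=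
          Nat.mul_le_mul_left _ (by omega)
        simp
        omega
      · exact hfr2.comp (by simp) (by simp) (hfr1.comp (by simp) (by simp) (by simp))

end Keys

/-! ### The constraints of a phase -/

theorem mul_add_inj {g r i r' i' : ℕ} (hi : i < g) (hi' : i' < g) :
    r * g + i = r' * g + i' ↔ r = r' ∧ i = i' := by
  constructor
  · intro h
    have h1 : (r * g + i) / g = (r' * g + i') / g := by rw [h]
    rw [mul_comm r, mul_comm r', Nat.mul_add_div (by omega), Nat.mul_add_div (by omega),
      Nat.div_eq_of_lt hi, Nat.div_eq_of_lt hi', add_zero, add_zero] at h1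
    subst h1
    exact ⟨rfl, Nat.add_left_cancel h⟩
  · rintro ⟨rfl, rfl⟩
    rfl

/-- The point `i` is the first one of its class for the code `c`, and this class contains more
than `s` floating points. -/
def Heavy (g s : ℕ) (key : ℕ → ℕ → ℕ) (x : ℕ → ℝ) (c i : ℕ) : Prop :=
  (∀ i2 < i, key c i2 ≠ key c i) ∧
    ∃ t : Finset ℕ, s < #t ∧ ∀ i2 ∈ t, i2 < g ∧ key c i2 = key c i ∧ Floats (x i2)

open Classical in
theorem heavy_iff {g s : ℕ} {key : ℕ → ℕ → ℕ} {x : ℕ → ℝ} {c i : ℕ} :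
    Heavy g s key x c i ↔ (∀ i2 < i, key c i2 ≠ key c i) ∧
      s < #{i2 ∈ range g | key c i2 = key c i ∧ Floats (x i2)} := by
  refine and_congr_right fun _ => ⟨?_, fun h => ⟨_, h, fun i2 h2 => by simpa using h2⟩⟩
  rintro ⟨t, ht, h⟩
  exact ht.trans_le (card_le_card fun i2 h2 => by simpa using h i2 h2)

section Rows

variable {X : Type*} {K : ℕ} {e : Env X K}

/-- The key of the point `i` for the code `c`. -/
def keyAt (i : NExp) : NExp := NV.key.at ((NV.off.v + NV.c.v) * NV.g.v + i)

/-- Whether the points `i` and `i2` lie in the same class for the code `c`. -/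
def sameKey : BExp := .and (.not (.natLT (keyAt NV.i2.v) (keyAt NV.i.v)))
  (.not (.natLT (keyAt NV.i.v) (keyAt NV.i2.v)))

/-- Whether the weight of the point `i` is floating. -/
def floatTest (i : NExp) : BExp := .and (.realLT (.ofNat (.lit 0)) (RV.x.at (i + .lit 1)))
  (.realLT (RV.x.at (i + .lit 1)) (.ofNat (.lit 1)))

/-- Write the indicator function of the class of the point `i` into a new row of the tableau. -/
def addRowProg : Prog := block [
  forN .i2 .g (.ite sameKey (RV.tb.setAt (NV.A.v * NV.g.v + NV.i2.v) (.ofNat (.lit 1)))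
    (RV.tb.setAt (NV.A.v * NV.g.v + NV.i2.v) (.ofNat (.lit 0)))),
  NV.bas.setAt NV.A.v (.lit 0), NV.A.set (NV.A.v + .lit 1)]

theorem wp_addRowProg (s : State) {g c i off A : ℕ} {key : ℕ → ℕ → ℕ} (hg : s.N .g 0 = g)
    (hc : s.N .c 0 = c) (hi : s.N .i 0 = i) (hoff : s.N .off 0 = off) (hA : s.N .A 0 = A)
    (hig : i < g) (hkey : ∀ i < g, s.N .key ((off + c) * g + i) = key c i) :
    Wp e addRowProg s (fun t s' => t ≤ g * 200 + 100 ∧ Fr [.i2, .bas, .A] [.tb] s s' ∧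
      s'.N .A 0 = A + 1 ∧ s'.N .bas = Function.update (s.N .bas) A 0 ∧
      (∀ z < A * g, s'.R .tb z = s.R .tb z) ∧
      ∀ i2 < g, s'.R .tb (A * g + i2) = if key c i2 = key c i then 1 else 0) := by
  rw [addRowProg, wp_cons]
  refine Wp.mono (wp_for g 120 [] [.tb] (fun y s' => (∀ z < A * g, s'.R .tb z = s.R .tb z) ∧
      ∀ i2 < y, s'.R .tb (A * g + i2) = if key c i2 = key c i then 1 else 0)
      hg (by simp) (by simp) (by simp) (by simp) ?_) ?_
  · intro y hy s' hfr hi2 hP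
    have key' : ∀ v : ℝ, v = (if key c y = key c i then 1 else 0) →
        (∀ z < A * g, (s'.wR .tb (A * g + y) v).R .tb z = s.R .tb z) ∧
        ∀ i2 < y + 1, (s'.wR .tb (A * g + y) v).R .tb (A * g + i2) =
          if key c i2 = key c i then 1 else 0 := by
      intro v hv
      simp only [State.wR_R_same, Function.update_apply]
      refine ⟨fun z hz => by rw [if_neg (by omega), hP.1 z hz], fun i2 h2 => ?_⟩
      split_ifs with h h' h'
      · obtain rfl : i2 = y := by omega
        rw [hv, if_pos h']
      · obtain rfl : i2 = y := by omega
        rw [hv, if_neg h']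
      · rw [hP.2 i2 (by omega), if_pos h']
      · rw [hP.2 i2 (by omega), if_neg h']
    have eN : ∀ c, c ∉ [NV.i2] → s'.N c = s.N c := hfr.n
    simp only [sameKey, keyAt, wp_ite, wp_rsetAt, BExp.holds_and, BExp.holds_not, BExp.holds_natLT,
      NV.eval_at, NExp.eval_add, NExp.eval_mul, NV.eval_v, RExp.eval_ofNat, NExp.eval_lit,
      eN .off (by simp), eN .c (by simp), eN .g (by simp), eN .i (by simp), eN .A (by simp),
      eN .key (by simp), hg, hc, hi, hoff, hA, hi2, hkey i hig, hkey y hy, not_lt]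
    refine ⟨fun h => ⟨by simp, by simp, key' _ ?_⟩, fun h => ⟨by simp, by simp, key' _ ?_⟩⟩
    · rw [if_pos (le_antisymm h.2 h.1)]; simp
    · rw [if_neg fun h' => h ⟨h'.ge, h'.le⟩]; simp
  · rintro t s' ⟨ht, hfr, hP⟩
    have eA : s'.N .A 0 = A := by rw [hfr.n _ (by simp), hA]
    have eb : s'.N .bas = s.N .bas := hfr.n _ (by simp)
    simp only [wp_cons, wp_setAt, wp_set, wp_nil, NExp.eval_add, NV.eval_v, NExp.eval_lit, eA]
    refine ⟨by simp; omega, ?_, by simp [eA], by simp [eb], by simpa using hP⟩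
    rw [Fr.wN_iff (by simp), Fr.wN_iff (by simp)]
    exact hfr.mono (by simp) (by simp)

/-- Set up the tableau whose rows are the indicator functions of the classes with more than `s`
floating points. -/
def rowsProg : Prog := block [NV.A.set (.lit 0),
  forN .c .lk (forN .i .g (block [NV.cnt.set (.lit 0), NV.dup.set (.lit 0),
    forN .i2 .g (.ite sameKey (block [
        .ite (.natLT NV.i2.v NV.i.v) (NV.dup.set (.lit 1)) .skip,
        .ite (floatTest NV.i2.v) (NV.cnt.set (NV.cnt.v + .lit 1)) .skip]) .skip),
    .ite (.and (.natLT NV.dup.v (.lit 1)) (.natLT NV.s.v NV.cnt.v)) addRowProg .skip]))]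

open Classical in
/-- The tableau has one row for each heavy class, and no basic columns yet. -/
theorem wp_rowsProg (s : State) {g lk off sv : ℕ} {key : ℕ → ℕ → ℕ} (hg : s.N .g 0 = g)
    (hlk : s.N .lk 0 = lk) (hoff : s.N .off 0 = off) (hs : s.N .s 0 = sv)
    (hkey : ∀ c < lk, ∀ i < g, s.N .key ((off + c) * g + i) = key c i) :
    Wp e rowsProg s (fun t s' => t ≤ lk * (g * (g * 500 + 500) + 100) + 100 ∧
      Fr [.A, .c, .i, .cnt, .dup, .i2, .bas] [.tb] s s' ∧
      s'.N .A 0 = ∑ c ∈ range lk,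
        #{i ∈ range g | Heavy g sv key (fun i => s.R .x (i + 1)) c i} ∧
      (∀ r < s'.N .A 0, s'.N .bas r = 0) ∧
      ∀ c < lk, ∀ i < g, Heavy g sv key (fun i => s.R .x (i + 1)) c i →
        ∃ r < s'.N .A 0, ∀ i2 < g,
          s'.R .tb (r * g + i2) = if key c i2 = key c i then 1 else 0) := by
  set x : ℕ → ℝ := fun i => s.R .x (i + 1) with hx
  -- The pairs before `(c, i)` in the lexicographic order have been processed.
  set P : ℕ → ℕ → State → Prop := fun c i s' =>
    s'.N .A 0 = ∑ c ∈ range c, #{i ∈ range g | Heavy g sv key x c i} +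
      #{i ∈ range i | Heavy g sv key x c i} ∧
    (∀ r < s'.N .A 0, s'.N .bas r = 0) ∧
    ∀ c', ∀ i' < g, (c' < c ∨ c' = c ∧ i' < i) → Heavy g sv key x c' i' →
        ∃ r < s'.N .A 0, ∀ i2 < g,
          s'.R .tb (r * g + i2) = if key c' i2 = key c' i' then 1 else 0 with hPdef
  have hP0 : ∀ c i s' v (a : NV), a ≠ .A → a ≠ .bas → P c i s' → P c i (s'.wN a 0 v) := by
    intro c i s' v a h1 h2 h
    simp only [hPdef, State.wN_N_ne s' 0 v (Ne.symm h1), State.wN_N_ne s' 0 v (Ne.symm h2)]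
    exact h
  simp only [rowsProg, wp_cons, wp_set]
  refine Wp.mono (wp_for lk (g * (g * 500 + 500) + 50) [.A, .i, .cnt, .dup, .i2, .bas] [.tb]
    (fun c => P c 0) (by simpa using hlk) (by simp) (by simp)
    (fun _ _ _ => hP0 _ _ _ _ _ (by simp) (by simp)) ?_ ?_) ?_
  · refine ⟨by simp, fun r hr => absurd hr (by simp), fun c' i' _ h => ?_⟩
    rcases h with h | h <;> omega
  · intro c hc s1 hfr1 hc1 hP1
    have eg1 : s1.N .g 0 = g := by rw [hfr1.n .g (by simp)]; simpa using hg
    refine Wp.mono (wp_for g (g * 500 + 450) [.A, .cnt, .dup, .i2, .bas] [.tb]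
      (fun i => P c i) eg1 (by simp) (by simp)
      (fun _ _ _ => hP0 _ _ _ _ _ (by simp) (by simp)) hP1 ?_) ?_
    · intro i hi s2 hfr2 hi2 hP2
      have e2 : ∀ a, a ∉ [NV.A, .c, .i, .cnt, .dup, .i2, .bas] → s2.N a = s.N a := by
        intro a ha
        simp only [List.mem_cons, List.not_mem_nil, or_false, not_or] at ha
        rw [hfr2.n a (by simp [ha]), hfr1.n a (by simp [ha]), State.wN_N_ne _ _ _ ha.1]
      have ec2 : s2.N .c 0 = c := by rw [hfr2.n .c (by simp), hc1]
      have ex2 : s2.R .x = s.R .x := by rw [hfr2.r .x (by simp), hfr1.r .x (by simp), State.wN_R]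
      simp only [wp_cons, wp_set]
      refine Wp.mono (wp_for g 150 [.cnt, .dup] []
        (fun y s' => s'.N .cnt 0 = #{i2 ∈ range y | key c i2 = key c i ∧ Floats (x i2)} ∧
          (s'.N .dup 0 < 1 ↔ ∀ i2 < y, i2 < i → key c i2 ≠ key c i))
        (by simp [e2, hg]) (by simp) (by simp) (by simp) (by simp) ?_) ?_
      · intro y hy s3 hfr3 hy3 hP3
        have e3 : ∀ a, a ∉ [NV.A, .c, .i, .cnt, .dup, .i2, .bas] → s3.N a = s.N a := by
          intro a ha
          simp only [List.mem_cons, List.not_mem_nil, or_false, not_or] at ha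
          rw [hfr3.n a (by simp [ha]), State.wN_N_ne _ _ _ (by simp [ha]),
            State.wN_N_ne _ _ _ (by simp [ha]), e2 a (by simp [ha])]
        have ec3 : s3.N .c 0 = c := by
          rw [hfr3.n .c (by simp), State.wN_N_ne _ _ _ (by simp), State.wN_N_ne _ _ _ (by simp),
            ec2]
        have ei3 : s3.N .i 0 = i := by
          rw [hfr3.n .i (by simp), State.wN_N_ne _ _ _ (by simp), State.wN_N_ne _ _ _ (by simp),
            hi2]
        have ex3 : s3.R .x = s.R .x := by rw [hfr3.r .x (by simp), State.wN_R, State.wN_R, ex2]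
        have hxy : s.R .x (y + 1) = x y := rfl
        have hfl : (0 < x y ∧ x y < 1) ↔ Floats (x y) := Iff.rfl
        have hw : ∀ (s : State) (v : ℕ), (s.wN .dup 0 v).N .i2 = s.N .i2 := by simp
        rw [card_filter_range_succ]
        have hd : ∀ p : Prop, (p ↔ ∀ i2 < y, i2 < i → key c i2 ≠ key c i) →
            ((p ∧ (y < i → key c y ≠ key c i)) ↔
              ∀ i2 < y + 1, i2 < i → key c i2 ≠ key c i) := by
          intro p hp
          rw [hp]
          constructor
          · rintro ⟨h1, h2⟩ i2 h3 h4
            rcases Nat.lt_succ_iff_lt_or_eq.mp h3 with h5 | rfl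
            · exact h1 i2 h5 h4
            · exact h2 h4
          · exact fun h => ⟨fun i2 h1 => h i2 (by omega), h y (by omega)⟩
        have hd' := hd _ hP3.2
        simp only [sameKey, keyAt, floatTest, wp_ite, wp_cons, wp_nil, wp_set, wp_skip,
          BExp.holds_and, BExp.holds_not, BExp.holds_natLT, BExp.holds_realLT, RV.eval_at,
          NV.eval_at, NExp.eval_add, NExp.eval_mul, NV.eval_v, RExp.eval_ofNat, NExp.eval_lit,
          e3 .off (by simp), e3 .g (by simp), e3 .key (by simp), ec3, ei3, hg, hoff, hy3,
          hkey c hc i hi, hkey c hc y hy, not_lt, State.wN_R, ex3, hw, hxy, hfl,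
          Nat.cast_zero, Nat.cast_one, ← hd']
        refine ⟨fun h => ⟨fun h1 => ⟨fun h2 => ?_, fun h2 => ?_⟩, fun h1 => ⟨fun h2 => ?_,
          fun h2 => ?_⟩⟩, fun h => ?_⟩
        · refine ⟨by simp, by simp, ?_, ?_⟩
          · simp [hP3.1, le_antisymm h.2 h.1, h2]
          · simp [h1, le_antisymm h.2 h.1]
        · refine ⟨by simp, by simp, ?_, ?_⟩
          · rw [if_neg (fun h' => h2 h'.2), State.wN_N_ne _ _ _ (by simp), hP3.1, add_zero]
          · simp [h1, le_antisymm h.2 h.1]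
        · refine ⟨by simp, by simp, ?_, ?_⟩
          · simp [hP3.1, le_antisymm h.2 h.1, h2]
          · rw [State.wN_N_ne _ _ _ (by simp)]
            exact (and_iff_left fun h' => absurd h' (not_lt.mpr h1)).symm
        · refine ⟨by simp, by simp, ?_, ?_⟩
          · rw [if_neg (fun h' => h2 h'.2), hP3.1, add_zero]
          · exact (and_iff_left fun h' => absurd h' (not_lt.mpr h1)).symm
        · have hne : key c y ≠ key c i := fun h' => h ⟨h'.ge, h'.le⟩
          refine ⟨by simp, by simp, ?_, ?_⟩
          · rw [if_neg (fun h' => hne h'.1), hP3.1, add_zero]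
          · exact (and_iff_left fun _ => hne).symm
      · rintro t s3 ⟨ht3, hfr3, hcnt, hdup⟩
        have e3 : ∀ a, a ∉ [NV.cnt, .dup, .i2] → s3.N a = s2.N a := by
          intro a ha
          simp only [List.mem_cons, List.not_mem_nil, or_false, not_or] at ha
          rw [hfr3.n a (by simp [ha]), State.wN_N_ne _ _ _ (by simp [ha]),
            State.wN_N_ne _ _ _ (by simp [ha])]
        have eR3 : s3.R .tb = s2.R .tb := by rw [hfr3.r _ (by simp), State.wN_R, State.wN_R]
        have hfr3' : Fr [.A, .cnt, .dup, .i2, .bas] [.tb] s2 s3 :=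
          hfr3.comp (by simp) (by simp) (by simp)
        have hH : Heavy g sv key x c i ↔ s3.N .dup 0 < 1 ∧ sv < s3.N .cnt 0 := by
          rw [heavy_iff, hcnt, hdup]
          exact and_congr_left fun _ =>
            ⟨fun h i2 _ h2 => h i2 h2, fun h i2 h2 => h i2 (by omega) h2⟩
        have es : s3.N .s 0 = sv := by rw [e3 _ (by simp), e2 _ (by simp), hs]
        simp only [wp_ite, BExp.holds_and, BExp.holds_natLT, NV.eval_v, NExp.eval_lit, es, ← hH,
          wp_skip, wp_nil]
        refine ⟨fun h => ?_, fun h => ?_⟩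
        · refine Wp.mono (wp_addRowProg s3 (g := g) (c := c) (i := i) (off := off)
            (A := s2.N .A 0) (key := key) (by rw [e3 _ (by simp), e2 _ (by simp), hg])
            (by rw [e3 _ (by simp), ec2]) (by rw [e3 _ (by simp), hi2])
            (by rw [e3 _ (by simp), e2 _ (by simp), hoff]) (by rw [e3 _ (by simp)]) hi
            (by rw [e3 _ (by simp), e2 _ (by simp)]; exact hkey c hc)) ?_
          rintro t4 s4 ⟨ht4, hfr4, hA4, hbas4, htb4, hrow4⟩
          refine ⟨by simp; omega, hfr4.comp (by simp) (by simp) hfr3', ?_, ?_, ?_⟩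
          · rw [hA4, card_filter_range_succ, if_pos h, hP2.1, add_assoc]
          · intro r hr
            rw [hbas4, Function.update_apply, e3 _ (by simp)]
            split_ifs with hr'
            · rfl
            · exact hP2.2.1 r (by omega)
          · intro c' i' hi' hlex hH'
            by_cases hold : c' < c ∨ c' = c ∧ i' < i
            · obtain ⟨r, hr, hrow⟩ := hP2.2.2 c' i' hi' hold hH'
              refine ⟨r, by omega, fun i2 h2 => ?_⟩
              have h3 : (r + 1) * g ≤ s2.N .A 0 * g := Nat.mul_le_mul_right _ hr
              rw [add_mul, one_mul] at h3
              rw [htb4 _ (by omega), eR3, hrow i2 h2]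
            · obtain ⟨rfl, rfl⟩ : c' = c ∧ i' = i := by omega
              exact ⟨s2.N .A 0, by omega, hrow4⟩
        · refine ⟨by simp; omega, hfr3', ?_, ?_, ?_⟩
          · rw [card_filter_range_succ, if_neg h, e3 _ (by simp), hP2.1, add_zero]
          · rw [e3 _ (by simp), e3 _ (by simp)]
            exact hP2.2.1
          · intro c' i' hi' hlex hH'
            by_cases hold : c' < c ∨ c' = c ∧ i' < i
            · rw [e3 _ (by simp), eR3]
              exact hP2.2.2 c' i' hi' hold hH'
            · obtain ⟨rfl, rfl⟩ : c' = c ∧ i' = i := by omega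
              exact absurd hH' h
    · rintro t s2 ⟨ht, hfr2, hP2⟩
      have : g * (g * 500 + 450 + 13) ≤ g * (g * 500 + 500) := Nat.mul_le_mul_left _ (by omega)
      refine ⟨ht.trans (Nat.add_le_add this (by norm_num)), hfr2.mono (by simp) (by simp),
        ?_, hP2.2.1, fun c' i' hi' h => ?_⟩
      · rw [sum_range_succ, hP2.1]
        simp
      · exact hP2.2.2 c' i' hi' (by omega)
  · rintro t s' ⟨ht, hfr, hP⟩
    rw [wp_nil]
    refine ⟨?_, hfr.comp (by simp) (by simp) (by simp), by simpa using hP.1, hP.2.1,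
      fun c hc i hi => hP.2.2 c i hi (Or.inl hc)⟩
    have h1 : lk * (g * (g * 500 + 500) + 50 + 13) ≤ lk * (g * (g * 500 + 500) + 100) :=
      Nat.mul_le_mul_left _ (by omega)
    have h2 := ht.trans (Nat.add_le_add_right h1 10)
    clear h1 ht
    simp only [NExp.cost_lit]
    generalize lk * (g * (g * 500 + 500) + 100) = v at h2 ⊢
    omega

end Rows

/-! ### Simplex rounding -/

/-- The upper bound of the variable with index `b`: index `0` belongs to a dummy variable that is
fixed at `0`, the other variables are the weights. -/
def upper (b : ℕ) : ℝ := ((1 - (1 - b) : ℕ) : ℝ)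

@[simp] theorem upper_zero : upper 0 = 0 := by simp [upper]

theorem upper_of_ne {b : ℕ} (h : b ≠ 0) : upper b = 1 := by
  rw [upper, show 1 - (1 - b) = 1 by omega, Nat.cast_one]

/-- The state of the rounding of `x0` under the constraints with matrix `T0` after the treatment
of the columns before `col`: the current weights are `x`, the null space of the tableau `T` is
contained in that of `T0`, and all floating weights treated so far are basic. -/
structure SimplexInv (g A : ℕ) (x0 : ℕ → ℝ) (T0 : ℕ → ℕ → ℝ) (col : ℕ) (x : ℕ → ℝ)
    (T : ℕ → ℕ → ℝ) (bas : ℕ → ℕ) : Prop where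
  unit : UnitCols A T bas
  bas_le : ∀ r < A, bas r ≤ col
  bas_floats : ∀ r < A, bas r ≠ 0 → Floats (x0 (bas r))
  x_zero : x 0 = 0
  x_mem : ∀ i < g, 0 ≤ x (i + 1) ∧ x (i + 1) ≤ 1
  fixed : ∀ i < g, ¬ Floats (x0 (i + 1)) → x (i + 1) = x0 (i + 1)
  ker : ∀ y : ℕ → ℝ, (∀ r < A, ∑ i ∈ range g, T r i * y i = 0) →
    ∀ r < A, ∑ i ∈ range g, T0 r i * y i = 0
  sum : ∀ r < A, ∑ i ∈ range g, T0 r i * (x (i + 1) - x0 (i + 1)) = 0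
  done : ∀ i < col, Floats (x (i + 1)) → ∃ r < A, bas r = i + 1

namespace SimplexInv

variable {g A col : ℕ} {x0 x : ℕ → ℝ} {T0 T : ℕ → ℕ → ℝ} {bas : ℕ → ℕ}

/-- At the start all rows have the dummy variable as their basic variable. -/
theorem init (hx0 : x0 0 = 0) (hx : ∀ i < g, 0 ≤ x0 (i + 1) ∧ x0 (i + 1) ≤ 1)
    (hbas : ∀ r < A, bas r = 0) : SimplexInv g A x0 T0 0 x0 T0 bas where
  unit r _ r' hr' h0 := absurd (hbas r' hr') h0
  bas_le r hr := (hbas r hr).le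
  bas_floats r hr h0 := absurd (hbas r hr) h0
  x_zero := hx0
  x_mem := hx
  fixed _ _ _ := rfl
  ker _ h := h
  sum r _ := by simp
  done i hi := absurd hi (by omega)

/-- A column whose weight is not floating needs no treatment. -/
theorem skip (h : SimplexInv g A x0 T0 col x T bas) (hf : ¬ Floats (x (col + 1))) :
    SimplexInv g A x0 T0 (col + 1) x T bas where
  unit := h.unit
  bas_le r hr := (h.bas_le r hr).trans (Nat.le_succ _)
  bas_floats := h.bas_floats
  x_zero := h.x_zero
  x_mem := h.x_mem
  fixed := h.fixed
  ker := h.ker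
  sum := h.sum
  done i hi hfl := by
    rcases Nat.lt_succ_iff_lt_or_eq.mp hi with h' | rfl
    · exact h.done i h' hfl
    · exact absurd hfl hf

theorem mem_upper (h : SimplexInv g A x0 T0 col x T bas) (hcol : col ≤ g) {r : ℕ} (hr : r < A) :
    0 ≤ x (bas r) ∧ x (bas r) ≤ upper (bas r) := by
  by_cases h0 : bas r = 0
  · rw [h0, h.x_zero, upper_zero]
    exact ⟨le_rfl, le_rfl⟩
  · have := h.bas_le r hr
    have h1 := h.x_mem (bas r - 1) (by omega)
    rw [show bas r - 1 + 1 = bas r by omega] at h1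
    rwa [upper_of_ne h0]

/-- One simplex step: the variable of the column `col` is increased by the largest possible
amount `θ`. -/
theorem step (h : SimplexInv g A x0 T0 col x T bas) (hcol : col < g) (hf : Floats (x (col + 1)))
    {θ : ℝ} (hθ0 : 0 ≤ θ) (hθ1 : θ ≤ 1 - x (col + 1))
    (hθ : ∀ r < A, 0 ≤ x (bas r) - θ * T r col ∧ x (bas r) - θ * T r col ≤ upper (bas r))
    {T' : ℕ → ℕ → ℝ} {bas' : ℕ → ℕ}
    (hor : (θ = 1 - x (col + 1) ∧ (∀ r < A, ∀ i < g, T' r i = T r i) ∧ ∀ r < A, bas' r = bas r) ∨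
      ∃ q < A, T q col ≠ 0 ∧
        (x (bas q) - θ * T q col = 0 ∨ x (bas q) - θ * T q col = upper (bas q)) ∧
        (∀ r < A, ∀ i < g, T' r i = pivoted T q col r i) ∧
        ∀ r < A, bas' r = Function.update bas q (col + 1) r) :
    SimplexInv g A x0 T0 (col + 1) (moved A T bas col θ x) T' bas' := by
  have hnb : ∀ r < A, bas r ≠ col + 1 := fun r hr => by have := h.bas_le r hr; omega
  -- A dummy variable is fixed at `0`, so it blocks the step unless its row vanishes in the column.
  have hdum : ∀ r < A, bas r = 0 → θ * T r col = 0 := by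
    intro r hr h0
    have := hθ r hr
    rw [h0, h.x_zero, upper_zero] at this
    linarith
  have hbg : ∀ r < A, bas r ≤ g := fun r hr => (h.bas_le r hr).trans hcol.le
  have hfl0 : Floats (x0 (col + 1)) := by
    by_contra hc
    exact hc (h.fixed col hcol hc ▸ hf)
  have hmem : ∀ i < g, 0 ≤ moved A T bas col θ x (i + 1) ∧ moved A T bas col θ x (i + 1) ≤ 1 := by
    intro i hi
    by_cases hic : i = col
    · subst hic
      rw [moved_self hnb]
      exact ⟨add_nonneg hf.1.le hθ0, by linarith⟩
    · by_cases hb : ∃ r < A, bas r = i + 1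
      · obtain ⟨r, hr, hb⟩ := hb
        have h0 : bas r ≠ 0 := by omega
        rw [← hb, moved_basic h.unit hr hnb h0]
        have := hθ r hr
        rwa [upper_of_ne h0] at this
      · push Not at hb
        rw [moved_of_notMem hb (by omega)]
        exact h.x_mem i hi
  have hfix : ∀ i < g, ¬ Floats (x0 (i + 1)) →
      moved A T bas col θ x (i + 1) = x0 (i + 1) := by
    intro i hi hnf
    have hb : ∀ r < A, bas r ≠ i + 1 := fun r hr hb =>
      hnf (hb ▸ h.bas_floats r hr (by omega))
    rw [moved_of_notMem hb fun hc => hnf (by rw [hc]; exact hfl0), h.fixed i hi hnf]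
  have hsum : ∀ r < A, ∑ i ∈ range g,
      T0 r i * (moved A T bas col θ x (i + 1) - x0 (i + 1)) = 0 := by
    intro r hr
    have h1 := h.ker (fun i => moved A T bas col θ x (i + 1) - x (i + 1))
      (fun r' hr' => sum_mul_moved h.unit hbg hcol hdum x hr') r hr
    have h2 := h.sum r hr
    have h3 : ∀ i, T0 r i * (moved A T bas col θ x (i + 1) - x0 (i + 1)) =
        T0 r i * (moved A T bas col θ x (i + 1) - x (i + 1)) +
          T0 r i * (x (i + 1) - x0 (i + 1)) := fun i => by ring
    rw [sum_congr rfl fun i _ => h3 i, sum_add_distrib, h1, h2, add_zero]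
  have hsplit : ∀ i < col, Floats (moved A T bas col θ x (i + 1)) → ∃ r < A, bas r = i + 1 := by
    intro i hi hfl
    by_contra hb
    push Not at hb
    rw [moved_of_notMem hb (by omega)] at hfl
    obtain ⟨r, hr, hb'⟩ := h.done i hi hfl
    exact hb r hr hb'
  rcases hor with ⟨hθe, hT', hb'⟩ | ⟨q, hq, hd, hqb, hT', hb'⟩
  · refine ⟨?_, ?_, ?_, ?_, hmem, hfix, ?_, hsum, ?_⟩
    · intro r hr r' hr' h0
      rw [hb' r' hr'] at h0 ⊢
      have := hbg r' hr'
      rw [hT' r hr _ (by omega)]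
      exact h.unit r hr r' hr' h0
    · intro r hr
      rw [hb' r hr]
      exact (h.bas_le r hr).trans (Nat.le_succ _)
    · intro r hr h0
      rw [hb' r hr] at h0 ⊢
      exact h.bas_floats r hr h0
    · rw [moved_zero hdum, h.x_zero]
    · intro y hy
      refine h.ker y fun r hr => ?_
      rw [← hy r hr]
      exact sum_congr rfl fun i hi => by rw [hT' r hr i (mem_range.mp hi)]
    · intro i hi hfl
      rcases Nat.lt_succ_iff_lt_or_eq.mp hi with h' | rfl
      · obtain ⟨r, hr, hb⟩ := hsplit i h' hfl
        exact ⟨r, hr, by rw [hb' r hr, hb]⟩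
      · -- The entering variable has reached `1`.
        rw [moved_self hnb, hθe] at hfl
        exact absurd hfl.2 (by linarith)
  · have hbup : ∀ r < A, bas' r ≤ col + 1 := by
      intro r hr
      rw [hb' r hr, Function.update_apply]
      split_ifs
      · exact le_rfl
      · exact (h.bas_le r hr).trans (Nat.le_succ _)
    refine ⟨?_, hbup, ?_, ?_, hmem, hfix, ?_, hsum, ?_⟩
    · intro r hr r' hr' h0
      have := hbup r' hr'
      rw [hT' r hr _ (by omega), hb' r' hr']
      rw [hb' r' hr'] at h0
      exact h.unit.pivoted hq hd r hr r' hr' h0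
    · intro r hr h0
      rw [hb' r hr, Function.update_apply] at h0 ⊢
      split_ifs at h0 ⊢
      · exact hfl0
      · exact h.bas_floats r hr h0
    · rw [moved_zero hdum, h.x_zero]
    · intro y hy
      refine h.ker y (sum_mul_of_pivoted hq hd fun r hr => ?_)
      rw [← hy r hr]
      exact sum_congr rfl fun i hi => by rw [hT' r hr i (mem_range.mp hi)]
    · intro i hi hfl
      rcases Nat.lt_succ_iff_lt_or_eq.mp hi with h' | rfl
      · obtain ⟨r, hr, hb⟩ := hsplit i h' hfl
        by_cases hrq : r = q
        · -- The variable that leaves the basis sits at one of its bounds.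
          subst hrq
          have h0 : bas r ≠ 0 := by omega
          rw [← hb, moved_basic h.unit hr hnb h0] at hfl
          rw [upper_of_ne h0] at hqb
          rcases hqb with hqb | hqb
          · exact absurd hfl.1 (by rw [hqb]; exact lt_irrefl _)
          · exact absurd hfl.2 (by rw [hqb]; exact lt_irrefl _)
        · exact ⟨r, hr, by rw [hb' r hr, Function.update_of_ne hrq, hb]⟩
      · exact ⟨q, hq, by rw [hb' q hq, Function.update_self]⟩

open Classical in
/-- A basic solution has at most one floating weight for each constraint. -/
theorem card_floats_le (h : SimplexInv g A x0 T0 g x T bas) :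
    #{i ∈ range g | Floats (x (i + 1))} ≤ A := by
  rw [← card_range A]
  refine (card_le_card (t := (range A).image fun r => bas r - 1) fun i hi => ?_).trans
    card_image_le
  rw [mem_filter, mem_range] at hi
  obtain ⟨r, hr, hb⟩ := h.done i hi.1 hi.2
  exact mem_image.mpr ⟨r, mem_range.mpr hr, by omega⟩

end SimplexInv

section Simplex

variable {X : Type*} {K : ℕ} {e : Env X K}

/-- The tableau in the memory. -/
def State.tab (s : State) (g r i : ℕ) : ℝ := s.R .tb (r * g + i)

/-- Find the largest amount `th` by which the variable of the column `col` can be increased.  If a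
basic variable stops the increase, `pr - 1` is its row. -/
def ratioProg : Prog := block [RV.th.set (.ofNat (.lit 1) - RV.x.at (NV.col.v + .lit 1)),
  NV.pr.set (.lit 0),
  forN .i .A (block [RV.d.set (RV.tb.at (NV.i.v * NV.g.v + NV.col.v)),
    RV.y.set (RV.x.at (NV.bas.at NV.i.v)),
    RV.u.set (.ofNat (.lit 1 - (.lit 1 - NV.bas.at NV.i.v)) - RV.y.v),
    .ite (.realLT (.ofNat (.lit 0)) RV.d.v)
      (.ite (.realLT RV.y.v (RV.th.v * RV.d.v))
        (block [RV.th.set (RV.y.v / RV.d.v), NV.pr.set (NV.i.v + .lit 1)]) .skip)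
      (.ite (.and (.realLT RV.d.v (.ofNat (.lit 0)))
          (.realLT RV.u.v (RV.th.v * (.ofNat (.lit 0) - RV.d.v))))
        (block [RV.th.set (RV.u.v / (.ofNat (.lit 0) - RV.d.v)), NV.pr.set (NV.i.v + .lit 1)])
        .skip)])]

/-- The bounds of a basic variable hold on an interval of step lengths that contains `0`. -/
theorem shrink {y θ θ' d u : ℝ} (hy0 : 0 ≤ y) (hyu : y ≤ u) (h : 0 ≤ y - θ * d ∧ y - θ * d ≤ u)
    (h0 : 0 ≤ θ') (hle : θ' ≤ θ) : 0 ≤ y - θ' * d ∧ y - θ' * d ≤ u := by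
  rcases le_total 0 d with hd | hd
  · have h1 := mul_le_mul_of_nonneg_right hle hd
    have h2 := mul_nonneg h0 hd
    constructor <;> linarith
  · have h1 := mul_le_mul_of_nonpos_right hle hd
    have h2 := mul_nonpos_of_nonneg_of_nonpos h0 hd
    constructor <;> linarith

/-- The ratio test: after the step of length `th` all basic variables keep their bounds, and either
the entering variable has reached `1` or the basic variable of the row `pr - 1` one of its bounds. -/
theorem wp_ratioProg (s : State) {g A col : ℕ} (hg : s.N .g 0 = g) (hA : s.N .A 0 = A)
    (hcol : s.N .col 0 = col) (hx1 : s.R .x (col + 1) ≤ 1)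
    (hb : ∀ r < A, 0 ≤ s.R .x (s.N .bas r) ∧ s.R .x (s.N .bas r) ≤ upper (s.N .bas r)) :
    Wp e ratioProg s (fun t s' => t ≤ A * 200 + 100 ∧ Fr [.i, .pr] [.th, .d, .y, .u] s s' ∧
      0 ≤ s'.R .th 0 ∧ s'.R .th 0 ≤ 1 - s.R .x (col + 1) ∧
      (∀ r < A, 0 ≤ s.R .x (s.N .bas r) - s'.R .th 0 * s.tab g r col ∧
        s.R .x (s.N .bas r) - s'.R .th 0 * s.tab g r col ≤ upper (s.N .bas r)) ∧
      (s'.N .pr 0 = 0 → s'.R .th 0 = 1 - s.R .x (col + 1)) ∧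
      ∀ q, s'.N .pr 0 = q + 1 → q < A ∧ s.tab g q col ≠ 0 ∧
        (s.R .x (s.N .bas q) - s'.R .th 0 * s.tab g q col = 0 ∨
          s.R .x (s.N .bas q) - s'.R .th 0 * s.tab g q col = upper (s.N .bas q))) := by
  simp only [ratioProg, wp_cons, wp_set, wp_rset]
  refine Wp.mono (wp_for A 150 [.pr] [.th, .d, .y, .u] (fun z s' =>
      0 ≤ s'.R .th 0 ∧ s'.R .th 0 ≤ 1 - s.R .x (col + 1) ∧
      (∀ r < z, 0 ≤ s.R .x (s.N .bas r) - s'.R .th 0 * s.tab g r col ∧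
        s.R .x (s.N .bas r) - s'.R .th 0 * s.tab g r col ≤ upper (s.N .bas r)) ∧
      (s'.N .pr 0 = 0 → s'.R .th 0 = 1 - s.R .x (col + 1)) ∧
      ∀ q, s'.N .pr 0 = q + 1 → q < A ∧ s.tab g q col ≠ 0 ∧
        (s.R .x (s.N .bas q) - s'.R .th 0 * s.tab g q col = 0 ∨
          s.R .x (s.N .bas q) - s'.R .th 0 * s.tab g q col = upper (s.N .bas q)))
    (by simpa using hA) (by simp) (by simp) (by simp) ?_ ?_) ?_
  · simp [hcol, hx1]
  · intro z hz s' hfr hi hP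
    obtain ⟨p1, p2, p3, p4, p5⟩ := hP
    have eg : s'.N .g 0 = g := by rw [hfr.n .g (by simp)]; simpa using hg
    have ecol : s'.N .col 0 = col := by rw [hfr.n .col (by simp)]; simpa using hcol
    have ebas : s'.N .bas = s.N .bas := by rw [hfr.n .bas (by simp)]; simp
    have ex : s'.R .x = s.R .x := by rw [hfr.r .x (by simp)]; simp
    have etb : s'.R .tb = s.R .tb := by rw [hfr.r .tb (by simp)]; simp
    obtain ⟨b1, b2⟩ := hb z hz
    have hd : s.R .tb (z * g + col) = s.tab g z col := rfl
    have hup : ((1 - (1 - s.N .bas z) : ℕ) : ℝ) = upper (s.N .bas z) := rfl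
    have keep : 0 ≤ s.R .x (s.N .bas z) - s'.R .th 0 * s.tab g z col ∧
        s.R .x (s.N .bas z) - s'.R .th 0 * s.tab g z col ≤ upper (s.N .bas z) →
        ∀ r < z + 1, 0 ≤ s.R .x (s.N .bas r) - s'.R .th 0 * s.tab g r col ∧
        s.R .x (s.N .bas r) - s'.R .th 0 * s.tab g r col ≤ upper (s.N .bas r) := by
      intro h r hr
      rcases Nat.lt_succ_iff_lt_or_eq.mp hr with h' | rfl
      · exact p3 r h'
      · exact h
    have change : ∀ θ, 0 ≤ θ → θ ≤ s'.R .th 0 →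
        0 ≤ s.R .x (s.N .bas z) - θ * s.tab g z col ∧
          s.R .x (s.N .bas z) - θ * s.tab g z col ≤ upper (s.N .bas z) →
        ∀ r < z + 1, 0 ≤ s.R .x (s.N .bas r) - θ * s.tab g r col ∧
        s.R .x (s.N .bas r) - θ * s.tab g r col ≤ upper (s.N .bas r) := by
      intro θ h0 hle h r hr
      rcases Nat.lt_succ_iff_lt_or_eq.mp hr with h' | rfl
      · exact shrink (hb r (by omega)).1 (hb r (by omega)).2 (p3 r h') h0 hle
      · exact h
    simp only [wp_rset, wp_ite, wp_cons, wp_nil, wp_set, wp_skip, BExp.holds_and,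
      BExp.holds_realLT, RExp.eval_ofNat, RExp.eval_sub, RExp.eval_mul, RExp.eval_div, RV.eval_at,
      RV.eval_v, NV.eval_at, NV.eval_v, NExp.eval_add, NExp.eval_sub, NExp.eval_mul, NExp.eval_lit,
      State.wR_N, State.wR_R_same, State.wN_R, State.wR_R_ne, ne_eq, reduceCtorEq,
      not_false_eq_true, Function.update_self, eg, ecol, ebas, ex, etb, hi, hd, hup, Nat.cast_zero,
      zero_sub]
    set D := s.tab g z col with hD
    set Y := s.R .x (s.N .bas z) with hY
    set U := upper (s.N .bas z) with hU
    set θ := s'.R .th 0 with hθ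
    refine ⟨fun h1 => ⟨fun h2 => ?_, fun h2 => ?_⟩, fun h1 => ⟨fun h2 => ?_, fun h2 => ?_⟩⟩
    · have e0 : Y - Y / D * D = 0 := by field_simp; ring
      have hle : Y / D ≤ θ := by rw [div_le_iff₀ h1]; exact h2.le
      have hnn : 0 ≤ Y / D := div_nonneg b1 h1.le
      refine ⟨by simp, by simp, ?_, ?_, ?_, ?_, ?_⟩
      · simpa using hnn
      · simpa using hle.trans p2
      · simpa using change _ hnn hle (by rw [e0]; exact ⟨le_rfl, b1.trans b2⟩)
      · simp
      · intro q hq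
        obtain rfl : z = q := by simpa using hq
        refine ⟨hz, h1.ne', Or.inl ?_⟩
        simpa using e0
    · refine ⟨by simp, by simp, ?_, ?_, ?_, ?_, ?_⟩
      · simpa using p1
      · simpa using p2
      · have hDθ := mul_nonneg p1 h1.le
        simpa using keep ⟨by linarith, by linarith⟩
      · simpa using p4
      · simpa using p5
    · have hD0 : 0 < -D := by linarith [h2.1]
      have e0 : Y - (U - Y) / -D * D = U := by
        have : D ≠ 0 := by linarith
        field_simp
        ring
      have hle : (U - Y) / -D ≤ θ := by rw [div_le_iff₀ hD0]; exact h2.2.le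
      have hnn : 0 ≤ (U - Y) / -D := div_nonneg (by linarith) hD0.le
      refine ⟨by simp, by simp, ?_, ?_, ?_, ?_, ?_⟩
      · simpa using hnn
      · simpa using hle.trans p2
      · simpa using change _ hnn hle (by rw [e0]; exact ⟨b1.trans b2, le_rfl⟩)
      · simp
      · intro q hq
        obtain rfl : z = q := by simpa using hq
        refine ⟨hz, by rw [← hD]; linarith, Or.inr ?_⟩
        simpa using e0
    · have hk : 0 ≤ Y - θ * D ∧ Y - θ * D ≤ U := by
        rcases (not_lt.mp h1).lt_or_eq with h3 | h3
        · have h4 : ¬ U - Y < θ * -D := fun h => h2 ⟨h3, h⟩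
          have h5 := mul_nonpos_of_nonneg_of_nonpos p1 h3.le
          constructor <;> linarith
        · rw [h3, mul_zero, sub_zero]
          exact ⟨b1, b2⟩
      refine ⟨by simp, by simp, ?_, ?_, ?_, ?_, ?_⟩
      · simpa using p1
      · simpa using p2
      · simpa using keep hk
      · simpa using p4
      · simpa using p5
  · rintro t s' ⟨ht, hfr, hP⟩
    rw [wp_nil]
    refine ⟨by simp; omega, hfr.comp (by simp) (by simp) (by simp), hP⟩

/-- Increase the variable of the column `col` by `th`. -/
def moveProg : Prog := block [
  forN .i .A (RV.x.setAt (NV.bas.at NV.i.v)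
    (RV.x.at (NV.bas.at NV.i.v) - RV.th.v * RV.tb.at (NV.i.v * NV.g.v + NV.col.v))),
  RV.x.setAt (NV.col.v + .lit 1) (RV.x.at (NV.col.v + .lit 1) + RV.th.v)]

theorem wp_moveProg (s : State) {g A col : ℕ} (hg : s.N .g 0 = g) (hA : s.N .A 0 = A)
    (hcol : s.N .col 0 = col) :
    Wp e moveProg s (fun t s' => t ≤ A * 100 + 100 ∧ Fr [.i] [.x] s s' ∧
      s'.R .x = moved A (s.tab g) (s.N .bas) col (s.R .th 0) (s.R .x)) := by
  rw [moveProg, wp_cons]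
  refine Wp.mono (wp_for A 50 [] [.x] (fun z s' => ∀ m, s'.R .x m = s.R .x m -
      s.R .th 0 * ∑ r ∈ range z, if s.N .bas r = m then s.tab g r col else 0)
    hA (by simp) (by simp) (by simp) (by simp) ?_) ?_
  · intro z hz s' hfr hi hP
    simp only [wp_rsetAt, RExp.eval_sub, RExp.eval_mul, RV.eval_at, RV.eval_v, NV.eval_at,
      NV.eval_v, NExp.eval_add, NExp.eval_mul, hi, hfr.n .bas (by simp), hfr.n .g (by simp),
      hfr.n .col (by simp), hfr.r .th (by simp), hfr.r .tb (by simp), hg, hcol]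
    refine ⟨by simp, by simp, fun m => ?_⟩
    rw [State.wR_R_same, Function.update_apply, sum_range_succ, hP, hP m]
    by_cases h : m = s.N .bas z
    · rw [if_pos h, if_pos h.symm, h, State.tab]
      ring
    · rw [if_neg h, if_neg (Ne.symm h), add_zero]
  · rintro t s' ⟨ht, hfr, hP⟩
    simp only [wp_cons, wp_nil, wp_rsetAt, RExp.eval_add, RV.eval_at, RV.eval_v,
      NV.eval_v, NExp.eval_add, NExp.eval_lit, hfr.n .col (by simp), hfr.r .th (by simp), hcol]
    refine ⟨by simp; omega, ?_, ?_⟩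
    · rw [Fr.wR_iff (by simp)]
      exact hfr
    · funext m
      rw [State.wR_R_same, Function.update_apply, moved, hP, hP m]
      by_cases h : m = col + 1
      · rw [if_pos h, if_pos h, h]
      · rw [if_neg h, if_neg h, add_zero]

/-- The pivot step with pivot row `q` and pivot column `col`. -/
def pivotProg : Prog := block [RV.d.set (RV.tb.at (NV.q.v * NV.g.v + NV.col.v)),
  forN .i2 .g (RV.tb.setAt (NV.q.v * NV.g.v + NV.i2.v)
    (RV.tb.at (NV.q.v * NV.g.v + NV.i2.v) / RV.d.v)),
  forN .i .A (.ite (.and (.not (.natLT NV.i.v NV.q.v)) (.not (.natLT NV.q.v NV.i.v))) .skip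
    (block [RV.d.set (RV.tb.at (NV.i.v * NV.g.v + NV.col.v)),
      forN .i2 .g (RV.tb.setAt (NV.i.v * NV.g.v + NV.i2.v)
        (RV.tb.at (NV.i.v * NV.g.v + NV.i2.v) -
          RV.d.v * RV.tb.at (NV.q.v * NV.g.v + NV.i2.v)))])),
  NV.bas.setAt NV.q.v (NV.col.v + .lit 1)]

theorem State.tab_wR (s : State) {g r i r' i' : ℕ} (hi : i < g) (hi' : i' < g) (v : ℝ) :
    (s.wR .tb (r * g + i) v).tab g r' i' = if r' = r ∧ i' = i then v else s.tab g r' i' := by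
  rw [State.tab, State.wR_R_same, Function.update_apply]
  simp only [mul_add_inj hi' hi, State.tab]

theorem wp_pivotProg (s : State) {g A col q : ℕ} (hg : s.N .g 0 = g) (hA : s.N .A 0 = A)
    (hcol : s.N .col 0 = col) (hq : s.N .q 0 = q) (hqA : q < A) (hcg : col < g) :
    Wp e pivotProg s (fun t s' => t ≤ A * (g * 100 + 100) + g * 100 + 100 ∧
      Fr [.i2, .i, .bas] [.tb, .d] s s' ∧
      (∀ r < A, ∀ i < g, s'.tab g r i = pivoted (s.tab g) q col r i) ∧
      s'.N .bas = Function.update (s.N .bas) q (col + 1)) := by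
  have htab : ∀ (s' s : State), s'.R .tb = s.R .tb → s'.tab g = s.tab g := by
    intro s' s h
    funext r i
    rw [State.tab, State.tab, h]
  simp only [pivotProg, wp_cons, wp_rset]
  refine Wp.mono (wp_for g 50 [] [.tb] (fun z s' => ∀ r < A, ∀ i < g, s'.tab g r i =
      if r = q ∧ i < z then s.tab g q i / s.tab g q col else s.tab g r i)
    (by simpa using hg) (by simp) (by simp) (fun _ _ _ h => h) (by
      intro r _ i _
      rw [if_neg (by omega), htab _ s (by simp)]) ?_) ?_
  · intro z hz s1 hfr1 hi1 hP1
    have et : s1.R .tb (q * g + z) = s.tab g q z := by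
      have := hP1 q hqA z hz
      rwa [if_neg (by omega)] at this
    have ed : s1.R .d 0 = s.tab g q col := by
      rw [hfr1.r .d (by simp)]
      simp [hg, hcol, hq, State.tab]
    simp only [wp_rsetAt, RExp.eval_div, RV.eval_at, RV.eval_v, NV.eval_v, NExp.eval_add,
      NExp.eval_mul, hi1, hfr1.n .q (by simp), hfr1.n .g (by simp), State.wR_N, hg, hq, et, ed]
    refine ⟨by simp, by simp, fun r hr i hi => ?_⟩
    rw [State.tab_wR _ hz hi, hP1 r hr i hi]
    by_cases h1 : r = q ∧ i = z
    · rw [if_pos h1, if_pos ⟨h1.1, by omega⟩, h1.2]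
    · rw [if_neg h1]
      by_cases h2 : r = q ∧ i < z
      · rw [if_pos h2, if_pos ⟨h2.1, by omega⟩]
      · rw [if_neg h2, if_neg (by omega)]
  rintro t1 s1 ⟨ht1, hfr1, hP1⟩
  have hpq : ∀ i < g, pivoted (s.tab g) q col q i = s.tab g q i / s.tab g q col := by
    intro i _
    simp [pivoted]
  have e1 : ∀ c, c ∉ [NV.i2] → s1.N c = s.N c := fun c hc => by
    rw [hfr1.n c hc, State.wR_N]
  refine Wp.mono (wp_for A (g * 100 + 80) [.i2] [.tb, .d] (fun y s' => ∀ r < A, ∀ i < g,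
      s'.tab g r i = if r = q ∨ r < y then pivoted (s.tab g) q col r i else s.tab g r i)
    (by rw [e1 _ (by simp), hA]) (by simp) (by simp) (fun _ _ _ h => h) ?_ ?_) ?_
  · intro r hr i hi
    rw [hP1 r hr i hi]
    by_cases h : r = q
    · subst h
      rw [if_pos ⟨rfl, hi⟩, if_pos (Or.inl rfl), hpq i hi]
    · rw [if_neg (fun h' => h h'.1), if_neg (by omega)]
  · intro y hy s2 hfr2 hi2 hP2
    have e2 : ∀ c, c ∉ [NV.i, .i2] → s2.N c = s.N c := fun c hc => by
      simp only [List.mem_cons, List.not_mem_nil, or_false, not_or] at hc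
      rw [hfr2.n c (by simp [hc]), e1 c (by simp [hc])]
    simp only [wp_ite, wp_skip, BExp.holds_and, BExp.holds_not, BExp.holds_natLT, NV.eval_v,
      hi2, e2 .q (by simp), hq, not_lt]
    refine ⟨fun h => ?_, fun h => ?_⟩
    · obtain rfl : y = q := le_antisymm h.2 h.1
      refine ⟨by simp, by simp, fun r hr i hi => ?_⟩
      rw [hP2 r hr i hi]
      by_cases h1 : r = y ∨ r < y
      · rw [if_pos h1, if_pos (by omega)]
      · rw [if_neg h1, if_neg (by omega)]
    · have hyq : y ≠ q := fun h' => h ⟨h'.ge, h'.le⟩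
      simp only [wp_cons, wp_rset]
      refine Wp.mono (wp_for g 60 [] [.tb] (fun z s' => ∀ r < A, ∀ i < g, s'.tab g r i =
          if r = q ∨ r < y ∨ (r = y ∧ i < z) then pivoted (s.tab g) q col r i else s.tab g r i)
        (by rw [State.wR_N, e2 _ (by simp), hg]) (by simp) (by simp) (fun _ _ _ h => h) (by
          intro r hr i hi
          rw [htab _ s2 (by simp), hP2 r hr i hi]
          congr 1
          simp) ?_) ?_
      · intro z hz s3 hfr3 hi3 hP3
        have eyz : s3.R .tb (y * g + z) = s.tab g y z := by
          have := hP3 y hy z hz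
          rwa [if_neg (by omega)] at this
        have eqz : s3.R .tb (q * g + z) = pivoted (s.tab g) q col q z := by
          have := hP3 q hqA z hz
          rwa [if_pos (by simp)] at this
        have ed : s3.R .d 0 = s.tab g y col := by
          rw [hfr3.r .d (by simp)]
          have := hP2 y hy col hcg
          rw [if_neg (by omega)] at this
          simpa [hi2, e2, hg, hcol, State.tab] using this
        have e3 : ∀ c, c ∉ [NV.i2] → s3.N c = s2.N c := fun c hc => by
          rw [hfr3.n c hc, State.wR_N]
        simp only [wp_rsetAt, RExp.eval_sub, RExp.eval_mul, RV.eval_at, RV.eval_v, NV.eval_v,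
          NExp.eval_add, NExp.eval_mul, hi3, e3 .q (by simp), e3 .g (by simp), e3 .i (by simp),
          e2 .q (by simp), e2 .g (by simp), hi2, hg, hq, eyz, eqz, ed]
        refine ⟨by simp, by simp, fun r hr i hi => ?_⟩
        rw [State.tab_wR _ hz hi, hP3 r hr i hi]
        by_cases h1 : r = y ∧ i = z
        · rw [if_pos h1, if_pos (by omega), h1.1, h1.2, hpq z hz, pivoted, if_neg hyq]
        · rw [if_neg h1]
          by_cases h2 : r = q ∨ r < y ∨ (r = y ∧ i < z)
          · rw [if_pos h2, if_pos (by omega)]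
          · rw [if_neg h2, if_neg (by omega)]
      · rintro t3 s3 ⟨ht3, hfr3, hP3⟩
        rw [wp_nil]
        refine ⟨by simp; omega, hfr3.comp (by simp) (by simp) (by simp), fun r hr i hi => ?_⟩
        rw [hP3 r hr i hi]
        by_cases h1 : r = q ∨ r < y + 1
        · rw [if_pos h1, if_pos (by omega)]
        · rw [if_neg h1, if_neg (by omega)]
  · rintro t2 s2 ⟨ht2, hfr2, hP2⟩
    have e2 : ∀ c, c ∉ [NV.i, .i2] → s2.N c = s.N c := fun c hc => by
      simp only [List.mem_cons, List.not_mem_nil, or_false, not_or] at hc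
      rw [hfr2.n c (by simp [hc]), e1 c (by simp [hc])]
    simp only [wp_setAt, wp_nil, NV.eval_v, NExp.eval_add, NExp.eval_lit,
      e2 .q (by simp), e2 .col (by simp), hq, hcol]
    refine ⟨?_, ?_, fun r hr i hi => ?_, by simp [e2]⟩
    · have h1 : A * (g * 100 + 80 + 13) ≤ A * (g * 100 + 100) := Nat.mul_le_mul_left _ (by omega)
      have h2 := ht2.trans (Nat.add_le_add_right h1 10)
      clear h1 ht2
      simp
      generalize A * (g * 100 + 100) = v at h2 ⊢
      omega
    · rw [Fr.wN_iff (by simp)]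
      exact hfr2.comp (by simp) (by simp) (hfr1.comp (by simp) (by simp) (by simp))
    · have := hP2 r hr i hi
      rw [if_pos (Or.inr hr)] at this
      exact this

/-- Round the floating weights to a vertex of the polytope of all weights between `0` and `1` that
satisfy the constraints. -/
def simplexProg : Prog := forN .col .g (.ite (floatTest NV.col.v) (block [ratioProg, moveProg,
  .ite (.natLT (.lit 0) NV.pr.v) (block [NV.q.set (NV.pr.v - .lit 1), pivotProg]) .skip]) .skip)

/-- A single pass over the columns turns the weights into a basic solution. -/
theorem wp_simplexProg (s : State) {g A : ℕ} (hg : s.N .g 0 = g) (hA : s.N .A 0 = A)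
    (hx0 : s.R .x 0 = 0) (hx : ∀ i < g, 0 ≤ s.R .x (i + 1) ∧ s.R .x (i + 1) ≤ 1)
    (hbas : ∀ r < A, s.N .bas r = 0) :
    Wp e simplexProg s (fun t s' => t ≤ g * (A * (g * 100 + 500) + g * 100 + 500) + 100 ∧
      Fr [.col, .i, .pr, .q, .i2, .bas] [.th, .d, .y, .u, .x, .tb] s s' ∧
      SimplexInv g A (s.R .x) (s.tab g) g (s'.R .x) (s'.tab g) (s'.N .bas)) := by
  rw [simplexProg]
  refine Wp.mono (wp_for g (A * (g * 100 + 450) + g * 100 + 450) [.i, .pr, .q, .i2, .bas]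
    [.th, .d, .y, .u, .x, .tb] (fun z s' => SimplexInv g A (s.R .x) (s.tab g) z (s'.R .x)
      (s'.tab g) (s'.N .bas)) hg (by simp) (by simp) ?_ (SimplexInv.init hx0 hx hbas) ?_) ?_
  · intro x s' v h
    rw [State.wN_N_ne _ _ _ (by simp)]
    exact h
  · intro z hz s1 hfr1 hi1 hP1
    have eg : s1.N .g 0 = g := by rw [hfr1.n _ (by simp), hg]
    have eA : s1.N .A 0 = A := by rw [hfr1.n _ (by simp), hA]
    simp only [floatTest, wp_ite, wp_skip, BExp.holds_and, BExp.holds_realLT, RV.eval_at,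
      NExp.eval_add, NV.eval_v, NExp.eval_lit, hi1, RExp.eval_ofNat, Nat.cast_zero, Nat.cast_one]
    refine ⟨fun h => ?_, fun h => ⟨by simp, by simp, hP1.skip h⟩⟩
    rw [wp_cons]
    refine Wp.mono (wp_ratioProg s1 (g := g) (A := A) (col := z) eg eA hi1 h.2.le
      (fun r hr => hP1.mem_upper hz.le hr)) ?_
    rintro t2 s2 ⟨ht2, hfr2, q1, q2, q3, q4, q5⟩
    rw [wp_cons]
    refine Wp.mono (wp_moveProg s2 (g := g) (A := A) (col := z) (by rw [hfr2.n _ (by simp), eg])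
      (by rw [hfr2.n _ (by simp), eA]) (by rw [hfr2.n _ (by simp), hi1])) ?_
    rintro t3 s3 ⟨ht3, hfr3, hx3⟩
    have etab2 : s2.tab g = s1.tab g := by
      funext r i
      rw [State.tab, State.tab, hfr2.r _ (by simp)]
    have etab3 : s3.tab g = s1.tab g := by
      rw [← etab2]
      funext r i
      rw [State.tab, State.tab, hfr3.r _ (by simp)]
    have ebas3 : s3.N .bas = s1.N .bas := by rw [hfr3.n _ (by simp), hfr2.n _ (by simp)]
    rw [etab2, hfr2.n .bas (by simp), hfr2.r .x (by simp)] at hx3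
    have hfr3' : Fr [.i, .pr, .q, .i2, .bas] [.th, .d, .y, .u, .x, .tb] s1 s3 :=
      hfr3.comp (by simp) (by simp) (hfr2.mono (by simp) (by simp))
    have hts : A * (g * 100 + 450) = 100 * (A * g) + 450 * A := by ring
    simp only [wp_cons, wp_ite, wp_skip, wp_nil, BExp.holds_natLT, NExp.eval_lit, NV.eval_v,
      wp_set, NExp.eval_sub, hfr3.n .pr (by simp)]
    refine ⟨fun hp => ?_, fun hp => ?_⟩
    · obtain ⟨q, hq⟩ : ∃ q, s2.N .pr 0 = q + 1 := ⟨s2.N .pr 0 - 1, by omega⟩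
      obtain ⟨hqA, hqd, hqb⟩ := q5 q hq
      refine Wp.mono (wp_pivotProg _ (g := g) (A := A) (col := z) (q := q)
        (by simp [hfr3.n, hfr2.n, eg]) (by simp [hfr3.n, hfr2.n, eA])
        (by simp [hfr3.n, hfr2.n, hi1]) (by simp [hq]) hqA hz) ?_
      rintro t4 s4 ⟨ht4, hfr4, htab4, hbas4⟩
      have etab4 : (s3.wN .q 0 (s2.N .pr 0 - 1)).tab g = s1.tab g := by rw [← etab3]; rfl
      refine ⟨?_, ?_, ?_⟩
      · rw [show A * (g * 100 + 100) = 100 * (A * g) + 100 * A by ring] at ht4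
        rw [hts]
        simp
        omega
      · refine hfr4.comp (by simp) (by simp) ?_
        rw [Fr.wN_iff (by simp)]
        exact hfr3'
      · have ex4 : s4.R .x = s3.R .x := by rw [hfr4.r _ (by simp), State.wN_R]
        rw [ex4, hx3]
        refine hP1.step hz h q1 q2 q3 (Or.inr ⟨q, hqA, hqd, hqb, ?_, fun r hr => ?_⟩)
        · rwa [etab4] at htab4
        · rw [hbas4, State.wN_N_ne _ _ _ (by simp), ebas3]
    · refine ⟨?_, hfr3', ?_⟩
      · rw [hts]
        simp
        omega
      · rw [hx3, etab3, ebas3]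
        exact hP1.step hz h q1 q2 q3 (Or.inl ⟨q4 (by omega), fun _ _ _ _ => rfl, fun _ _ => rfl⟩)
  · rintro t s' ⟨ht, hfr, hP⟩
    refine ⟨ht.trans (Nat.add_le_add (Nat.mul_le_mul_left _ ?_) (by norm_num)),
      hfr.mono (by simp) (by simp), hP⟩
    have h1 : A * (g * 100 + 450) ≤ A * (g * 100 + 500) := Nat.mul_le_mul_left _ (by omega)
    exact Nat.add_le_add (Nat.add_le_add_right h1 _) (by norm_num : 450 + 13 ≤ 500) |>.trans'
      (by rw [add_assoc])

end Simplex

/-! ### Halving a block -/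

section Selection

open Classical in
/-- The points of a block that are selected differ in number from the points with weight `1` by no
more than the discrepancy of the whole block, so they halve every orthant up to twice the
discrepancy of an orthant. -/
theorem abs_card_selected_sub_le {g L k s h : ℕ} {q : ℕ → ℕ → ℝ} {x : ℕ → ℝ} (hgL : g < 2 ^ L)
    (hx : ∀ i < g, x i = 0 ∨ x i = 1)
    (H : ∀ c < L ^ k, ∀ i0 < g,
      |∑ i ∈ range g with boxKey g L (fun j => rankIn g (fun i => q i j)) k c i =
        boxKey g L (fun j => rankIn g (fun i => q i j)) k c i0, (x i - 1 / 2)| ≤ s)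
    {S : Finset ℕ} (hS : S ⊆ range g) (hcard : #S = h) (hg : g = 2 * h)
    (hor : S ⊆ {i ∈ range g | 0 < x i} ∨ {i ∈ range g | 0 < x i} ⊆ S) (v : Fin k → ℝ) :
    |(#{i ∈ S | ∀ j : Fin k, q i j ≤ v j} : ℝ) - #{i ∈ range g | ∀ j : Fin k, q i j ≤ v j} / 2| ≤
      2 * (L ^ k * s : ℕ) := by
  have hr : ∀ j i, i < g → (fun j => rankIn g (fun i => q i j)) j i < g :=
    fun j i hi => rankIn_lt hi
  have hR : ∀ j : Fin k, #{i2 ∈ range g | q i2 j ≤ v j} < 2 ^ L := fun j =>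
    ((card_filter_le _ _).trans (card_range g).le).trans_lt hgL
  have hO : {i ∈ range g | ∀ j : Fin k, (fun j => rankIn g (fun i => q i j)) j i <
      #{i2 ∈ range g | q i2 j ≤ v j}} = {i ∈ range g | ∀ j : Fin k, q i j ≤ v j} := by
    refine filter_congr fun i hi => forall_congr' fun j => ?_
    exact rankIn_lt_iff (q := fun i => q i j) (mem_range.mp hi) (v j)
  have hall : {i ∈ range g | ∀ j : Fin k, (fun j => rankIn g (fun i => q i j)) j i < g} =
      range g := by
    refine filter_true_of_mem fun i hi j => hr j i (mem_range.mp hi)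
  set ones := {i ∈ range g | 0 < x i} with hones
  have hsum : ∀ C ⊆ range g, ∑ i ∈ C, (x i - 1 / 2) = (#(C ∩ ones) : ℝ) - #C / 2 := by
    intro C hC
    have h1 : ∀ i ∈ C, x i - 1 / 2 = (if i ∈ ones then 1 else 0) - 1 / 2 := by
      intro i hi
      rcases hx i (mem_range.mp (hC hi)) with h | h
      · rw [if_neg, h]
        rw [hones, mem_filter, h]
        exact fun h' => lt_irrefl _ h'.2
      · rw [if_pos, h]
        rw [hones, mem_filter, h]
        exact ⟨hC hi, one_pos⟩
    rw [sum_congr rfl h1, sum_sub_distrib, sum_const, ← sum_filter, filter_mem_eq_inter, sum_const]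
    simp
    ring
  -- The discrepancy of the orthant, and that of the whole block.
  have b1 := abs_sum_orthant_le hr H (fun j => #{i2 ∈ range g | q i2 j ≤ v j}) hR
  have b2 := abs_sum_orthant_le hr H (fun _ => g) (fun _ => hgL)
  rw [hO, hsum _ (filter_subset _ _)] at b1
  rw [hall, hsum _ (Subset.refl _), inter_eq_right.mpr (filter_subset _ _), card_range] at b2
  set O := {i ∈ range g | ∀ j : Fin k, q i j ≤ v j} with hOdef
  have hSO : {i ∈ S | ∀ j : Fin k, q i j ≤ v j} = O ∩ S := by
    ext i
    simp only [hOdef, mem_inter, mem_filter]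
    exact ⟨fun h => ⟨⟨hS h.1, h.2⟩, h.1⟩, fun h => ⟨h.2, h.1.2⟩⟩
  rw [hSO]
  have b3 : |(#(O ∩ S) : ℝ) - #(O ∩ ones)| ≤ |(#ones : ℝ) - #S| := by
    rcases hor with h | h
    · have h1 : #(O ∩ S) ≤ #(O ∩ ones) := card_le_card (inter_subset_inter_left h)
      have h2 : #(O ∩ ones) + #S ≤ #(O ∩ S) + #ones := by
        have e1 : #(ones \ S) + #S = #ones := by
          rw [card_sdiff_add_card, union_eq_left.mpr h]
        have e2 : #(O ∩ ones) ≤ #(O ∩ S) + #(ones \ S) := by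
          refine (card_le_card fun i hi => ?_).trans (card_union_le _ _)
          rw [mem_union, mem_inter, mem_sdiff]
          rw [mem_inter] at hi
          tauto
        omega
      have h1' : (#(O ∩ S) : ℝ) ≤ #(O ∩ ones) := by exact_mod_cast h1
      have h2' : (#(O ∩ ones) : ℝ) + #S ≤ #(O ∩ S) + #ones := by exact_mod_cast h2
      have h3 : (#S : ℝ) ≤ #ones := by exact_mod_cast card_le_card h
      rw [abs_sub_comm, abs_of_nonneg (by linarith), abs_of_nonneg (by linarith)]
      linarith
    · have h1 : #(O ∩ ones) ≤ #(O ∩ S) := card_le_card (inter_subset_inter_left h)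
      have h2 : #(O ∩ S) + #ones ≤ #(O ∩ ones) + #S := by
        have e1 : #(S \ ones) + #ones = #S := by
          rw [card_sdiff_add_card, union_eq_left.mpr h]
        have e2 : #(O ∩ S) ≤ #(O ∩ ones) + #(S \ ones) := by
          refine (card_le_card fun i hi => ?_).trans (card_union_le _ _)
          rw [mem_union, mem_inter, mem_sdiff]
          rw [mem_inter] at hi
          tauto
        omega
      have h1' : (#(O ∩ ones) : ℝ) ≤ #(O ∩ S) := by exact_mod_cast h1
      have h2' : (#(O ∩ S) : ℝ) + #ones ≤ #(O ∩ ones) + #S := by exact_mod_cast h2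
      have h3 : (#ones : ℝ) ≤ #S := by exact_mod_cast card_le_card h
      rw [abs_of_nonneg (by linarith), abs_sub_comm, abs_of_nonneg (by linarith)]
      linarith
  have b4 : |(#ones : ℝ) - #S| ≤ (L ^ k * s : ℕ) := by
    have hg' : (g : ℝ) = 2 * h := by exact_mod_cast hg
    rw [hcard, show (h : ℝ) = g / 2 by rw [hg']; ring]
    exact b2
  calc |(#(O ∩ S) : ℝ) - #O / 2|
      = |((#(O ∩ S) : ℝ) - #(O ∩ ones)) + (#(O ∩ ones) - #O / 2)| := by congr 1; ring
    _ ≤ |(#(O ∩ S) : ℝ) - #(O ∩ ones)| + |(#(O ∩ ones) : ℝ) - #O / 2| := abs_add_le _ _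
    _ ≤ 2 * (L ^ k * s : ℕ) := by linarith

end Selection

section Phase

variable {X : Type*} {K : ℕ} {e : Env X K}

/-- One phase of the rounding. -/
def phaseProg : Prog := block [rowsProg, simplexProg]

open Classical in
/-- A phase halves the number of floating weights, and preserves the sums of the heavy classes. -/
theorem wp_phaseProg (s : State) {g lk off : ℕ} {key : ℕ → ℕ → ℕ} (hg : s.N .g 0 = g)
    (hlk : s.N .lk 0 = lk) (hoff : s.N .off 0 = off) (hs : s.N .s 0 = 2 * lk)
    (hkey : ∀ c < lk, ∀ i < g, s.N .key ((off + c) * g + i) = key c i)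
    (hg0 : 0 < g) (hlk0 : 0 < lk) (hx0 : s.R .x 0 = 0)
    (hx : ∀ i < g, 0 ≤ s.R .x (i + 1) ∧ s.R .x (i + 1) ≤ 1) :
    Wp e phaseProg s (fun t s' => t ≤ 4000 * (lk * (g * g * g)) ∧
      Fr [.A, .c, .i, .cnt, .dup, .i2, .bas, .col, .pr, .q] [.th, .d, .y, .u, .x, .tb] s s' ∧
      s'.R .x 0 = 0 ∧ (∀ i < g, 0 ≤ s'.R .x (i + 1) ∧ s'.R .x (i + 1) ≤ 1) ∧
      (∀ i < g, ¬ Floats (s.R .x (i + 1)) → s'.R .x (i + 1) = s.R .x (i + 1)) ∧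
      (∀ c < lk, ∀ i0 < g,
        2 * lk < #{i ∈ {i ∈ range g | key c i = key c i0} | Floats (s.R .x (i + 1))} →
        ∑ i ∈ range g with key c i = key c i0, s'.R .x (i + 1) =
          ∑ i ∈ range g with key c i = key c i0, s.R .x (i + 1)) ∧
      2 * #{i ∈ range g | Floats (s'.R .x (i + 1))} ≤
        #{i ∈ range g | Floats (s.R .x (i + 1))}) := by
  set x : ℕ → ℝ := fun i => s.R .x (i + 1) with hxdef
  rw [phaseProg, wp_cons]
  refine Wp.mono (wp_rowsProg s hg hlk hoff hs hkey) ?_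
  rintro t1 s1 ⟨ht1, hfr1, hA1, hbas1, hrow1⟩
  set A := s1.N .A 0 with hA
  set F := #{i ∈ range g | Floats (x i)} with hF
  -- Each class that is kept as a constraint contains more than `2 * lk` floating points, and each
  -- floating point lies in `lk` classes.
  have h2A : 2 * A ≤ F := by
    have h1 := card_heavy_le (M := lk) (g := g) (s := 2 * lk) key (fun i => Floats (x i))
    simp only [heavy_iff] at hA1
    rw [← hA1, ← hF] at h1
    have h3 : lk * (2 * A) ≤ lk * F := by
      refine le_trans ?_ h1
      rw [mul_add, mul_one]
      refine le_trans (le_of_eq ?_) (Nat.le_add_right _ _)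
      ring
    exact Nat.le_of_mul_le_mul_left h3 hlk0
  have hFg : F ≤ g := (card_filter_le _ _).trans (card_range g).le
  have ex1 : s1.R .x = s.R .x := hfr1.r _ (by simp)
  rw [wp_cons]
  refine Wp.mono (wp_simplexProg s1 (g := g) (A := A) (by rw [hfr1.n _ (by simp), hg]) rfl
    (by rw [ex1, hx0]) (by rwa [ex1]) hbas1) ?_
  rintro t2 s2 ⟨ht2, hfr2, hinv⟩
  rw [ex1] at hinv
  rw [wp_nil]
  refine ⟨?_, ?_, hinv.x_zero, hinv.x_mem, hinv.fixed, ?_, ?_⟩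
  · have hAg : A ≤ g := by omega
    have h1 : t2 ≤ g * (g * (g * 100 + 500) + g * 100 + 500) + 100 :=
      ht2.trans (Nat.add_le_add_right (Nat.mul_le_mul_left _ (Nat.add_le_add_right
        (Nat.add_le_add_right (Nat.mul_le_mul_right _ hAg) _) _)) _)
    have e1 : g * (g * (g * 100 + 500) + g * 100 + 500) =
      100 * (g * g * g) + 600 * (g * g) + 500 * g := by ring
    have e2 : lk * (g * (g * 500 + 500) + 100) =
      500 * (lk * (g * g)) + 500 * (lk * g) + 100 * lk := by ring
    have i1 : g * g * g ≤ lk * (g * g * g) := Nat.le_mul_of_pos_left _ hlk0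
    have i2 : g * g ≤ g * g * g := Nat.le_mul_of_pos_right _ hg0
    have i3 : g ≤ g * g := Nat.le_mul_of_pos_right _ hg0
    have i4 : lk * (g * g) ≤ lk * (g * g * g) := Nat.mul_le_mul_left _ i2
    have i5 : lk * g ≤ lk * (g * g) := Nat.mul_le_mul_left _ i3
    have i6 : lk ≤ lk * g := Nat.le_mul_of_pos_right _ hg0
    rw [e1] at h1
    rw [e2] at ht1
    generalize lk * (g * g * g) = u1 at *
    generalize lk * (g * g) = u2 at *
    generalize lk * g = u3 at *
    generalize g * g * g = u4 at *
    generalize g * g = u5 at *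
    omega
  · exact hfr2.comp (by simp) (by simp) (hfr1.mono (by simp) (by simp))
  · intro c hc i0 hi0 hheavy
    -- The first point of the class represents it in the tableau.
    obtain ⟨i1, hi1, hk1, hmin⟩ : ∃ i1 < g, key c i1 = key c i0 ∧
        ∀ i2 < i1, key c i2 ≠ key c i1 := by
      have hex : ∃ i, key c i = key c i0 := ⟨i0, rfl⟩
      refine ⟨Nat.find hex, (Nat.find_min' hex rfl).trans_lt hi0, Nat.find_spec hex, ?_⟩
      intro i2 h2 h3
      exact Nat.find_min hex h2 (h3.trans (Nat.find_spec hex))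
    obtain ⟨r, hr, hrow⟩ := hrow1 c hc i1 hi1 (heavy_iff.mpr ⟨hmin, by
      rw [filter_filter] at hheavy
      simpa only [hk1] using hheavy⟩)
    have h1 := hinv.sum r hr
    have h2 : ∀ i ∈ range g, s1.tab g r i * (s2.R .x (i + 1) - s.R .x (i + 1)) =
        if key c i = key c i0 then s2.R .x (i + 1) - s.R .x (i + 1) else 0 := by
      intro i hi
      rw [State.tab, hrow i (mem_range.mp hi), hk1]
      split_ifs <;> ring
    rw [sum_congr rfl h2, ← sum_filter, sum_sub_distrib, sub_eq_zero] at h1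
    exact h1
  · have := hinv.card_floats_le
    refine le_trans ?_ h2A
    exact Nat.mul_le_mul_left _ this

/-- Copy the selected points of a block to the point number `wp` and the following ones: points of
weight `1` are selected as long as fewer than `h` points are selected, and all points are selected
once this is necessary to obtain `h` points. -/
def selectProg : Prog := block [NV.w.set (.lit 0),
  forN .i .g (.ite (.not (.and (.not (.and (.natLT NV.w.v NV.h.v)
        (.realLT (.ofNat (.lit 0)) (RV.x.at (NV.i.v + .lit 1)))))
      (.natLT NV.h.v (NV.w.v + (NV.g.v - NV.i.v)))))
    (block [forN .j .k (RV.pt.setAt (NV.wp.v * NV.k.v + NV.j.v)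
        (RV.pt.at ((NV.base.v + NV.i.v) * NV.k.v + NV.j.v))),
      NV.wp.set (NV.wp.v + .lit 1), NV.w.set (NV.w.v + .lit 1)]) .skip)]

theorem image_update_range (τ : ℕ → ℕ) (w z : ℕ) :
    (range (w + 1)).image (Function.update τ w z) = insert z ((range w).image τ) := by
  rw [range_add_one, image_insert, Function.update_self]
  congr 1
  refine image_congr fun u hu => ?_
  have := mem_range.mp (mem_coe.mp hu)
  exact Function.update_of_ne (by omega) _ _

open Classical in
/-- Exactly `h` points are selected, and they comprise, or are among, the points of weight `1`.  They
are moved towards the start of the memory, over points that are not needed any more. -/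
theorem wp_selectProg (s : State) {g h k b wp : ℕ} (hg : s.N .g 0 = g) (hh : s.N .h 0 = h)
    (hk : s.N .k 0 = k) (hb : s.N .base 0 = b) (hwp : s.N .wp 0 = wp) (hle : wp ≤ b)
    (hhg : h ≤ g) :
    Wp e selectProg s (fun t s' => t ≤ g * (k * 100 + 200) + 100 ∧
      Fr [.w, .i, .j, .wp] [.pt] s s' ∧ s'.N .wp 0 = wp + h ∧
      (∀ z, z < wp * k ∨ (b + g) * k ≤ z → s'.R .pt z = s.R .pt z) ∧
      ∃ τ : ℕ → ℕ, (∀ u < h, τ u < g) ∧ (∀ u < h, ∀ u' < h, τ u = τ u' → u = u') ∧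
        (∀ u < h, ∀ j < k, s'.R .pt ((wp + u) * k + j) = s.R .pt ((b + τ u) * k + j)) ∧
        ((range h).image τ ⊆ {i ∈ range g | 0 < s.R .x (i + 1)} ∨
          {i ∈ range g | 0 < s.R .x (i + 1)} ⊆ (range h).image τ)) := by
  set ones : ℕ → Finset ℕ := fun z => {i ∈ range z | 0 < s.R .x (i + 1)} with hones
  have hones_succ : ∀ z, ones (z + 1) = if 0 < s.R .x (z + 1) then insert z (ones z) else ones z := by
    intro z
    simp only [hones]
    rw [range_add_one, filter_insert]
  -- The selection agrees with the points of weight `1` until either `h` points are selected or all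
  -- remaining points are needed.
  set P : ℕ → State → Prop := fun z s' =>
    s'.N .wp 0 = wp + s'.N .w 0 ∧ s'.N .w 0 ≤ h ∧ h ≤ s'.N .w 0 + (g - z) ∧
    (∀ m, m < wp * k ∨ (b + z) * k ≤ m → s'.R .pt m = s.R .pt m) ∧
    ∃ τ : ℕ → ℕ, (∀ u < s'.N .w 0, τ u < z) ∧
      (∀ u < s'.N .w 0, ∀ u' < s'.N .w 0, τ u = τ u' → u = u') ∧
      (∀ u < s'.N .w 0, ∀ j < k, s'.R .pt ((wp + u) * k + j) = s.R .pt ((b + τ u) * k + j)) ∧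
      ((range (s'.N .w 0)).image τ = ones z ∨
        (s'.N .w 0 = h ∧ (range (s'.N .w 0)).image τ ⊆ ones z) ∨
        (s'.N .w 0 + (g - z) = h ∧ ones z ⊆ (range (s'.N .w 0)).image τ)) with hP
  simp only [selectProg, wp_cons, wp_set]
  refine Wp.mono (wp_for g (k * 100 + 150) [.w, .j, .wp] [.pt] P (by simpa using hg) (by simp)
    (by simp) ?_ ?_ ?_) ?_
  · intro z s' v hPz
    simp only [hP, State.wN_R, State.wN_N_ne s' (c := NV.i) (c' := NV.w) 0 v (by simp),
      State.wN_N_ne s' (c := NV.i) (c' := NV.wp) 0 v (by simp)]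
    exact hPz
  · refine ⟨by simp [hwp], by simp, by simpa using hhg, by simp, fun u => u, by simp, by simp,
      by simp, Or.inl ?_⟩
    simp [hones]
  · intro z hz s1 hfr1 hi1 hP1
    obtain ⟨p1, p2, p3, p4, τ, p5, p6, p7, p8⟩ := hP1
    set w := s1.N .w 0 with hw
    have e1 : ∀ c, c ∉ [NV.w, .i, .j, .wp] → s1.N c = s.N c := by
      intro c hc
      simp only [List.mem_cons, List.not_mem_nil, or_false, not_or] at hc
      rw [hfr1.n c (by simp [hc]), State.wN_N_ne _ _ _ hc.1]
    have ex1 : s1.R .x = s.R .x := by rw [hfr1.r _ (by simp), State.wN_R]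
    have hwz : w ≤ z := by
      rw [← card_range w, ← card_range z]
      refine card_le_card_of_injOn τ (fun u hu => ?_) fun u hu u' hu' huu => ?_
      · exact mem_coe.mpr (mem_range.mpr (p5 u (mem_range.mp (mem_coe.mp hu))))
      · exact p6 u (mem_range.mp (mem_coe.mp hu)) u' (mem_range.mp (mem_coe.mp hu')) huu
    simp only [wp_ite, wp_skip, BExp.holds_not, BExp.holds_and, BExp.holds_natLT,
      BExp.holds_realLT, RExp.eval_ofNat, RV.eval_at, NExp.eval_add, NExp.eval_sub, NV.eval_v,
      NExp.eval_lit, hi1, e1 .h (by simp), e1 .g (by simp), hh, hg, ex1, Nat.cast_zero, ← hw]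
    refine ⟨fun hsel => ?_, fun hsel => ?_⟩
    · have hsel' : (w < h ∧ 0 < s.R .x (z + 1)) ∨ w + (g - z) = h := by
        by_contra hc
        push Not at hc
        refine hsel ⟨fun h' => absurd h'.2 (not_lt.mpr (hc.1 h'.1)), ?_⟩
        have := hc.2
        omega
      have hwh : w < h := by rcases hsel' with h' | h' <;> omega
      rw [wp_cons]
      refine Wp.mono (wp_for k 50 [] [.pt] (fun y s' =>
          (∀ j < y, s'.R .pt ((wp + w) * k + j) = s.R .pt ((b + z) * k + j)) ∧
          ∀ m, m < (wp + w) * k ∨ (wp + w) * k + y ≤ m → s'.R .pt m = s1.R .pt m)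
        (by rw [e1 _ (by simp), hk]) (by simp) (by simp) (fun _ _ _ h => h) (by simp) ?_) ?_
      · intro y hy s2 hfr2 hi2 hP2
        have hsrc : s2.R .pt ((b + z) * k + y) = s.R .pt ((b + z) * k + y) := by
          have hkk : (wp + w) * k ≤ (b + z) * k := Nat.mul_le_mul_right _ (by omega)
          rw [hP2.2 _ (Or.inr (Nat.add_le_add_right hkk _)),
            p4 _ (Or.inr (Nat.le_add_right _ _))]
        have e2 : ∀ c, c ∉ [NV.j] → s2.N c = s1.N c := hfr2.n
        simp only [wp_rsetAt, RV.eval_at, NExp.eval_add, NExp.eval_mul, NV.eval_v, hi2,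
          e2 .wp (by simp), e2 .k (by simp), e2 .base (by simp), e2 .i (by simp),
          e1 .k (by simp), e1 .base (by simp), hi1, p1, hk, hb, hsrc]
        refine ⟨by simp, by simp, fun j hj => ?_, fun m hm => ?_⟩
        · rw [State.wR_R_same, Function.update_apply]
          split_ifs with hjy
          · rw [Nat.add_left_cancel hjy]
          · exact hP2.1 j (by omega)
        · rw [State.wR_R_same, Function.update_apply, if_neg (by omega)]
          exact hP2.2 m (by omega)
      · rintro t2 s2 ⟨ht2, hfr2, hP2⟩
        have ew2 : s2.N .w 0 = w := by rw [hfr2.n _ (by simp)]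
        have ewp2 : s2.N .wp 0 = wp + w := by rw [hfr2.n _ (by simp), p1]
        simp only [wp_cons, wp_set, wp_nil, NExp.eval_add, NV.eval_v, NExp.eval_lit, ewp2,
          State.wN_N_ne _ (c := NV.wp) (c' := NV.w) _ _ (by simp), ew2]
        refine ⟨by simp; omega, ?_, ?_⟩
        · rw [Fr.wN_iff (by simp), Fr.wN_iff (by simp)]
          exact hfr2.comp (by simp) (by simp) (Fr.refl _ _ _)
        · simp only [hP, State.wN_R, State.wN_N_same,
            State.wN_N_ne _ (c := NV.w) (c' := NV.wp) _ _ (by simp), Function.update_self]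
          refine ⟨by omega, by omega, by omega, fun m hm => ?_, Function.update τ w z, ?_, ?_, ?_, ?_⟩
          · have h1 : (wp + w + 1) * k ≤ (b + (z + 1)) * k := Nat.mul_le_mul_right _ (by omega)
            have h2 : wp * k ≤ (wp + w) * k := Nat.mul_le_mul_right _ (by omega)
            have h3 : (b + z) * k ≤ (b + (z + 1)) * k := Nat.mul_le_mul_right _ (by omega)
            rw [add_mul _ 1, one_mul] at h1
            rw [hP2.2 m, p4 m]
            · rcases hm with hm | hm
              · exact Or.inl hm
              · exact Or.inr (h3.trans hm)
            · rcases hm with hm | hm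
              · exact Or.inl (hm.trans_le h2)
              · exact Or.inr (h1.trans hm)
          · intro u hu
            rw [Function.update_apply]
            split_ifs with huw
            · omega
            · have := p5 u (by omega); omega
          · intro u hu u' hu' huu
            rw [Function.update_apply, Function.update_apply] at huu
            split_ifs at huu with h1 h2 h2
            · omega
            · have := p5 u' (by omega); omega
            · have := p5 u (by omega); omega
            · exact p6 u (by omega) u' (by omega) huu
          · intro u hu j hj
            rw [Function.update_apply]
            split_ifs with huw
            · rw [huw]; exact hP2.1 j hj
            · have h1 : (wp + u + 1) * k ≤ (wp + w) * k := Nat.mul_le_mul_right _ (by omega)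
              rw [add_mul _ 1, one_mul] at h1
              rw [hP2.2 _ (Or.inl (by omega))]
              exact p7 u (by omega) j hj
          · rw [image_update_range, hones_succ]
            by_cases hx : 0 < s.R .x (z + 1)
            · rw [if_pos hx]
              rcases p8 with h8 | h8 | h8
              · exact Or.inl (by rw [h8])
              · omega
              · exact Or.inr (Or.inr ⟨by omega, insert_subset_insert _ h8.2⟩)
            · rw [if_neg hx]
              have hforced : w + (g - z) = h := hsel'.resolve_left fun h' => hx h'.2
              refine Or.inr (Or.inr ⟨by omega, ?_⟩)
              rcases p8 with h8 | h8 | h8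
              · rw [h8]; exact subset_insert _ _
              · omega
              · exact h8.2.trans (subset_insert _ _)
    · have hsel' : (w < h → ¬ 0 < s.R .x (z + 1)) ∧ h < w + (g - z) := by
        push Not at hsel
        exact ⟨fun h' => not_lt.mpr (hsel.1 h'), hsel.2⟩
      refine ⟨by simp, by simp, p1, p2, ?_, fun m hm => ?_, τ, ?_, p6, p7, ?_⟩
      · have := hsel'.2
        omega
      · have h3 : (b + z) * k ≤ (b + (z + 1)) * k := Nat.mul_le_mul_right _ (by omega)
        exact p4 m (hm.imp_right fun h' => h3.trans h')
      · exact fun u hu => (p5 u hu).trans (Nat.lt_succ_self _)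
      · rw [hones_succ]
        have hgz := hsel'.2
        by_cases hx : 0 < s.R .x (z + 1)
        · rw [if_pos hx]
          have hwh : w = h := by
            by_contra hne
            exact hsel'.1 (lt_of_le_of_ne p2 hne) hx
          refine Or.inr (Or.inl ⟨hwh, ?_⟩)
          rcases p8 with h8 | h8 | h8
          · rw [h8]; exact subset_insert _ _
          · exact h8.2.trans (subset_insert _ _)
          · omega
        · rw [if_neg hx]
          rcases p8 with h8 | h8 | h8
          · exact Or.inl h8
          · exact Or.inr (Or.inl h8)
          · omega
  · rintro t s' ⟨ht, hfr, p1, p2, p3, p4, τ, p5, p6, p7, p8⟩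
    have hwh : s'.N .w 0 = h := by omega
    rw [hwh] at p5 p6 p7 p8
    rw [wp_nil]
    refine ⟨?_, hfr.comp (by simp) (by simp) (by simp), by rw [p1, hwh], p4, τ, p5, p6, p7, ?_⟩
    · have h1 : g * (k * 100 + 150 + 13) ≤ g * (k * 100 + 200) := Nat.mul_le_mul_left _ (by omega)
      have h2 := ht.trans (Nat.add_le_add_right h1 10)
      clear h1 ht
      simp only [NExp.cost_lit]
      generalize g * (k * 100 + 200) = v at h2 ⊢
      omega
    · rcases p8 with h8 | h8 | h8
      · exact Or.inl h8.subset
      · exact Or.inl h8.2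
      · exact Or.inr h8.2

end Phase

section Block

variable {X : Type*} {K : ℕ} {e : Env X K}

/-- Replace the `g` points of the block with first point number `base` by half of them. -/
def blockProg : Prog := block [keysProg, RV.x.set (.ofNat (.lit 0)),
  forN .i .g (RV.x.setAt (NV.i.v + .lit 1) (.ofNat (.lit 1) / .ofNat (.lit 2))),
  forN .ph .L phaseProg, selectProg]

/-- The arrays of natural numbers used in halving a block. -/
def blockNames : List NV := [.off, .cj, .i, .j, .t, .i2, .rk, .c, .l, .key, .ph, .A, .cnt, .dup, .bas,
  .col, .pr, .q, .w, .wp]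

theorem nearHalf_const {C : Finset ℕ} {s : ℕ} {x : ℕ → ℝ} (h : ∀ i ∈ C, x i = 1 / 2) :
    NearHalf C s x := by
  refine ⟨fun _ => 1 / 2, fun _ _ => by norm_num, by simp, Or.inl h⟩

theorem card_filter_image_range {h : ℕ} {τ : ℕ → ℕ}
    (hτ : ∀ u < h, ∀ u' < h, τ u = τ u' → u = u') (p : ℕ → Prop) [DecidablePred p] :
    #{i ∈ (range h).image τ | p i} = #{u ∈ range h | p (τ u)} := by
  rw [filter_image]
  refine card_image_of_injOn fun u hu u' hu' => ?_
  have h1 := mem_range.mp (mem_filter.mp (mem_coe.mp hu)).1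
  have h2 := mem_range.mp (mem_filter.mp (mem_coe.mp hu')).1
  exact hτ u h1 u' h2

open Classical in
/-- A block is halved with error at most `4 L ^ (2 k)` in every orthant. -/
theorem wp_blockProg (s : State) {g h L k b wp : ℕ} (hg : s.N .g 0 = g) (hh : s.N .h 0 = h)
    (hL : s.N .L 0 = L) (hk : s.N .k 0 = k) (hlk : s.N .lk 0 = L ^ k)
    (hs : s.N .s 0 = 2 * L ^ k) (hb : s.N .base 0 = b) (hwp : s.N .wp 0 = wp)
    (hsh : ∀ l < L, ∀ x < g, s.N .sh (l * g + x) = x / 2 ^ l)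
    (hgh : g = 2 * h) (hg0 : 0 < g) (hgL : g < 2 ^ L) (hk0 : 0 < k) (hle : wp ≤ b) :
    Wp e blockProg s (fun t s' => t ≤ 9000 * (k * (L * (L ^ k * (g * g * g)))) ∧
      Fr blockNames [.th, .d, .y, .u, .x, .tb, .pt] s s' ∧ s'.N .wp 0 = wp + h ∧
      (∀ z, z < wp * k ∨ (b + g) * k ≤ z → s'.R .pt z = s.R .pt z) ∧
      ∃ τ : ℕ → ℕ, (∀ u < h, τ u < g) ∧ (∀ u < h, ∀ u' < h, τ u = τ u' → u = u') ∧
        (∀ u < h, ∀ j < k, s'.R .pt ((wp + u) * k + j) = s.R .pt ((b + τ u) * k + j)) ∧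
        ∀ v : Fin k → ℝ,
          |(#{u ∈ range h | ∀ j : Fin k, s.R .pt ((b + τ u) * k + j) ≤ v j} : ℝ) -
            #{i ∈ range g | ∀ j : Fin k, s.R .pt ((b + i) * k + j) ≤ v j} / 2| ≤
            4 * ((L : ℝ) ^ k) ^ 2) := by
  have hL0 : 0 < L := by
    rcases Nat.eq_zero_or_pos L with h0 | h0
    · rw [h0, pow_zero] at hgL; omega
    · exact h0
  have hlk0 : 0 < L ^ k := by positivity
  set key := boxKey g L (fun j => rankIn g (fun i => s.R .pt ((b + i) * k + j))) k with hkeydef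
  rw [blockProg, wp_cons]
  refine Wp.mono (wp_keysProg s hg hL hk hb hsh hg0 hL0) ?_
  rintro t1 s1 ⟨ht1, hfr1, hkey1⟩
  rw [wp_cons, wp_rset, wp_cons]
  set s2 := s1.wR .x 0 ((RExp.ofNat (.lit 0)).eval s1) with hs2
  have eN2 : s2.N = s1.N := rfl
  have ept2 : s2.R .pt = s.R .pt := by
    rw [hs2, State.wR_R_ne _ _ _ (by simp), hfr1.r _ (by simp)]
  refine Wp.mono (wp_for g 30 [] [.x] (fun z s' => s'.R .x 0 = 0 ∧
    ∀ i < z, s'.R .x (i + 1) = 1 / 2) (by rw [eN2, hfr1.n _ (by simp), hg]) (by simp) (by simp)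
    (fun _ _ _ h => h) (by simp [hs2]) ?_) ?_
  · intro z hz s' hfr hi hP
    simp only [wp_rsetAt, NExp.eval_add, NV.eval_v, hi, NExp.eval_lit, RExp.eval_div,
      RExp.eval_ofNat]
    refine ⟨by simp, by simp, ?_, fun i hi' => ?_⟩
    · rw [State.wR_R_same, Function.update_of_ne (by omega), hP.1]
    · rw [State.wR_R_same, Function.update_apply]
      split_ifs with hiz
      · norm_num
      · exact hP.2 i (by omega)
  rintro t3 s3 ⟨ht3, hfr3, hx30, hx3⟩
  have e3 : ∀ c, c ∉ [NV.off, .cj, .i, .j, .t, .i2, .rk, .c, .l, .key] → s3.N c = s.N c := by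
    intro c hc
    rw [hfr3.n c (by simp only [List.mem_cons, List.not_mem_nil, or_false, not_or] at hc ⊢; exact hc.2.2.1),
      eN2, hfr1.n c hc]
  have ept3 : s3.R .pt = s.R .pt := by rw [hfr3.r _ (by simp), ept2]
  set off := s3.N .off 0 with hoff
  have hkey3 : ∀ c < L ^ k, ∀ i < g, s3.N .key ((off + c) * g + i) = key c i := by
    rw [hoff, hfr3.n .key (by simp), hfr3.n .off (by simp)]
    exact hkey1
  rw [wp_cons]
  refine Wp.mono (wp_for L (4000 * (L ^ k * (g * g * g)))
    [.A, .c, .i, .cnt, .dup, .i2, .bas, .col, .pr, .q] [.th, .d, .y, .u, .x, .tb]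
    (fun ph s' => s'.R .x 0 = 0 ∧ (∀ i < g, 0 ≤ s'.R .x (i + 1) ∧ s'.R .x (i + 1) ≤ 1) ∧
      (∀ c < L ^ k, ∀ i0 < g, NearHalf {i ∈ range g | key c i = key c i0} (2 * L ^ k)
        (fun i => s'.R .x (i + 1))) ∧
      2 ^ ph * #{i ∈ range g | Floats (s'.R .x (i + 1))} ≤ g)
    (by rw [e3 _ (by simp), hL]) (by simp) (by simp) (fun _ _ _ h => h) ?_ ?_) ?_
  · refine ⟨hx30, fun i hi => by rw [hx3 i hi]; norm_num, fun c hc i0 hi0 => ?_, ?_⟩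
    · exact nearHalf_const fun i hi => hx3 i (mem_range.mp (mem_filter.mp hi).1)
    · rw [pow_zero, one_mul]
      exact (card_filter_le _ _).trans (card_range g).le
  · rintro ph hph s4 hfr4 hi4 ⟨p1, p2, p3, p4⟩
    have e4 : ∀ c, c ∉ [NV.ph, .A, .c, .i, .cnt, .dup, .i2, .bas, .col, .pr, .q] →
      s4.N c = s3.N c := hfr4.n
    refine Wp.mono (wp_phaseProg s4 (g := g) (lk := L ^ k) (off := off) (key := key)
      (by rw [e4 _ (by simp), e3 _ (by simp), hg])
      (by rw [e4 _ (by simp), e3 _ (by simp), hlk]) (by rw [e4 _ (by simp)])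
      (by rw [e4 _ (by simp), e3 _ (by simp), hs]) (by rw [e4 .key (by simp)]; exact hkey3)
      hg0 hlk0 p1 p2) ?_
    rintro t s5 ⟨ht, hfr, q1, q2, q3, q4, q5⟩
    refine ⟨ht, hfr, q1, q2, fun c hc i0 hi0 => ?_, ?_⟩
    · refine (p3 c hc i0 hi0).step (fun i hi => ?_) (fun i hi => ?_) (q4 c hc i0 hi0)
      · exact q2 i (mem_range.mp (mem_filter.mp hi).1)
      · exact q3 i (mem_range.mp (mem_filter.mp hi).1)
    · rw [pow_succ, mul_assoc]
      exact (Nat.mul_le_mul_left _ q5).trans p4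
  rintro t4 s4 ⟨ht4, hfr4, p1, p2, p3, p4⟩
  have e4 : ∀ c, c ∉ [NV.off, .cj, .i, .j, .t, .i2, .rk, .c, .l, .key, .ph, .A, .cnt, .dup, .bas,
      .col, .pr, .q] → s4.N c = s.N c := by
    intro c hc
    simp only [List.mem_cons, List.not_mem_nil, or_false, not_or] at hc
    rw [hfr4.n c (by simp [hc]), e3 c (by simp [hc])]
  have ept4 : s4.R .pt = s.R .pt := by rw [hfr4.r _ (by simp), ept3]
  -- After `L` phases fewer than one weight is floating.
  have hno : ∀ i < g, s4.R .x (i + 1) = 0 ∨ s4.R .x (i + 1) = 1 := by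
    have h0 : #{i ∈ range g | Floats (s4.R .x (i + 1))} = 0 := by
      by_contra hne
      have : 2 ^ L * 1 ≤ 2 ^ L * #{i ∈ range g | Floats (s4.R .x (i + 1))} :=
        Nat.mul_le_mul_left _ (Nat.one_le_iff_ne_zero.mpr hne)
      omega
    rw [card_eq_zero, filter_eq_empty_iff] at h0
    intro i hi
    have h1 := h0 (mem_range.mpr hi)
    obtain ⟨h2, h3⟩ := p2 i hi
    by_contra hc
    push Not at hc
    exact h1 ⟨lt_of_le_of_ne h2 (Ne.symm hc.1), lt_of_le_of_ne h3 hc.2⟩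
  -- By `abs_card_selected_sub_le` this yields the error `2 * (L ^ k * (2 * L ^ k))`.
  have hcls : ∀ c < L ^ k, ∀ i0 < g,
      |∑ i ∈ range g with key c i = key c i0, (s4.R .x (i + 1) - 1 / 2)| ≤ (2 * L ^ k : ℕ) := by
    intro c hc i0 hi0
    exact (p3 c hc i0 hi0).abs_sum_le fun i hi => p2 i (mem_range.mp (mem_filter.mp hi).1)
  rw [wp_cons]
  refine Wp.mono (wp_selectProg s4 (g := g) (h := h) (k := k) (b := b) (wp := wp)
    (by rw [e4 _ (by simp), hg]) (by rw [e4 _ (by simp), hh]) (by rw [e4 _ (by simp), hk])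
    (by rw [e4 _ (by simp), hb]) (by rw [e4 _ (by simp), hwp]) hle (by omega)) ?_
  rintro t5 s5 ⟨ht5, hfr5, r1, r2, τ, r3, r4, r5, r6⟩
  rw [ept4] at r2 r5
  rw [wp_nil]
  refine ⟨?_, ?_, r1, r2, τ, r3, r4, r5, fun v => ?_⟩
  · have hgg : g ≤ g * g := Nat.le_mul_of_pos_right _ hg0
    have i1 : g * g ≤ g * g * g := Nat.le_mul_of_pos_right _ hg0
    have i2 : L ^ k * (g * g) ≤ L ^ k * (g * g * g) := Nat.mul_le_mul_left _ i1
    have i3 : L ^ k * (g * g * g) ≤ L * (L ^ k * (g * g * g)) := Nat.le_mul_of_pos_left _ hL0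
    have i4 : k * (L ^ k * (g * g)) ≤ k * (L * (L ^ k * (g * g * g))) :=
      Nat.mul_le_mul_left _ (i2.trans i3)
    have i5 : L * (L ^ k * (g * g * g)) ≤ k * (L * (L ^ k * (g * g * g))) :=
      Nat.le_mul_of_pos_left _ hk0
    have i6 : g * g * g ≤ L ^ k * (g * g * g) := Nat.le_mul_of_pos_left _ hlk0
    have i7 : g ≤ L * (L ^ k * (g * g * g)) := (hgg.trans i1).trans (i6.trans i3)
    have i8 : k * g ≤ k * (L * (L ^ k * (g * g * g))) := Nat.mul_le_mul_left _ i7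
    have i9 : L * 1 ≤ L * (L ^ k * (g * g * g)) := Nat.mul_le_mul_left _ (by
      exact Nat.one_le_iff_ne_zero.mpr (by positivity))
    have e1 : k * (L ^ k * (g * g) * 1000) = 1000 * (k * (L ^ k * (g * g))) := by ring
    have e2 : L * (4000 * (L ^ k * (g * g * g)) + 13) =
      4000 * (L * (L ^ k * (g * g * g))) + 13 * L := by ring
    have e3 : g * (k * 100 + 200) = 100 * (k * g) + 200 * g := by ring
    rw [e1] at ht1
    rw [e2] at ht4
    rw [e3] at ht5
    simp only [RExp.cost_ofNat, NExp.cost_lit]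
    generalize k * (L * (L ^ k * (g * g * g))) = u1 at *
    generalize L * (L ^ k * (g * g * g)) = u2 at *
    generalize k * (L ^ k * (g * g)) = u3 at *
    generalize k * g = u4 at *
    clear e1 e2 e3 i1 i2 i3 i6
    omega
  · have f2 : Fr blockNames [.th, .d, .y, .u, .x, .tb, .pt] s s2 := by
      rw [hs2, Fr.wR_iff (by simp)]
      exact hfr1.mono (by simp [blockNames]) (by simp)
    exact hfr5.comp (by simp [blockNames]) (by simp) (hfr4.comp (by simp [blockNames]) (by simp)
      (hfr3.comp (by simp [blockNames]) (by simp) f2))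
  · have hS : (range h).image τ ⊆ range g := fun i hi => by
      obtain ⟨u, hu, rfl⟩ := mem_image.mp hi
      exact mem_range.mpr (r3 u (mem_range.mp hu))
    have hcard : #((range h).image τ) = h := by
      rw [card_image_of_injOn, card_range]
      exact fun u hu u' hu' => r4 u (mem_range.mp (mem_coe.mp hu)) u' (mem_range.mp (mem_coe.mp hu'))
    have := abs_card_selected_sub_le (q := fun i j => s.R .pt ((b + i) * k + j))
      (x := fun i => s4.R .x (i + 1)) (k := k) hgL hno hcls hS hcard hgh r6 v
    rw [card_filter_image_range r4] at this
    refine this.trans (le_of_eq ?_)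
    push_cast
    ring

end Block

/-! ### Halving the sample block by block -/

section Round

variable {X : Type*} {K : ℕ} {e : Env X K}

/-- The point number `i` of the current sample. -/
def State.pts (s : State) (k i : ℕ) : Fin k → ℝ := fun j => s.R .pt (i * k + j)

open Classical in
/-- The points `Q' 0, …, Q' (m - 1)` are `m` of the points `Q 0, …, Q (n - 1)`, and the number of
them in an orthant is half the number of all `n` points in it, up to an error `D`. -/
def Halved {k : ℕ} (m n : ℕ) (D : ℝ) (Q' Q : ℕ → Fin k → ℝ) : Prop :=
  ∃ τ : ℕ → ℕ, (∀ u < m, τ u < n) ∧ (∀ u < m, ∀ u' < m, τ u = τ u' → u = u') ∧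
    (∀ u < m, Q' u = Q (τ u)) ∧
    ∀ v, |(#{u ∈ range m | Q' u ≤ v} : ℝ) - #{i ∈ range n | Q i ≤ v} / 2| ≤ D

theorem card_filter_range_add (p : ℕ → Prop) [DecidablePred p] (m n : ℕ) :
    #{i ∈ range (m + n) | p i} = #{i ∈ range m | p i} + #{i ∈ range n | p (m + i)} := by
  simp only [card_filter, sum_range_add]

/-- The errors of two blocks add up. -/
theorem Halved.append {k : ℕ} {m n m' n' : ℕ} {D D' : ℝ} {Q' Q : ℕ → Fin k → ℝ}
    (h : Halved m n D Q' Q) (h' : Halved m' n' D' (fun u => Q' (m + u)) fun i => Q (n + i)) :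
    Halved (m + m') (n + n') (D + D') Q' Q := by
  classical
  obtain ⟨τ, a1, a2, a3, a4⟩ := h
  obtain ⟨τ', b1, b2, b3, b4⟩ := h'
  refine ⟨fun u => if u < m then τ u else n + τ' (u - m), fun u hu => ?_, fun u hu u' hu' he => ?_,
    fun u hu => ?_, fun v => ?_⟩
  · dsimp only
    split_ifs with h
    · have := a1 u h; omega
    · have := b1 (u - m) (by omega); omega
  · dsimp only at he
    split_ifs at he with h1 h2 h2
    · exact a2 u h1 u' h2 he
    · have := a1 u h1; omega
    · have := a1 u' h2; omega
    · have := b2 (u - m) (by omega) (u' - m) (by omega) (by omega)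
      omega
  · dsimp only
    split_ifs with h
    · exact a3 u h
    · have := b3 (u - m) (by omega)
      dsimp only at this
      rwa [Nat.add_sub_cancel' (by omega)] at this
  · rw [card_filter_range_add, card_filter_range_add]
    have h1 := a4 v
    have h2 := b4 v
    push_cast
    rw [abs_le] at h1 h2 ⊢
    constructor <;> linarith

/-- Halve the sample, which consists of `N` points, block by block, where the blocks consist of
`2 ^ (L - 1)` points. -/
def roundProg : Prog := block [sizeProg, powProg, NV.s.set (NV.lk.v + NV.lk.v), shiftProg,
  NV.wp.set (.lit 0), NV.base.set (.lit 0),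
  .loop (.natLT NV.base.v NV.N.v) (block [blockProg, NV.base.set (NV.base.v + NV.g.v)]),
  NV.N.set NV.wp.v]

/-- The arrays of natural numbers used in halving the sample. -/
def roundNames : List NV := blockNames ++ [.L1, .g, .h, .lk, .s, .pw, .sh, .base, .N]

/-- The arrays of real numbers used in halving the sample. -/
def roundReals : List RV := [.th, .d, .y, .u, .x, .tb, .pt]

open Classical in
/-- A round halves every one of its `B` blocks. -/
theorem wp_roundProg (s : State) {k a B : ℕ} (hL : s.N .L 0 = a + 2) (hk : s.N .k 0 = k)
    (hN : s.N .N 0 = B * 2 ^ (a + 1)) (hk0 : 0 < k) (hB : 0 < B) :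
    Wp e roundProg s (fun t s' =>
      t ≤ 10000 * (B * (k * ((a + 2) * ((a + 2) ^ k * (2 ^ (a + 1)) ^ 3)))) ∧
      Fr roundNames roundReals s s' ∧ s'.N .N 0 = B * 2 ^ a ∧
      Halved (B * 2 ^ a) (B * 2 ^ (a + 1)) (B * (4 * (((a + 2 : ℕ) : ℝ) ^ k) ^ 2))
        (s'.pts k) (s.pts k)) := by
  set L := a + 2 with hLdef
  set g := 2 ^ (a + 1) with hg
  set h := 2 ^ a with hh
  have hgh : g = 2 * h := by rw [hg, hh, pow_succ']
  have hh0 : 0 < h := by positivity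
  have hgL : g < 2 ^ L := by
    rw [hg, hLdef]; exact Nat.pow_lt_pow_right (by norm_num) (by omega)
  have hlk0 : 0 < L ^ k := by positivity
  rw [roundProg, wp_cons]
  refine Wp.mono (wp_sizeProg s hL) ?_
  rintro t1 s1 ⟨ht1, hfr1, hg1, hh1⟩
  rw [wp_cons]
  refine Wp.mono (wp_powProg s1) ?_
  rintro t2 s2 ⟨ht2, hfr2, hlk2⟩
  rw [wp_cons, wp_set, wp_cons]
  rw [hfr1.n .k (by simp), hk] at ht2 hlk2
  rw [hfr1.n .L (by simp), hL] at hlk2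
  rw [hL] at ht1
  refine Wp.mono (wp_shiftProg _ (g := g) (L := L) ?_ ?_) ?_
  · rw [State.wN_N_ne _ _ _ (by simp), hfr2.n _ (by simp), hg1]
  · rw [State.wN_N_ne _ _ _ (by simp), hfr2.n _ (by simp), hfr1.n _ (by simp), hL]
  rintro t3 s3 ⟨ht3, hfr3, hsh3⟩
  have eR3 : s3.R = s.R := by
    funext c
    rw [hfr3.r c (by simp), State.wN_R, hfr2.r c (by simp), hfr1.r c (by simp)]
  have F3 : Fr roundNames roundReals s s3 := by
    refine hfr3.comp (by simp [roundNames, blockNames]) (by simp) ?_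
    rw [Fr.wN_iff (by simp [roundNames])]
    exact hfr2.comp (by simp [roundNames, blockNames]) (by simp)
      (hfr1.mono (by simp [roundNames, blockNames]) (by simp))
  have g3 : s3.N .g 0 = g := by
    rw [hfr3.n _ (by simp), State.wN_N_ne _ _ _ (by simp), hfr2.n _ (by simp), hg1]
  have h3 : s3.N .h 0 = h := by
    rw [hfr3.n _ (by simp), State.wN_N_ne _ _ _ (by simp), hfr2.n _ (by simp), hh1]
  have L3 : s3.N .L 0 = L := by rw [F3.n _ (by simp [roundNames, blockNames]), hL]
  have k3 : s3.N .k 0 = k := by rw [F3.n _ (by simp [roundNames, blockNames]), hk]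
  have lk3 : s3.N .lk 0 = L ^ k := by
    rw [hfr3.n _ (by simp), State.wN_N_ne _ _ _ (by simp), hlk2]
  have sv3 : s3.N .s 0 = 2 * L ^ k := by
    rw [hfr3.n _ (by simp), State.wN_N_same]
    simp [hlk2, two_mul]
  have N3 : s3.N .N 0 = B * g := by
    rw [hfr3.n _ (by simp), State.wN_N_ne _ _ _ (by simp), hfr2.n _ (by simp),
      hfr1.n _ (by simp), hN]
  rw [wp_cons, wp_set, wp_cons, wp_set, wp_cons]
  set s4 := (s3.wN .wp 0 ((NExp.lit 0).eval s3)) with hs4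
  set s5 := s4.wN .base 0 ((NExp.lit 0).eval s4) with hs5
  have e5 : ∀ c, c ∉ [NV.wp, .base] → s5.N c = s3.N c := by
    intro c hc
    simp only [List.mem_cons, List.not_mem_nil, or_false, not_or] at hc
    rw [hs5, State.wN_N_ne _ _ _ hc.2, hs4, State.wN_N_ne _ _ _ hc.1]
  have eR5 : s5.R = s.R := eR3
  set T := 9000 * (k * (L * (L ^ k * (g * g * g)))) with hT
  set D : ℝ := 4 * (((L : ℕ) : ℝ) ^ k) ^ 2 with hD
  refine Wp.mono (wp_loop B (T + 20) (fun b s' => Fr (.base :: blockNames) roundReals s5 s' ∧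
    s'.N .base 0 = b * g ∧ s'.N .wp 0 = b * h ∧
    (∀ z, b * g * k ≤ z → s'.R .pt z = s.R .pt z) ∧
    Halved (b * h) (b * g) (b * D) (s'.pts k) (s.pts k)) ?_ ?_ ?_) ?_
  · refine ⟨by simp, by simp [hs5], by simp [hs5, hs4], by simp [eR5], fun u => u, by simp, by simp, by simp,
      by simp⟩
  · rintro b hb s6 ⟨hfr6, hbase6, hwp6, hpt6, hhalf6⟩
    have e6 : ∀ c, c ∉ NV.base :: blockNames → s6.N c = s3.N c := by
      intro c hc
      rw [hfr6.n c hc]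
      refine e5 c fun h' => hc ?_
      simp only [List.mem_cons, List.not_mem_nil, or_false] at h'
      rcases h' with rfl | rfl <;> simp [blockNames]
    refine ⟨?_, ?_⟩
    · simp only [BExp.holds_natLT, NV.eval_v, hbase6, e6 .N (by simp [blockNames]), N3]
      exact Nat.mul_lt_mul_of_pos_right hb (by omega)
    rw [wp_cons]
    refine Wp.mono (wp_blockProg s6 (g := g) (h := h) (L := L) (k := k) (b := b * g) (wp := b * h)
      (by rw [e6 _ (by simp [blockNames]), g3]) (by rw [e6 _ (by simp [blockNames]), h3])
      (by rw [e6 _ (by simp [blockNames]), L3]) (by rw [e6 _ (by simp [blockNames]), k3])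
      (by rw [e6 _ (by simp [blockNames]), lk3]) (by rw [e6 _ (by simp [blockNames]), sv3])
      hbase6 hwp6 ?_ hgh (by omega) hgL hk0 (Nat.mul_le_mul_left _ (by omega))) ?_
    · rw [e6 _ (by simp [blockNames])]; exact hsh3
    rintro t7 s7 ⟨ht7, hfr7, hwp7, hpt7, τ, q1, q2, q3, q4⟩
    have eg7 : s7.N .g 0 = g := by
      rw [hfr7.n _ (by simp [blockNames]), e6 _ (by simp [blockNames]), g3]
    have eb7 : s7.N .base 0 = b * g := by rw [hfr7.n _ (by simp [blockNames]), hbase6]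
    simp only [wp_cons, wp_set, wp_nil, NExp.eval_add, NV.eval_v, eg7, eb7]
    have epts : ∀ i, s6.pts k (b * g + i) = s.pts k (b * g + i) := by
      intro i
      funext j
      refine hpt6 _ ?_
      rw [add_mul, add_assoc]
      exact Nat.le_add_right _ _
    refine ⟨?_, ?_, ?_, ?_, fun z hz => ?_, ?_⟩
    · simp only [NExp.cost_add, NV.cost_v]; omega
    · rw [Fr.wN_iff (by simp)]
      exact hfr7.comp (fun _ h => List.mem_cons_of_mem _ h) (by simp [roundReals]) hfr6
    · simp [add_mul]
    · rw [State.wN_N_ne _ _ _ (by simp), hwp7, add_mul, one_mul]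
    · have h1 : b * g * k ≤ (b + 1) * g * k := Nat.mul_le_mul_right _
        (Nat.mul_le_mul_right _ (by omega))
      rw [State.wN_R, hpt7 z (Or.inr ?_), hpt6 z (h1.trans hz)]
      refine le_trans (le_of_eq ?_) hz
      ring
    · rw [add_mul, one_mul, add_mul, one_mul, Nat.cast_succ, add_mul, one_mul]
      refine Halved.append (Q' := s7.pts k) ?_ ⟨τ, q1, q2, fun u hu => ?_, fun v => ?_⟩
      · -- The points selected earlier are not touched any more.
        have hkeep : ∀ u < b * h, s7.pts k u = s6.pts k u := by
          intro u hu
          funext j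
          refine hpt7 _ (Or.inl ?_)
          have : (u + 1) * k ≤ b * h * k := Nat.mul_le_mul_right _ hu
          rw [add_mul, one_mul] at this
          exact (Nat.add_lt_add_left j.2 _).trans_le this
        obtain ⟨τ', c1, c2, c3, c4⟩ := hhalf6
        refine ⟨τ', c1, c2, fun u hu => by rw [hkeep u hu, c3 u hu], fun v => ?_⟩
        rw [filter_congr fun u hu => by rw [hkeep u (mem_range.mp hu)]]
        exact c4 v
      · change s7.pts k (b * h + u) = s.pts k (b * g + τ u)
        rw [← epts]
        funext j
        exact q3 u hu j j.2
      · have := q4 v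
        simp only [← epts]
        rw [filter_congr (q := fun u => ∀ j : Fin k, s6.R .pt ((b * g + τ u) * k + j) ≤ v j)
          fun u hu => ?_]
        · convert this using 4
          refine congrArg (fun n : ℕ => (n : ℝ)) (congrArg card ?_)
          ext i
          simp only [mem_filter]
          exact Iff.rfl
        · have : s7.pts k (b * h + u) = s6.pts k (b * g + τ u) := by
            funext j
            exact q3 u (mem_range.mp hu) j j.2
          rw [this]
          exact Iff.rfl
  · rintro s6 ⟨hfr6, hbase6, -⟩
    have : s6.N .N 0 = B * g := by
      rw [hfr6.n _ (by simp [blockNames]), e5 _ (by simp), N3]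
    simp [hbase6, this]
  rintro t6 s6 ⟨ht6, hfr6, hbase6, hwp6, hpt6, hhalf6⟩
  simp only [wp_cons, wp_set, wp_nil, NV.eval_v, hwp6]
  refine ⟨?_, ?_, by simp, hhalf6⟩
  · have e1 : g ^ 3 = g * g * g := by ring
    rw [e1]
    have hM : 1 ≤ L ^ k * (g * g * g) := Nat.one_le_iff_ne_zero.mpr (by positivity)
    have i1 : L * 1 ≤ L * (L ^ k * (g * g * g)) := Nat.mul_le_mul_left _ hM
    have hM' : 1 ≤ L * (L ^ k * (g * g * g)) := Nat.one_le_iff_ne_zero.mpr (by positivity)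
    have i2 : k * 1 ≤ k * (L * (L ^ k * (g * g * g))) := Nat.mul_le_mul_left _ hM'
    have i3 : L * (L ^ k * (g * g * g)) ≤ k * (L * (L ^ k * (g * g * g))) :=
      Nat.le_mul_of_pos_left _ hk0
    have hM'' : 1 ≤ k * (L * (L ^ k * (g * g * g))) := Nat.one_le_iff_ne_zero.mpr (by positivity)
    have i4 : B * 1 ≤ B * (k * (L * (L ^ k * (g * g * g)))) := Nat.mul_le_mul_left _ hM''
    have i5 : k * (L * (L ^ k * (g * g * g))) ≤ B * (k * (L * (L ^ k * (g * g * g)))) :=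
      Nat.le_mul_of_pos_left _ hB
    have i6 : L * g ≤ L * (L ^ k * (g * g * g)) := by
      refine Nat.mul_le_mul_left _ ((Nat.le_mul_of_pos_right g (by omega : 0 < g)).trans ?_)
      exact (Nat.le_mul_of_pos_right _ (by omega : 0 < g)).trans (Nat.le_mul_of_pos_left _ hlk0)
    have e2 : B * (T + 20 + 5 + 1) =
        9000 * (B * (k * (L * (L ^ k * (g * g * g))))) + 26 * B := by
      rw [hT]; ring
    have e3 : L * (g * 60 + 60) = 60 * (L * g) + 60 * L := by ring
    have ht6' : t6 ≤ 9000 * (B * (k * (L * (L ^ k * (g * g * g))))) + 26 * B + 6 := by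
      rw [← e2]
      refine ht6.trans (le_of_eq ?_)
      simp
    rw [e3] at ht3
    clear ht6 e2 e3 e1
    clear_value T
    simp only [NExp.cost_add, NExp.cost_lit, NV.cost_v]
    generalize B * (k * (L * (L ^ k * (g * g * g)))) = u1 at *
    generalize k * (L * (L ^ k * (g * g * g))) = u2 at *
    generalize L * (L ^ k * (g * g * g)) = u3 at *
    generalize L * g = u4 at *
    clear_value L
    clear hT hM hgL
    omega
  · rw [Fr.wN_iff (by simp [roundNames])]
    refine hfr6.comp (by simp [roundNames, blockNames]) (by simp) ?_
    rw [hs5, Fr.wN_iff (by simp [roundNames]), hs4, Fr.wN_iff (by simp [roundNames, blockNames])]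
    exact F3

end Round

/-! ### The parameters of a run -/

section Params

variable {X : Type*} {K : ℕ} {e : Env X K}

/-- Find the least `a` with `256 (a + 1) ^ (2 k) ≤ 2 ^ a ε`, and let `L = a + 1` and `g = 2 ^ a`. -/
def levelProg : Prog := block [NV.L.set (.lit 1), NV.g.set (.lit 1), NV.w.set (.lit 1),
  .loop (.realLT (.ofNat NV.g.v * RV.eps.v) (.ofNat (.lit 256 * NV.w.v)))
    (block [NV.L.set (NV.L.v + .lit 1), NV.g.set (NV.g.v + NV.g.v), powProg,
      NV.w.set (NV.lk.v * NV.lk.v)])]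

/-- The search for the level, where `a` is given by its minimality. -/
theorem wp_levelProg (s : State) {k a : ℕ} {ε : ℝ} (hk : s.N .k 0 = k) (hε : s.R .eps 0 = ε)
    (h1 : ∀ x < a, (2 : ℝ) ^ x * ε < 256 * ((x : ℝ) + 1) ^ (2 * k))
    (h2 : 256 * ((a : ℝ) + 1) ^ (2 * k) ≤ 2 ^ a * ε) :
    Wp e levelProg s (fun t s' => t ≤ a * (k * 40 + 150) + 50 ∧
      Fr [.L, .g, .w, .i, .lk] [] s s' ∧ s'.N .L 0 = a + 1 ∧ s'.N .g 0 = 2 ^ a) := by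
  simp only [levelProg, wp_cons, wp_set]
  refine Wp.mono (wp_loop a (k * 40 + 80) (fun x s' => Fr [.L, .g, .w, .i, .lk] [] s s' ∧
    s'.N .L 0 = x + 1 ∧ s'.N .g 0 = 2 ^ x ∧ s'.N .w 0 = (x + 1) ^ (2 * k)) ?_ ?_ ?_) ?_
  · simp
  · rintro x hx s1 ⟨hfr, hL, hg, hw⟩
    have hε' : s1.R .eps 0 = ε := by rw [hfr.r _ (by simp), hε]
    refine ⟨?_, ?_⟩
    · have := h1 x hx
      simp only [BExp.holds_realLT, RExp.eval_mul, RExp.eval_ofNat, NV.eval_v, RV.eval_v, hg, hε',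
        NExp.eval_mul, NExp.eval_lit, hw]
      push_cast
      exact this
    · simp only [wp_cons, wp_set]
      refine Wp.mono (wp_powProg _) ?_
      rintro t s2 ⟨ht, hfr2, hlk⟩
      simp [hL, hg, hfr.n .k (by simp), hk] at ht hlk
      simp only [wp_nil, NExp.eval_mul, NV.eval_v, hlk]
      refine ⟨?_, ?_, ?_, ?_, ?_⟩
      · simp only [NExp.cost_add, NExp.cost_mul, NV.cost_v, NExp.cost_lit]; omega
      · rw [Fr.wN_iff (by simp)]
        refine hfr2.comp (by simp) (by simp) ?_
        rwa [Fr.wN_iff (by simp), Fr.wN_iff (by simp)]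
      · rw [State.wN_N_ne _ _ _ (by simp), hfr2.n _ (by simp)]
        simp [hL]
      · rw [State.wN_N_ne _ _ _ (by simp), hfr2.n _ (by simp)]
        simp [hg, pow_succ, mul_two]
      · simp [two_mul, pow_add]
  · rintro s1 ⟨hfr, hL, hg, hw⟩
    have hε' : s1.R .eps 0 = ε := by rw [hfr.r _ (by simp), hε]
    simp only [BExp.holds_realLT, RExp.eval_mul, RExp.eval_ofNat, NV.eval_v, RV.eval_v, hg, hε',
      NExp.eval_mul, NExp.eval_lit, hw, not_lt]
    push_cast
    exact h2
  · rintro t s1 ⟨ht, hfr, hL, hg, hw⟩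
    simp only [wp_nil]
    refine ⟨?_, hfr, hL, hg⟩
    simp at ht ⊢
    have : a * (k * 40 + 80 + 12 + 1) ≤ a * (k * 40 + 150) := Nat.mul_le_mul_left _ (by omega)
    omega

/-- Find the least `p` with `k ≤ 2 ^ p ε δ`. -/
def confidenceProg : Prog := block [NV.pw.set (.lit 1), NV.p.set (.lit 0),
  .loop (.realLT (.ofNat NV.pw.v * RV.eps.v * RV.delta.v) (.ofNat NV.k.v))
    (block [NV.pw.set (NV.pw.v + NV.pw.v), NV.p.set (NV.p.v + .lit 1)])]

theorem wp_confidenceProg (s : State) {k p : ℕ} {ε δ : ℝ} (hk : s.N .k 0 = k)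
    (hε : s.R .eps 0 = ε) (hδ : s.R .delta 0 = δ) (h1 : ∀ x < p, (2 : ℝ) ^ x * ε * δ < k)
    (h2 : (k : ℝ) ≤ 2 ^ p * ε * δ) :
    Wp e confidenceProg s (fun t s' => t ≤ p * 100 + 50 ∧ Fr [.pw, .p] [] s s' ∧
      s'.N .p 0 = p) := by
  simp only [confidenceProg, wp_cons, wp_set]
  refine Wp.mono (wp_loop p 50 (fun x s' => Fr [.pw, .p] [] s s' ∧
    s'.N .pw 0 = 2 ^ x ∧ s'.N .p 0 = x) ?_ ?_ ?_) ?_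
  · simp
  · rintro x hx s1 ⟨hfr, hpw, hp⟩
    refine ⟨?_, ?_⟩
    · simpa [hpw, hfr.r .eps (by simp), hε, hfr.r .delta (by simp), hδ, hfr.n .k (by simp), hk]
        using h1 x hx
    · simp [hpw, hp, hfr, pow_succ, mul_two]
  · rintro s1 ⟨hfr, hpw, hp⟩
    simpa [hpw, hfr.r .eps (by simp), hε, hfr.r .delta (by simp), hδ, hfr.n .k (by simp), hk]
        using h2
  · rintro t s1 ⟨ht, hfr, -, hp⟩
    simp only [wp_nil]
    refine ⟨?_, hfr, hp⟩
    simp at ht ⊢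
    omega

/-- Find the least `r` with `32 k p ≤ 16 ^ r g ε ^ 2`, and let `N = 16 ^ r g`. -/
def countProg : Prog := block [NV.N.set NV.g.v, NV.r.set (.lit 0),
  .loop (.realLT (.ofNat NV.N.v * RV.eps.v * RV.eps.v) (.ofNat (.lit 32 * (NV.k.v * NV.p.v))))
    (block [NV.N.set (.lit 16 * NV.N.v), NV.r.set (NV.r.v + .lit 1)])]

theorem wp_countProg (s : State) {k p g r : ℕ} {ε : ℝ} (hk : s.N .k 0 = k)
    (hε : s.R .eps 0 = ε) (hp : s.N .p 0 = p) (hg : s.N .g 0 = g)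
    (h1 : ∀ x < r, ((16 ^ x * g : ℕ) : ℝ) * ε * ε < 32 * (k * p))
    (h2 : 32 * ((k : ℝ) * p) ≤ ((16 ^ r * g : ℕ) : ℝ) * ε * ε) :
    Wp e countProg s (fun t s' => t ≤ r * 100 + 50 ∧ Fr [.N, .r] [] s s' ∧
      s'.N .r 0 = r ∧ s'.N .N 0 = 16 ^ r * g) := by
  simp only [countProg, wp_cons, wp_set]
  refine Wp.mono (wp_loop r 50 (fun x s' => Fr [.N, .r] [] s s' ∧
    s'.N .r 0 = x ∧ s'.N .N 0 = 16 ^ x * g) ?_ ?_ ?_) ?_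
  · simp [hg]
  · rintro x hx s1 ⟨hfr, hr, hN⟩
    refine ⟨?_, ?_⟩
    · have := h1 x hx
      push_cast at this
      simpa [hN, hfr.r .eps (by simp), hε, hfr.n .p (by simp), hp, hfr.n .k (by simp), hk]
        using this
    · simp [hN, hr, hfr, pow_succ]
      ring
  · rintro s1 ⟨hfr, hr, hN⟩
    push_cast at h2
    simpa [hN, hfr.r .eps (by simp), hε, hfr.n .p (by simp), hp, hfr.n .k (by simp), hk]
        using h2
  · rintro t s1 ⟨ht, hfr, hr, hN⟩
    simp only [wp_nil]
    refine ⟨?_, hfr, hr, hN⟩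
    simp at ht ⊢
    omega

end Params

/-! ### Drawing the sample, and writing the output -/

section Transfer

variable {X : Type*} {k : ℕ} {e : Env X k}

/-- The names of all arrays of real numbers. -/
def allReals : List RV := [.eps, .delta, .th, .d, .y, .u, .pt, .x, .tb]

theorem mem_allReals (c : RV) : c ∈ allReals := by cases c <;> simp [allReals]

/-- Draw `N` points.  The cells to which a point is drawn lie beyond those of all coordinates of
the sample. -/
def drawProg : Prog := block [NV.z.set (.lit 64 * (NV.N.v * NV.k.v)), NV.u.set (.lit 0),
  .loop (.natLT NV.u.v NV.N.v) (block [.sample NV.z.v,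
    forN .j .k (RV.pt.setAt (NV.u.v * NV.k.v + NV.j.v) (.get (NV.z.v + NV.j.v))),
    NV.u.set (NV.u.v + .lit 1)])]

theorem wp_drawProg (s : State) {N : ℕ} (hk : s.N .k 0 = k) (hN : s.N .N 0 = N)
    (hs : s.drawn = 0) :
    Wp e drawProg s (fun t s' => t ≤ N * (e.n + e.T + k * 60 + 60) + 60 ∧
      (∀ c, c ∉ [NV.z, .u, .j] → s'.N c = s.N c) ∧
      ∀ i < N, s'.pts k i = e.f (e.ω i)) := by
  simp only [drawProg, wp_cons, wp_set]
  refine Wp.mono (wp_loop N (e.n + e.T + k * 60 + 40) (fun x s' =>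
    (∀ c, c ∉ [NV.z, .u, .j] → s'.N c = s.N c) ∧ s'.N .z 0 = 64 * (N * k) ∧ s'.N .u 0 = x ∧
    s'.drawn = x ∧ ∀ i < x, s'.pts k i = e.f (e.ω i)) ?_ ?_ ?_) ?_
  · refine ⟨fun c hc => ?_, by simp [hk, hN], by simp, by simpa using hs, by simp⟩
    simp only [List.mem_cons, List.not_mem_nil, or_false, not_or] at hc
    rw [State.wN_N_ne _ _ _ hc.2.1, State.wN_N_ne _ _ _ hc.1]
  · rintro x hx s1 ⟨hfr, hz, hu, hdr, hpt⟩
    refine ⟨by simp [hu, hfr .N (by simp), hN, hx], ?_⟩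
    rw [wp_cons, wp_sample, wp_cons]
    set s2 : State := { s1 with
        real := storeVec s1.real (NV.z.v.eval s1) (e.f (e.ω s1.drawn))
        drawn := s1.drawn + 1 } with hs2
    have hreal : ∀ m, s2.real m = storeVec s1.real (64 * (N * k)) (e.f (e.ω x)) m := by
      intro m; rw [hs2, NV.eval_v, hz, hdr]
    have eN2 : s2.N = s1.N := rfl
    have hlow : ∀ m, m < 64 * (N * k) → s2.real m = s1.real m := by
      intro m hm
      rw [hreal, storeVec, dif_neg (by omega)]
    have hptaddr : ∀ i < N, ∀ j < k, 64 * (i * k + j) + RV.pt.ctorIdx < 64 * (N * k) := by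
      intro i hi j hj
      have h1 : (i + 1) * k ≤ N * k := Nat.mul_le_mul_right _ hi
      rw [add_mul, one_mul] at h1
      have h2 := RV.pt.ctorIdx_lt
      generalize i * k = u at *
      generalize N * k = v at *
      omega
    refine Wp.mono (wp_for k 40 [] [.pt] (fun y s' =>
        (∀ m, 64 * (N * k) ≤ m → s'.real m = s2.real m) ∧
        (∀ i < x, ∀ j < k, s'.R .pt (i * k + j) = s2.R .pt (i * k + j)) ∧
        ∀ j (hj : j < k), j < y → s'.R .pt (x * k + j) = e.f (e.ω x) ⟨j, hj⟩)
      (by rw [eN2, hfr .k (by simp), hk]) (by simp) (by simp) (fun _ _ _ h => h) (by simp) ?_) ?_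
    · rintro y hy s3 hfr3 hj3 ⟨p1, p2, p3⟩
      have e3 : ∀ c, c ∉ [NV.j] → s3.N c = s1.N c := fun c hc => (hfr3.n c hc).trans (by rw [eN2])
      have hread : s3.real (64 * (N * k) + y) = e.f (e.ω x) ⟨y, hy⟩ := by
        rw [p1 _ (Nat.le_add_right _ _), hreal, storeVec, dif_pos ⟨by omega, by omega⟩]
        congr 2
        omega
      simp only [wp_rsetAt, NExp.eval_add, NExp.eval_mul, NV.eval_v, e3 .u (by simp), hu,
        e3 .k (by simp), hfr .k (by simp), hk, hj3, RExp.eval, e3 .z (by simp), hz, hread]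
      refine ⟨by simp [RExp.cost], by simp, fun m hm => ?_, fun i hi j hj => ?_, fun j hj hjy => ?_⟩
      · have := hptaddr x hx y hy
        rw [← p1 m hm]
        exact Function.update_of_ne (by omega) _ _
      · rw [State.wR_R_same, Function.update_of_ne, p2 i hi j hj]
        have h1 : (i + 1) * k ≤ x * k := Nat.mul_le_mul_right _ hi
        rw [add_mul, one_mul] at h1
        omega
      · rw [State.wR_R_same, Function.update_apply]
        split_ifs with h
        · have : j = y := Nat.add_left_cancel h
          subst this
          rfl
        · exact p3 j hj (by omega)
    · rintro t s3 ⟨ht, hfr3, p1, p2, p3⟩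
      have e3 : ∀ c, c ∉ [NV.j] → s3.N c = s1.N c := fun c hc => (hfr3.n c hc).trans (by rw [eN2])
      simp only [wp_cons, wp_set, wp_nil, NExp.eval_add, NV.eval_v, e3 .u (by simp), hu,
        NExp.eval_lit]
      refine ⟨?_, fun c hc => ?_, ?_, by simp, ?_, fun i hi => ?_⟩
      · simp only [NExp.cost_add, NV.cost_v, NExp.cost_lit]
        have : k * (40 + 13) ≤ k * 60 := Nat.mul_le_mul_left _ (by norm_num)
        omega
      · simp only [List.mem_cons, List.not_mem_nil, or_false, not_or] at hc
        rw [State.wN_N_ne _ _ _ hc.2.1, e3 _ (by simp [hc]), hfr _ (by simp [hc])]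
      · rw [State.wN_N_ne _ _ _ (by simp), e3 _ (by simp), hz]
      · rw [State.wN_drawn, hfr3.drawn]
        exact congrArg (· + 1) hdr
      · funext j
        rcases Nat.lt_succ_iff_lt_or_eq.mp hi with h | rfl
        · rw [← hpt i h]
          exact (p2 i h j j.2).trans (hlow _ (hptaddr i (by omega) j j.2))
        · exact p3 j j.2 j.2
  · rintro s1 ⟨hfr, hz, hu, -, -⟩
    simp [hu, hfr .N (by simp), hN]
  · rintro t s1 ⟨ht, hfr, -, -, -, hpt⟩
    simp only [wp_nil]
    refine ⟨?_, hfr, hpt⟩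
    simp at ht ⊢
    have : N * (e.n + e.T + k * 60 + 40 + 5 + 1) ≤ N * (e.n + e.T + k * 60 + 60) :=
      Nat.mul_le_mul_left _ (by omega)
    omega

/-- Write the sample to the cells in which the output is expected.  The cell that is written has a
smaller address than the cells still to be read. -/
def outputProg : Prog := block [NV.z.set (NV.N.v * NV.k.v),
  forN .u .z (.setR NV.u.v (RV.pt.at NV.u.v)), NV.k.set NV.N.v]

theorem wp_outputProg (s : State) {N : ℕ} (hk : s.N .k 0 = k) (hN : s.N .N 0 = N) :
    Wp e outputProg s (fun t s' => t ≤ N * k * 40 + 50 ∧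
      output k s' = (Multiset.range N).map (s.pts k)) := by
  simp only [outputProg, wp_cons, wp_set]
  refine Wp.mono (wp_for (N * k) 20 [] allReals (fun x s' =>
    (∀ m < x, s'.real m = s.R .pt m) ∧ ∀ m, x ≤ m → s'.real m = s.real m)
    (by simp [hk, hN]) (by simp) (by simp) (fun _ _ _ h => h) ⟨by simp, fun _ _ => rfl⟩ ?_) ?_
  · rintro x hx s1 hfr hu ⟨p1, p2⟩
    simp only [wp_setR, NV.eval_v, hu, RV.eval_at]
    refine ⟨by simp, ⟨fun _ _ => rfl, fun c hc => absurd (mem_allReals c) hc, rfl⟩,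
      fun m hm => ?_, fun m hm => ?_⟩
    · rw [Function.update_apply]
      split_ifs with h
      · rw [h, State.R, p2 _ (by omega)]
        rfl
      · exact p1 m (by omega)
    · rw [Function.update_of_ne (by omega), p2 m (by omega)]
  · rintro t s1 ⟨ht, hfr, p1, -⟩
    simp only [NV.eval_v, hfr.n .N (by simp), wp_nil]
    refine ⟨?_, ?_⟩
    · simp
      omega
    · have e1 : (s1.wN .k 0 N).nat 0 = N := by
        have := congrFun (State.wN_N_same s1 .k 0 N) 0
        simpa [State.N, NV.ctorIdx] using this
      rw [State.wN_N_ne _ _ _ (by simp), hN, output, e1]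
      refine Multiset.map_congr rfl fun i hi => ?_
      funext j
      have h1 : (i + 1) * k ≤ N * k := Nat.mul_le_mul_right _ (Multiset.mem_range.mp hi)
      rw [add_mul, one_mul] at h1
      exact p1 _ ((Nat.add_lt_add_left j.2 _).trans_le h1)

end Transfer

/-! ### Reducing the sample -/

section Reduce

open Classical in
/-- The points `Q' 0, …, Q' (m - 1)` are `m` of the points `Q 0, …, Q (n - 1)`, and the fractions of
both families in an orthant differ by at most `E`. -/
def Thinned {k : ℕ} (m n : ℕ) (E : ℝ) (Q' Q : ℕ → Fin k → ℝ) : Prop :=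
  ∃ τ : ℕ → ℕ, (∀ u < m, τ u < n) ∧ (∀ u < m, ∀ u' < m, τ u = τ u' → u = u') ∧
    (∀ u < m, Q' u = Q (τ u)) ∧
    ∀ v, |(#{u ∈ range m | Q' u ≤ v} : ℝ) / m - #{i ∈ range n | Q i ≤ v} / n| ≤ E

theorem Thinned.refl {k : ℕ} (m : ℕ) (Q : ℕ → Fin k → ℝ) : Thinned m m 0 Q Q :=
  ⟨fun u => u, by simp, by simp, by simp, by simp⟩

theorem Thinned.trans {k : ℕ} {m n l : ℕ} {E E' : ℝ} {Q'' Q' Q : ℕ → Fin k → ℝ}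
    (h : Thinned l m E' Q'' Q') (h' : Thinned m n E Q' Q) : Thinned l n (E + E') Q'' Q := by
  obtain ⟨τ, a1, a2, a3, a4⟩ := h
  obtain ⟨τ', b1, b2, b3, b4⟩ := h'
  refine ⟨fun u => τ' (τ u), fun u hu => b1 _ (a1 u hu), fun u hu u' hu' h => ?_, fun u hu => ?_,
    fun v => ?_⟩
  · exact a2 u hu u' hu' (b2 _ (a1 u hu) _ (a1 u' hu') h)
  · rw [a3 u hu, b3 _ (a1 u hu)]
  · have h1 := a4 v
    have h2 := b4 v
    rw [abs_le] at h1 h2 ⊢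
    constructor <;> linarith

theorem Thinned.mono {k : ℕ} {m n : ℕ} {E E' : ℝ} {Q' Q : ℕ → Fin k → ℝ}
    (h : Thinned m n E Q' Q) (hE : E ≤ E') : Thinned m n E' Q' Q := by
  obtain ⟨τ, a1, a2, a3, a4⟩ := h
  exact ⟨τ, a1, a2, a3, fun v => (a4 v).trans hE⟩

/-- A bound for the error caused by halving the sample in blocks of `2 ^ c` points. -/
noncomputable def roundError (k c : ℕ) : ℝ := 8 * ((c : ℝ) + 1) ^ (2 * k) / 2 ^ c

open Classical in
/-- The error of a round relative to the size of the sample does not depend on the number `B` of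
blocks. -/
theorem Halved.thinned {k c B : ℕ} {Q' Q : ℕ → Fin k → ℝ} (hB : 0 < B)
    (h : Halved (B * 2 ^ c) (B * 2 ^ (c + 1)) (B * (4 * (((c + 2 : ℕ) : ℝ) ^ k) ^ 2)) Q' Q) :
    Thinned (B * 2 ^ c) (B * 2 ^ (c + 1)) (roundError k (c + 1)) Q' Q := by
  obtain ⟨τ, a1, a2, a3, a4⟩ := h
  refine ⟨τ, a1, a2, a3, fun v => ?_⟩
  have hB' : (0 : ℝ) < B := by exact_mod_cast hB
  have h1 := a4 v
  set x : ℝ := ((#{u ∈ range (B * 2 ^ c) | Q' u ≤ v} : ℕ) : ℝ)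
  set y : ℝ := ((#{u ∈ range (B * 2 ^ (c + 1)) | Q u ≤ v} : ℕ) : ℝ)
  have e1 : x / ((B * 2 ^ c : ℕ) : ℝ) - y / ((B * 2 ^ (c + 1) : ℕ) : ℝ) =
      (x - y / 2) / (B * 2 ^ c) := by
    push_cast
    field_simp
    ring
  have e2 : roundError k (c + 1) = B * (4 * (((c + 2 : ℕ) : ℝ) ^ k) ^ 2) / (B * 2 ^ c) := by
    rw [roundError, ← pow_mul, mul_comm k 2]
    push_cast
    field_simp
    ring
  rw [e1, e2, abs_div, abs_of_pos (by positivity : (0 : ℝ) < B * 2 ^ c)]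
  gcongr

variable {X : Type*} {K : ℕ} {e : Env X K}

/-- A round in terms of the exponent `c` of the size of its blocks. -/
theorem wp_roundProg_thinned (s : State) {k c y : ℕ} (hc : 0 < c) (hL : s.N .L 0 = c + 1)
    (hk : s.N .k 0 = k) (hN : s.N .N 0 = 2 * y * 2 ^ (c - 1)) (hk0 : 0 < k) (hy : 0 < y) :
    Wp e roundProg s (fun t s' => t ≤ 10000 * (y * (k * ((c + 1) ^ (k + 1) * 8 ^ c))) ∧
      Fr roundNames roundReals s s' ∧ s'.N .N 0 = y * 2 ^ (c - 1) ∧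
      Thinned (y * 2 ^ (c - 1)) (2 * y * 2 ^ (c - 1)) (roundError k c) (s'.pts k) (s.pts k)) := by
  obtain ⟨a, rfl⟩ : ∃ a, c = a + 1 := ⟨c - 1, by omega⟩
  have e1 : 2 * y * 2 ^ (a + 1 - 1) = y * 2 ^ (a + 1) := by
    rw [Nat.add_sub_cancel, pow_succ]; ring
  rw [e1] at hN ⊢
  rw [Nat.add_sub_cancel]
  refine Wp.mono (wp_roundProg s hL hk hN hk0 hy) ?_
  rintro t s' ⟨ht, hfr, hN', hh⟩
  refine ⟨ht.trans (le_of_eq ?_), hfr, hN', hh.thinned hy⟩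
  rw [show (8 : ℕ) = 2 ^ 3 by norm_num, ← pow_mul, ← pow_mul, mul_comm 3, pow_succ _ k]
  ring

/-- The time for halving a block of `2 ^ c` points, up to a factor of order `k`. -/
def roundCost (k c : ℕ) : ℕ := (c + 1) ^ (k + 1) * 8 ^ c

theorem roundCost_pos (k c : ℕ) : 0 < roundCost k c := by
  rw [roundCost]; positivity

/-- The cost of a block grows by less than a factor of `16`, by which the number of blocks decreases. -/
theorem roundCost_succ_le {k c : ℕ} (hk : 0 < k)
    (h : 2 * (c + 2) ^ (2 * k) ≤ 3 * (c + 1) ^ (2 * k)) :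
    roundCost k (c + 1) ≤ 12 * roundCost k c := by
  obtain ⟨m, rfl⟩ : ∃ m, k = m + 1 := ⟨k - 1, by omega⟩
  have h1 : 2 * (c + 2) ^ (m + 1 + 1) ≤ 3 * (c + 1) ^ (m + 1 + 1) := by
    have h2 : 2 * (c + 2) ^ (m + 1 + 1) * (c + 1) ^ m ≤ 3 * (c + 1) ^ (m + 1 + 1) * (c + 1) ^ m :=
      calc 2 * (c + 2) ^ (m + 1 + 1) * (c + 1) ^ m ≤ 2 * (c + 2) ^ (m + 1 + 1) * (c + 2) ^ m :=
            Nat.mul_le_mul_left _ (Nat.pow_le_pow_left (by omega) _)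
        _ = 2 * (c + 2) ^ (2 * (m + 1)) := by ring
        _ ≤ 3 * (c + 1) ^ (2 * (m + 1)) := h
        _ = 3 * (c + 1) ^ (m + 1 + 1) * (c + 1) ^ m := by ring
    exact Nat.le_of_mul_le_mul_right h2 (by positivity)
  have h2 : 8 ^ c * 4 * (2 * (c + 2) ^ (m + 1 + 1)) ≤ 8 ^ c * 4 * (3 * (c + 1) ^ (m + 1 + 1)) :=
    Nat.mul_le_mul_left _ h1
  rw [roundCost, roundCost]
  calc (c + 1 + 1) ^ (m + 1 + 1) * 8 ^ (c + 1) = 8 ^ c * 4 * (2 * (c + 2) ^ (m + 1 + 1)) := by ring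
    _ ≤ _ := h2
    _ = _ := by ring

theorem roundCost_le_succ (k c : ℕ) : 8 * roundCost k c ≤ roundCost k (c + 1) := by
  rw [roundCost, roundCost]
  calc 8 * ((c + 1) ^ (k + 1) * 8 ^ c) = (c + 1) ^ (k + 1) * 8 ^ (c + 1) := by ring
    _ ≤ (c + 1 + 1) ^ (k + 1) * 8 ^ (c + 1) :=
      Nat.mul_le_mul_right _ (Nat.pow_le_pow_left (by omega) _)

theorem roundError_nonneg (k c : ℕ) : 0 ≤ roundError k c := by
  rw [roundError]; positivity

/-- The errors of the rounds decrease geometrically in the size of the blocks. -/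
theorem roundError_succ_le {k c : ℕ} (h : 2 * (c + 2) ^ (2 * k) ≤ 3 * (c + 1) ^ (2 * k)) :
    roundError k (c + 1) ≤ 3 / 4 * roundError k c := by
  have h' : (2 : ℝ) * ((c : ℝ) + 2) ^ (2 * k) ≤ 3 * ((c : ℝ) + 1) ^ (2 * k) := by exact_mod_cast h
  rw [roundError, roundError, pow_succ, div_le_iff₀ (by positivity)]
  push_cast
  rw [show (c : ℝ) + 1 + 1 = c + 2 by ring]
  field_simp
  linarith

/-- Increase the size of the blocks, and reduce the size of the sample faster, until the sample is a
single block. -/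
def shrinkProg : Prog :=
  forN .kk .r (block [roundProg, roundProg, roundProg, NV.L.set (NV.L.v + .lit 1)])

/-- The errors `3 * roundError k c` of the steps are bounded by the differences of
`12 * roundError k c`, the costs by those of the potential of the loop. -/
theorem wp_shrinkProg (s : State) {k a r : ℕ} (hk0 : 0 < k) (ha : 0 < a) (hL : s.N .L 0 = a + 1)
    (hk : s.N .k 0 = k) (hr : s.N .r 0 = r) (hN : s.N .N 0 = 16 ^ r * 2 ^ a)
    (hgrow : ∀ c, a ≤ c → 2 * (c + 2) ^ (2 * k) ≤ 3 * (c + 1) ^ (2 * k)) :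
    Wp e shrinkProg s (fun t s' => t ≤ 80000 * (k * (16 ^ r * roundCost k a)) + 20 ∧
      Fr (.kk :: .L :: roundNames) roundReals s s' ∧ s'.N .L 0 = a + r + 1 ∧
      s'.N .N 0 = 2 ^ (a + r) ∧ Thinned (2 ^ (a + r)) (16 ^ r * 2 ^ a)
        (12 * (roundError k a - roundError k (a + r))) (s'.pts k) (s.pts k)) := by
  rw [shrinkProg, forN, wp_cons, wp_set, wp_cons]
  set s0 := s.wN .kk 0 ((NExp.lit 0).eval s) with hs0
  refine Wp.mono (wp_loop_potential r
    (fun x => 80000 * (k * (16 ^ (r - x) * roundCost k (a + x))))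
    (fun x s' => Fr (.kk :: .L :: roundNames) roundReals s s' ∧ s'.N .kk 0 = x ∧
      s'.N .L 0 = a + x + 1 ∧ s'.N .N 0 = 16 ^ (r - x) * 2 ^ (a + x) ∧
      Thinned (16 ^ (r - x) * 2 ^ (a + x)) (16 ^ r * 2 ^ a)
        (12 * (roundError k a - roundError k (a + x))) (s'.pts k) (s.pts k)) ?_ ?_ ?_) ?_
  · refine ⟨by simp [hs0], by simp [hs0], by simp [hs0, hL], by simp [hs0, hN], ?_⟩
    change Thinned _ _ _ (s.pts k) _
    simpa using Thinned.refl (16 ^ r * 2 ^ a) (s.pts k)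
  · rintro x hx s1 ⟨hfr1, hkk1, hL1, hN1, hth1⟩
    set c := a + x with hc
    set y := 16 ^ (r - (x + 1)) with hy
    have hy0 : 0 < y := by positivity
    have hsize : 16 ^ (r - x) * 2 ^ c = 2 * (16 * y) * 2 ^ (c - 1) := by
      rw [show r - x = r - (x + 1) + 1 by omega, pow_succ, ← hy]
      obtain ⟨m, hm⟩ : ∃ m, c = m + 1 := ⟨c - 1, by omega⟩
      rw [hm, Nat.add_sub_cancel, pow_succ]
      ring
    have hg := hgrow c (by omega)
    have hr1 : s1.N .r 0 = r := by rw [hfr1.n _ (by simp [roundNames, blockNames]), hr]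
    refine ⟨by simp [hkk1, hr1, hx], ?_⟩
    rw [hsize] at hN1 hth1
    simp only [wp_cons]
    refine Wp.mono (wp_roundProg_thinned s1 (y := 16 * y) (by omega) hL1
      (by rw [hfr1.n _ (by simp [roundNames, blockNames]), hk]) hN1 hk0 (by omega)) ?_
    rintro t2 s2 ⟨ht2, hfr2, hN2, hth2⟩
    rw [show 16 * y = 2 * (8 * y) by ring] at hN2
    refine Wp.mono (wp_roundProg_thinned s2 (y := 8 * y) (c := c) (k := k) (by omega)
      (by rw [hfr2.n _ (by simp [roundNames, blockNames]), hL1])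
      (by rw [hfr2.n _ (by simp [roundNames, blockNames]),
        hfr1.n _ (by simp [roundNames, blockNames]), hk]) hN2 hk0 (by omega)) ?_
    rintro t3 s3 ⟨ht3, hfr3, hN3, hth3⟩
    rw [show 8 * y = 2 * (4 * y) by ring] at hN3
    refine Wp.mono (wp_roundProg_thinned s3 (y := 4 * y) (c := c) (k := k) (by omega)
      (by rw [hfr3.n _ (by simp [roundNames, blockNames]),
        hfr2.n _ (by simp [roundNames, blockNames]), hL1])
      (by rw [hfr3.n _ (by simp [roundNames, blockNames]),
        hfr2.n _ (by simp [roundNames, blockNames]),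
        hfr1.n _ (by simp [roundNames, blockNames]), hk]) hN3 hk0 (by omega)) ?_
    rintro t4 s4 ⟨ht4, hfr4, hN4, hth4⟩
    have eL4 : s4.N .L 0 = c + 1 := by
      rw [hfr4.n _ (by simp [roundNames, blockNames]), hfr3.n _ (by simp [roundNames, blockNames]),
        hfr2.n _ (by simp [roundNames, blockNames]), hL1]
    have ekk4 : s4.N .kk 0 = x := by
      rw [hfr4.n _ (by simp [roundNames, blockNames]), hfr3.n _ (by simp [roundNames, blockNames]),
        hfr2.n _ (by simp [roundNames, blockNames]), hkk1]
    -- Three rounds divide the size by `8`; with blocks twice as large this is `1 / 16` of the blocks.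
    have hsize' : 4 * y * 2 ^ (c - 1) = y * 2 ^ (a + (x + 1)) := by
      obtain ⟨m, hm⟩ : ∃ m, c = m + 1 := ⟨c - 1, by omega⟩
      rw [show a + (x + 1) = c + 1 by omega, hm, Nat.add_sub_cancel, pow_succ, pow_succ]
      ring
    rw [show 2 * (4 * y) = 8 * y by ring] at hth4
    rw [show 2 * (8 * y) = 16 * y by ring] at hth3
    have hth := ((hth4.trans hth3).trans hth2).trans hth1
    rw [hsize'] at hth hN4
    simp only [wp_set, wp_nil, NExp.eval_add, NV.eval_v, eL4, NExp.eval_lit,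
      State.wN_N_ne _ (c := NV.L) (c' := NV.kk) _ _ (by simp), ekk4]
    refine ⟨?_, ?_, by simp, by simp [hc, add_assoc], ?_, ?_⟩
    · have hW := roundCost_succ_le hk0 hg
      have e1 : k * (16 ^ (r - x) * roundCost k c) = 16 * (k * (y * roundCost k c)) := by
        rw [show r - x = r - (x + 1) + 1 by omega, pow_succ, ← hy]
        ring
      have e2 : k * (y * roundCost k (a + (x + 1))) ≤ 12 * (k * (y * roundCost k c)) := by
        calc k * (y * roundCost k (a + (x + 1))) ≤ k * (y * (12 * roundCost k c)) :=
              Nat.mul_le_mul_left _ (Nat.mul_le_mul_left _ hW)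
          _ = _ := by ring
      have e3 : 0 < k * (y * roundCost k c) := by
        have := roundCost_pos k c
        positivity
      have e4 : ∀ z, z * y * (k * ((c + 1) ^ (k + 1) * 8 ^ c)) = z * (k * (y * roundCost k c)) := by
        intro z; rw [roundCost]; ring
      rw [e4] at ht2 ht3 ht4
      rw [e1]
      simp only [NExp.cost_add, NV.cost_v, NExp.cost_lit, BExp.cost_natLT]
      generalize k * (y * roundCost k c) = v at *
      generalize k * (y * roundCost k (a + (x + 1))) = v' at *
      omega
    · rw [Fr.wN_iff (by simp), Fr.wN_iff (by simp)]
      have hsub : ∀ c ∈ roundNames, c ∈ NV.kk :: .L :: roundNames := fun c hc =>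
        List.mem_cons_of_mem _ (List.mem_cons_of_mem _ hc)
      exact hfr4.comp hsub (by simp) (hfr3.comp hsub (by simp) (hfr2.comp hsub (by simp) hfr1))
    · rw [State.wN_N_ne _ _ _ (by simp), State.wN_N_ne _ _ _ (by simp), hN4]
    · refine Thinned.mono (Q' := s4.pts k) hth ?_
      have h1 := roundError_succ_le hg
      rw [show a + (x + 1) = c + 1 by omega]
      linarith
  · rintro s1 ⟨hfr1, hkk1, -⟩
    simp [hkk1, hfr1.n .r (by simp [roundNames, blockNames]), hr]
  · rintro t s1 ⟨ht, hfr1, -, hL1, hN1, hth1⟩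
    rw [Nat.sub_self, pow_zero, one_mul] at hN1 hth1
    rw [wp_nil]
    refine ⟨?_, hfr1, hL1, hN1, hth1⟩
    rw [Nat.sub_zero, add_zero] at ht
    simp only [BExp.cost_natLT, NV.cost_v, NExp.cost_lit] at ht ⊢
    omega

/-- Halve a sample that consists of a single block repeatedly. -/
def halveProg : Prog := forN .kk .r (block [roundProg, NV.L.set (NV.L.v - .lit 1)])

/-- The rounds on a single block, whose errors telescope as those of `shrinkProg`. -/
theorem wp_halveProg (s : State) {k a r : ℕ} (hk0 : 0 < k) (hL : s.N .L 0 = a + r + 1)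
    (hk : s.N .k 0 = k) (hr : s.N .r 0 = r) (hN : s.N .N 0 = 2 ^ (a + r))
    (hgrow : ∀ c, a ≤ c → 2 * (c + 2) ^ (2 * k) ≤ 3 * (c + 1) ^ (2 * k)) :
    Wp e halveProg s (fun t s' => t ≤ 20000 * (k * roundCost k (a + r)) + 20 ∧
      Fr (.kk :: .L :: roundNames) roundReals s s' ∧
      s'.N .N 0 = 2 ^ a ∧ Thinned (2 ^ a) (2 ^ (a + r))
        (4 * (roundError k a - roundError k (a + r))) (s'.pts k) (s.pts k)) := by
  rw [halveProg, forN, wp_cons, wp_set, wp_cons]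
  set s0 := s.wN .kk 0 ((NExp.lit 0).eval s) with hs0
  refine Wp.mono (wp_loop_potential r
    (fun x => 20000 * (k * roundCost k (a + (r - x))))
    (fun x s' => Fr (.kk :: .L :: roundNames) roundReals s s' ∧ s'.N .kk 0 = x ∧
      s'.N .L 0 = a + (r - x) + 1 ∧ s'.N .N 0 = 2 ^ (a + (r - x)) ∧
      Thinned (2 ^ (a + (r - x))) (2 ^ (a + r))
        (4 * (roundError k (a + (r - x)) - roundError k (a + r))) (s'.pts k) (s.pts k)) ?_ ?_ ?_) ?_
  · refine ⟨by simp [hs0], by simp [hs0], by simp [hs0, hL], by simp [hs0, hN], ?_⟩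
    change Thinned _ _ _ (s.pts k) _
    simpa using Thinned.refl (2 ^ (a + r)) (s.pts k)
  · rintro x hx s1 ⟨hfr1, hkk1, hL1, hN1, hth1⟩
    obtain ⟨c, hc⟩ : ∃ c, a + (r - x) = c + 1 := ⟨a + (r - x) - 1, by omega⟩
    have hc' : a + (r - (x + 1)) = c := by omega
    rw [hc] at hL1 hN1 hth1
    have hg := hgrow c (by omega)
    have hr1 : s1.N .r 0 = r := by rw [hfr1.n _ (by simp [roundNames, blockNames]), hr]
    refine ⟨by simp [hkk1, hr1, hx], ?_⟩
    have hsize : 2 ^ (c + 1) = 2 * 1 * 2 ^ (c + 1 - 1) := by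
      rw [Nat.add_sub_cancel, pow_succ]; ring
    rw [hsize] at hN1 hth1
    simp only [wp_cons]
    refine Wp.mono (wp_roundProg_thinned s1 (y := 1) (by omega) hL1
      (by rw [hfr1.n _ (by simp [roundNames, blockNames]), hk]) hN1 hk0 one_pos) ?_
    rintro t2 s2 ⟨ht2, hfr2, hN2, hth2⟩
    have hth := hth2.trans hth1
    rw [one_mul, Nat.add_sub_cancel] at hN2 hth
    have eL2 : s2.N .L 0 = c + 1 + 1 := by rw [hfr2.n _ (by simp [roundNames, blockNames]), hL1]
    have ekk2 : s2.N .kk 0 = x := by rw [hfr2.n _ (by simp [roundNames, blockNames]), hkk1]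
    simp only [wp_set, wp_nil, NExp.eval_add, NExp.eval_sub, NV.eval_v, eL2, NExp.eval_lit,
      State.wN_N_ne _ (c := NV.L) (c' := NV.kk) _ _ (by simp), ekk2, hc', hc]
    refine ⟨?_, ?_, by simp, by simp, ?_, ?_⟩
    · have hW : 8 * (k * roundCost k c) ≤ k * roundCost k (c + 1) := by
        calc 8 * (k * roundCost k c) = k * (8 * roundCost k c) := by ring
          _ ≤ _ := Nat.mul_le_mul_left _ (roundCost_le_succ k c)
      have e3 : 0 < k * roundCost k (c + 1) := by
        have := roundCost_pos k (c + 1)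
        positivity
      rw [one_mul, ← roundCost] at ht2
      simp only [NExp.cost_add, NExp.cost_sub, NV.cost_v, NExp.cost_lit, BExp.cost_natLT]
      generalize k * roundCost k (c + 1) = v at *
      generalize k * roundCost k c = v' at *
      omega
    · rw [Fr.wN_iff (by simp), Fr.wN_iff (by simp)]
      exact hfr2.comp (fun c hc => List.mem_cons_of_mem _ (List.mem_cons_of_mem _ hc)) (by simp) hfr1
    · rw [State.wN_N_ne _ _ _ (by simp), State.wN_N_ne _ _ _ (by simp), hN2]
    · refine Thinned.mono (Q' := s2.pts k) hth ?_
      have h1 := roundError_succ_le hg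
      have h2 := roundError_nonneg k c
      linarith
  · rintro s1 ⟨hfr1, hkk1, -⟩
    simp [hkk1, hfr1.n .r (by simp [roundNames, blockNames]), hr]
  · rintro t s1 ⟨ht, hfr1, -, hL1, hN1, hth1⟩
    rw [Nat.sub_self, add_zero] at hN1 hth1
    rw [wp_nil]
    refine ⟨?_, hfr1, hN1, hth1⟩
    rw [Nat.sub_zero] at ht
    simp only [BExp.cost_natLT, NV.cost_v, NExp.cost_lit] at ht ⊢
    omega

end Reduce

/-! ### The whole program -/

section Whole

variable {X : Type*} {k : ℕ} {e : Env X k}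

/-- Draw a sample and reduce it to a quantization. -/
def quantProg : Prog := block [levelProg, confidenceProg, countProg, drawProg, shrinkProg,
  halveProg, outputProg]

theorem initial_N (n : ℕ) (ε δ : ℝ) : (initial k n ε δ).N .k 0 = k := by
  simp [State.N, initial, NV.ctorIdx]

theorem initial_eps (n : ℕ) (ε δ : ℝ) : (initial k n ε δ).R .eps 0 = ε := by
  simp [State.R, initial, RV.ctorIdx]

theorem initial_delta (n : ℕ) (ε δ : ℝ) : (initial k n ε δ).R .delta 0 = δ := by
  simp [State.R, initial, RV.ctorIdx]

/-- For every sequence of draws the program halts in time, and its output is close to the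
empirical distribution of its sample. -/
theorem wp_quantProg {a p r : ℕ} {ε δ : ℝ} (hk0 : 0 < k) (ha : 0 < a) (hε0 : 0 ≤ ε) (hε1 : ε ≤ 1)
    (ha1 : ∀ x < a, (2 : ℝ) ^ x * ε < 256 * ((x : ℝ) + 1) ^ (2 * k))
    (ha2 : 256 * ((a : ℝ) + 1) ^ (2 * k) ≤ 2 ^ a * ε)
    (hp1 : ∀ x < p, (2 : ℝ) ^ x * ε * δ < k) (hp2 : (k : ℝ) ≤ 2 ^ p * ε * δ)
    (hr1 : ∀ x < r, ((16 ^ x * 2 ^ a : ℕ) : ℝ) * ε * ε < 32 * (k * p))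
    (hr2 : 32 * ((k : ℝ) * p) ≤ ((16 ^ r * 2 ^ a : ℕ) : ℝ) * ε * ε)
    (hgrow : ∀ c, a ≤ c → 2 * (c + 2) ^ (2 * k) ≤ 3 * (c + 1) ^ (2 * k)) :
    Wp e quantProg (initial k e.n ε δ) (fun t s' =>
      t ≤ 16 ^ r * 2 ^ a * (e.n + e.T) + 101000 * (k * (16 ^ r * roundCost k a)) ∧
      ∃ Q' : ℕ → Fin k → ℝ, output k s' = (Multiset.range (2 ^ a)).map Q' ∧
        Thinned (2 ^ a) (16 ^ r * 2 ^ a) (ε / 2) Q' (fun i => e.f (e.ω i))) := by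
  set s := initial k e.n ε δ with hs
  have hk : s.N .k 0 = k := initial_N _ _ _
  rw [quantProg, wp_cons]
  refine Wp.mono (wp_levelProg s hk (initial_eps _ _ _) ha1 ha2) ?_
  rintro t1 s1 ⟨ht1, hfr1, hL1, hg1⟩
  have hk1 : s1.N .k 0 = k := by rw [hfr1.n _ (by simp), hk]
  have hε1' : s1.R .eps 0 = ε := by rw [hfr1.r _ (by simp)]; exact initial_eps _ _ _
  rw [wp_cons]
  refine Wp.mono (wp_confidenceProg s1 hk1 hε1'
    (by rw [hfr1.r _ (by simp)]; exact initial_delta _ _ _) hp1 hp2) ?_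
  rintro t2 s2 ⟨ht2, hfr2, hp⟩
  have hk2 : s2.N .k 0 = k := by rw [hfr2.n _ (by simp), hk1]
  have hL2 : s2.N .L 0 = a + 1 := by rw [hfr2.n _ (by simp), hL1]
  rw [wp_cons]
  refine Wp.mono (wp_countProg s2 hk2 (by rw [hfr2.r _ (by simp), hε1']) hp
    (by rw [hfr2.n _ (by simp), hg1]) hr1 hr2) ?_
  rintro t3 s3 ⟨ht3, hfr3, hr3, hN3⟩
  have hk3 : s3.N .k 0 = k := by rw [hfr3.n _ (by simp), hk2]
  have hL3 : s3.N .L 0 = a + 1 := by rw [hfr3.n _ (by simp), hL2]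
  rw [wp_cons]
  refine Wp.mono (wp_drawProg s3 hk3 hN3 (by rw [hfr3.drawn, hfr2.drawn, hfr1.drawn]; rfl)) ?_
  rintro t4 s4 ⟨ht4, hfr4, hpt4⟩
  have hk4 : s4.N .k 0 = k := by rw [hfr4 _ (by simp), hk3]
  rw [wp_cons]
  refine Wp.mono (wp_shrinkProg s4 hk0 ha (by rw [hfr4 _ (by simp), hL3]) hk4
    (by rw [hfr4 _ (by simp), hr3]) (by rw [hfr4 _ (by simp), hN3]) hgrow) ?_
  rintro t5 s5 ⟨ht5, hfr5, hL5, hN5, hth5⟩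
  have hk5 : s5.N .k 0 = k := by rw [hfr5.n _ (by simp [roundNames, blockNames]), hk4]
  rw [wp_cons]
  refine Wp.mono (wp_halveProg s5 hk0 hL5 hk5
    (by rw [hfr5.n _ (by simp [roundNames, blockNames]), hfr4 _ (by simp), hr3]) hN5 hgrow) ?_
  rintro t6 s6 ⟨ht6, hfr6, hN6, hth6⟩
  have hk6 : s6.N .k 0 = k := by rw [hfr6.n _ (by simp [roundNames, blockNames]), hk5]
  rw [wp_cons]
  refine Wp.mono (wp_outputProg s6 hk6 hN6) ?_
  rintro t7 s7 ⟨ht7, hout⟩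
  rw [wp_nil]
  refine ⟨?_, s6.pts k, hout, ?_⟩
  · have hW0 := roundCost_pos k a
    have hU0 : 0 < 16 ^ r * roundCost k a := by positivity
    set U := 16 ^ r * roundCost k a with hU
    have hUk : U ≤ k * U := Nat.le_mul_of_pos_left _ hk0
    -- All parameters are bounded by `U`, so all that is done besides drawing and evaluating costs
    -- `O (k * U)`.
    have i0 : 2 ^ a ≤ roundCost k a := by
      rw [roundCost]
      exact (Nat.pow_le_pow_left (by norm_num) a).trans (Nat.le_mul_of_pos_left _ (by positivity))
    have i1 : 16 ^ r * 2 ^ a ≤ U := Nat.mul_le_mul_left _ i0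
    have i2 : a ≤ U := (Nat.lt_two_pow_self.le.trans (Nat.le_mul_of_pos_left _ (by positivity))).trans i1
    have i3 : r ≤ U := (Nat.lt_pow_self (by norm_num : 1 < 16)).le.trans
      ((Nat.le_mul_of_pos_right _ (by positivity)).trans i1)
    have i4 : 2 ^ a ≤ U := i0.trans (Nat.le_mul_of_pos_left _ (by positivity))
    have i5 : p ≤ U := by
      have h1 : (p : ℝ) ≤ ((16 ^ r * 2 ^ a : ℕ) : ℝ) := by
        have h2 : (1 : ℝ) ≤ k := by exact_mod_cast hk0
        have h3 : (p : ℝ) ≤ k * p := le_mul_of_one_le_left (by positivity) h2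
        have h4 : ((16 ^ r * 2 ^ a : ℕ) : ℝ) * ε * ε ≤ ((16 ^ r * 2 ^ a : ℕ) : ℝ) * 1 * 1 := by
          gcongr
        have h5 : (0 : ℝ) ≤ p := by positivity
        linarith
      exact (by exact_mod_cast h1 : p ≤ 16 ^ r * 2 ^ a).trans i1
    have i6 : roundCost k (a + r) ≤ U := by
      have : ∀ r, roundCost k (a + r) ≤ 16 ^ r * roundCost k a := by
        intro r
        induction r with
        | zero => simp
        | succ r ih =>
          calc roundCost k (a + (r + 1)) ≤ 12 * roundCost k (a + r) :=
                roundCost_succ_le hk0 (hgrow (a + r) (Nat.le_add_right _ _))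
            _ ≤ 16 * (16 ^ r * roundCost k a) := Nat.mul_le_mul (by norm_num) ih
            _ = _ := by ring
      exact this r
    have hk' : k * 40 + 150 ≤ k * 190 := by omega
    have hk'' : e.n + e.T + k * 60 + 60 ≤ e.n + e.T + k * 120 := by omega
    have j1 : a * (k * 40 + 150) ≤ 190 * (k * U) := by
      calc a * (k * 40 + 150) ≤ U * (k * 190) :=
            Nat.mul_le_mul i2 hk'
        _ = _ := by ring
    have j2 : 16 ^ r * 2 ^ a * (e.n + e.T + k * 60 + 60) ≤
        16 ^ r * 2 ^ a * (e.n + e.T) + 120 * (k * U) := by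
      calc 16 ^ r * 2 ^ a * (e.n + e.T + k * 60 + 60) ≤
            16 ^ r * 2 ^ a * (e.n + e.T + k * 120) := Nat.mul_le_mul_left _ hk''
        _ = 16 ^ r * 2 ^ a * (e.n + e.T) + 16 ^ r * 2 ^ a * (k * 120) := by ring
        _ ≤ 16 ^ r * 2 ^ a * (e.n + e.T) + U * (k * 120) :=
            Nat.add_le_add_left (Nat.mul_le_mul_right _ i1) _
        _ = _ := by ring
    have j3 : 2 ^ a * k * 40 ≤ 40 * (k * U) := by
      calc 2 ^ a * k * 40 ≤ U * k * 40 := Nat.mul_le_mul_right _ (Nat.mul_le_mul_right _ i4)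
        _ = _ := by ring
    have j4 : k * roundCost k (a + r) ≤ k * U := Nat.mul_le_mul_left _ i6
    have t4' := ht4.trans (Nat.add_le_add_right j2 _)
    clear_value U
    generalize 16 ^ r * 2 ^ a * (e.n + e.T) = z at *
    generalize k * roundCost k (a + r) = z' at *
    generalize k * U = V at *
    generalize a * (k * 40 + 150) = z2 at *
    clear hL5 hN5 hN6 hr1 hr2 ha1 ha2 hgrow j2 ht4 hU i0 i1 i4 hN3
    omega
  · have hth := (hth6.trans hth5).mono (E' := ε / 2) ?_
    · obtain ⟨τ, b1, b2, b3, b4⟩ := hth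
      classical
      refine ⟨τ, b1, b2, fun u hu => by rw [b3 u hu, hpt4 _ (b1 u hu)], fun v => ?_⟩
      have h1 := b4 v
      rw [filter_congr (s := range (16 ^ r * 2 ^ a)) (q := fun i => e.f (e.ω i) ≤ v)
        (fun i hi => by rw [hpt4 i (mem_range.mp hi)])] at h1
      convert h1
    · -- The errors of the two loops add up to less than `12 + 4` times `roundError k a`.
      have h1 := roundError_nonneg k (a + r)
      have h2 : 16 * roundError k a ≤ ε / 2 := by
        rw [roundError]
        have : (0 : ℝ) < 2 ^ a := by positivity
        rw [mul_div_assoc', div_le_iff₀ this]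
        linarith
      linarith

end Whole

/-! ### Empirical distributions -/

section Brackets

variable (ν : Measure ℝ) [IsProbabilityMeasure ν]

/-- The quantile half-line on which the distribution function of `ν` is smaller than `c`. -/
def upperBracket (c : ℝ) : Set ℝ := {x | ν.real (Set.Iic x) < c}

/-- The quantile half-line on which the left limit of the distribution function of `ν` is smaller
than `c`. -/
def lowerBracket (c : ℝ) : Set ℝ := {x | ν.real (Set.Iio x) < c}

theorem measurableSet_upperBracket (c : ℝ) : MeasurableSet (upperBracket ν c) :=
  Set.OrdConnected.measurableSet (IsLowerSet.ordConnected fun _ _ hab ha =>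
    lt_of_le_of_lt (measureReal_mono (Set.Iic_subset_Iic.mpr hab)) ha)

theorem measurableSet_lowerBracket (c : ℝ) : MeasurableSet (lowerBracket ν c) :=
  Set.OrdConnected.measurableSet (IsLowerSet.ordConnected fun _ _ hab ha =>
    lt_of_le_of_lt (measureReal_mono (Set.Iio_subset_Iio hab)) ha)

/-- A measurable set of reals has measure at most `c` if all its compact subsets do. -/
theorem measureReal_le_of_isCompact {A : Set ℝ} (hA : MeasurableSet A) {c : ℝ} (hc : 0 ≤ c)
    (h : ∀ K ⊆ A, IsCompact K → K.Nonempty → ν.real K ≤ c) : ν.real A ≤ c := by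
  refine ENNReal.toReal_le_of_le_ofReal hc ?_
  rw [hA.measure_eq_iSup_isCompact ν]
  refine iSup_le fun K => iSup_le fun hKA => iSup_le fun hK => ?_
  rcases K.eq_empty_or_nonempty with rfl | hne
  · simp
  · rw [← ENNReal.ofReal_toReal (measure_ne_top ν K)]
    exact ENNReal.ofReal_le_ofReal (h K hKA hK hne)

/-- The distribution function stays below `c` on the bracket, whose end need not belong to it; compact
subsets have a greatest element. -/
theorem measureReal_upperBracket_le {c : ℝ} (hc : 0 ≤ c) : ν.real (upperBracket ν c) ≤ c := by
  refine measureReal_le_of_isCompact ν (measurableSet_upperBracket ν c) hc fun K hKA hK hne => ?_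
  obtain ⟨x, hx, hmax⟩ := hK.exists_isGreatest hne
  have h1 : ν.real (Set.Iic x) < c := hKA hx
  exact (measureReal_mono fun y hy => hmax hy).trans h1.le

theorem le_measureReal_lowerBracket {c : ℝ} (hc : c ≤ 1) : c ≤ ν.real (lowerBracket ν c) := by
  have h1 : ν.real (lowerBracket ν c)ᶜ ≤ 1 - c := by
    refine measureReal_le_of_isCompact ν (measurableSet_lowerBracket ν c).compl (by linarith)
      fun K hKA hK hne => ?_
    obtain ⟨x, hx, hmin⟩ := hK.exists_isLeast hne
    have h1 : c ≤ ν.real (Set.Iio x) := not_lt.mp (hKA hx)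
    have h2 : ν.real K ≤ ν.real (Set.Iio x)ᶜ :=
      measureReal_mono fun y hy => not_lt.mpr (hmin hy)
    rw [probReal_compl_eq_one_sub measurableSet_Iio] at h2
    linarith
  rw [probReal_compl_eq_one_sub (measurableSet_lowerBracket ν c)] at h1
  linarith

/-- Every half-line lies between two brackets whose levels differ by `1 / M`. -/
theorem exists_bracket {M : ℕ} (hM : 0 < M) (v : ℝ) : ∃ i : Fin (M + 1),
    lowerBracket ν ((i : ℕ) / M) ⊆ Set.Iic v ∧ Set.Iic v ⊆ upperBracket ν (((i : ℕ) + 1) / M) := by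
  have hM' : (0 : ℝ) < M := by exact_mod_cast hM
  set c := ν.real (Set.Iic v) with hc
  have hc0 : 0 ≤ c := measureReal_nonneg
  have hc1 : c ≤ 1 := measureReal_le_one
  have h1 : (⌊c * M⌋₊ : ℝ) ≤ c * M := Nat.floor_le (by positivity)
  have h2 : c * M < ⌊c * M⌋₊ + 1 := Nat.lt_floor_add_one _
  have h3 : ⌊c * M⌋₊ ≤ M := by
    have : c * M ≤ M := mul_le_of_le_one_left hM'.le hc1
    exact_mod_cast h1.trans this
  refine ⟨⟨⌊c * M⌋₊, by omega⟩, fun x hx => ?_, fun x hx => ?_⟩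
  · by_contra hxv
    have h4 : c ≤ ν.real (Set.Iio x) := measureReal_mono (Set.Iic_subset_Iio.mpr (not_le.mp hxv))
    have h5 : ν.real (Set.Iio x) < (⌊c * M⌋₊ : ℝ) / M := hx
    rw [lt_div_iff₀ hM'] at h5
    have := mul_le_mul_of_nonneg_right h4 hM'.le
    linarith
  · have h4 : ν.real (Set.Iic x) ≤ c := measureReal_mono (Set.Iic_subset_Iic.mpr hx)
    refine lt_of_le_of_lt h4 ?_
    rwa [lt_div_iff₀ hM']

end Brackets

section Empirical

open ProbabilityTheory

variable {X : Type*} [MeasurableSpace X] (μ : Measure X) [IsProbabilityMeasure μ]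

open Classical in
/-- Hoeffding's inequality for the number of draws in a fixed set. -/
theorem measureReal_card_ge_le {S : Set X} (hS : MeasurableSet S) {m : ℕ} (hm : 0 < m) {η : ℝ}
    (hη : 0 ≤ η) :
    (Measure.infinitePi fun _ : ℕ => μ).real
      {ω | (μ.real S + η) * m ≤ #{i ∈ range m | ω i ∈ S}} ≤ Real.exp (-2 * m * η ^ 2) := by
  set P := Measure.infinitePi fun _ : ℕ => μ
  set Z : X → ℝ := S.indicator 1 with hZ
  have hZm : Measurable Z := measurable_one.indicator hS
  have hZint : ∫ x, Z x ∂μ = μ.real S := integral_indicator_one hS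
  have hmp : ∀ i : ℕ, MeasurePreserving (fun ω : ℕ → X => ω i) P μ := fun i =>
    ⟨measurable_pi_apply i, Measure.infinitePi_map_eval _ i⟩
  have hind : iIndepFun (fun (i : ℕ) (ω : ℕ → X) => Z (ω i) - μ.real S) P :=
    iIndepFun_infinitePi (P := fun _ : ℕ => μ) (X := fun _ x => Z x - μ.real S)
      fun _ => hZm.sub_const _
  have hsub : ∀ i < m, HasSubgaussianMGF (fun ω : ℕ → X => Z (ω i) - μ.real S)
      ((‖(1 : ℝ) - 0‖₊ / 2) ^ 2) P := by
    intro i _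
    have h1 := hasSubgaussianMGF_of_mem_Icc (μ := P) (X := fun ω : ℕ → X => Z (ω i)) (a := 0)
      (b := 1) (hZm.comp (measurable_pi_apply i)).aemeasurable (Filter.Eventually.of_forall
        fun ω => ?_)
    · have h2 : ∫ ω, Z (ω i) ∂P = μ.real S := by
        rw [← hZint, ← (hmp i).map_eq,
          integral_map (measurable_pi_apply i).aemeasurable hZm.aestronglyMeasurable]
      rwa [h2] at h1
    · simp only [hZ, Set.indicator_apply, Pi.one_apply]
      split_ifs <;> simp
  have hm' : (0 : ℝ) < m := by exact_mod_cast hm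
  have h := HasSubgaussianMGF.measure_sum_range_ge_le_of_iIndepFun hind hsub
    (ε := η * m) (by positivity)
  convert h using 2
  · ext ω
    rw [Set.mem_ofPred_eq, Set.mem_ofPred_eq]
    have h1 : ∑ i ∈ range m, (Z (ω i) - μ.real S) = #{i ∈ range m | ω i ∈ S} - m * μ.real S := by
      rw [sum_sub_distrib, sum_const, card_range, nsmul_eq_mul]
      congr 1
      rw [card_filter]
      push_cast
      refine sum_congr rfl fun i _ => ?_
      simp [hZ, Set.indicator_apply]
    rw [h1]
    constructor <;> intro h' <;> linarith
  · push_cast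
    simp only [sub_zero, norm_one]
    field_simp

variable {k : ℕ} {f : X → Fin k → ℝ}

open Classical in
/-- A sample of `m` independent points approximates the distribution function of `f` uniformly. -/
theorem measure_exists_deviation_le (hf : Measurable f) {m M : ℕ} (hm : 0 < m) (hM : 0 < M)
    {η : ℝ} (hη : 0 ≤ η) :
    (Measure.infinitePi fun _ : ℕ => μ) {ω | ∃ v, k / M + η <
      |(#{i ∈ range m | f (ω i) ≤ v} : ℝ) / m - μ.real {x | f x ≤ v}|} ≤
      ENNReal.ofReal (2 * (M + 1) ^ k * Real.exp (-2 * m * η ^ 2)) := by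
  set P := Measure.infinitePi fun _ : ℕ => μ
  have hfj : ∀ j, Measurable fun x => f x j := fun j => (measurable_pi_apply j).comp hf
  set ν : Fin k → Measure ℝ := fun j => μ.map fun x => f x j with hν
  have hνp : ∀ j, IsProbabilityMeasure (ν j) := fun j =>
    Measure.isProbabilityMeasure_map (hfj j).aemeasurable
  set lo : (Fin k → Fin (M + 1)) → Set X := fun i =>
    {x | ∀ j, f x j ∈ lowerBracket (ν j) ((i j : ℕ) / M)} with hlo
  set up : (Fin k → Fin (M + 1)) → Set X := fun i =>
    {x | ∀ j, f x j ∈ upperBracket (ν j) (((i j : ℕ) + 1) / M)} with hup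
  have hlom : ∀ i, MeasurableSet (lo i) := fun i => by
    rw [hlo]
    simp only [Set.ofPred_forall]
    exact MeasurableSet.iInter fun j => hfj j (measurableSet_lowerBracket _ _)
  have hupm : ∀ i, MeasurableSet (up i) := fun i => by
    rw [hup]
    simp only [Set.ofPred_forall]
    exact MeasurableSet.iInter fun j => hfj j (measurableSet_upperBracket _ _)
  set cnt : Set X → (ℕ → X) → ℕ := fun S ω => #{i ∈ range m | ω i ∈ S} with hcnt
  have hcnt1 : ∀ S ω v, {x | f x ≤ v} ⊆ S → #{i ∈ range m | f (ω i) ≤ v} ≤ cnt S ω :=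
    fun S ω v h => card_le_card fun u hu => by
      rw [mem_filter] at hu ⊢
      exact ⟨hu.1, h hu.2⟩
  have hcnt2 : ∀ S ω v, Sᶜ ⊆ {x | f x ≤ v} →
      m ≤ #{i ∈ range m | f (ω i) ≤ v} + cnt S ω := fun S ω v h => by
    rw [← card_range m]
    refine (card_le_card fun u hu => ?_).trans (card_union_le _ _)
    rw [mem_union, mem_filter, mem_filter, card_range]
    by_cases h' : ω u ∈ S
    · exact Or.inr ⟨hu, h'⟩
    · exact Or.inl ⟨hu, h h'⟩
  -- A lower deviation for `lo i` is an upper deviation for its complement.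
  set bad : Set X → Set (ℕ → X) := fun S => {ω | (μ.real S + η) * m ≤ cnt S ω} with hbad
  have hm' : (0 : ℝ) < m := by exact_mod_cast hm
  have hM' : (0 : ℝ) < M := by exact_mod_cast hM
  have hsub : {ω | ∃ v, k / M + η <
      |(#{i ∈ range m | f (ω i) ≤ v} : ℝ) / m - μ.real {x | f x ≤ v}|} ⊆
      ⋃ i : Fin k → Fin (M + 1), bad (up i) ∪ bad (lo i)ᶜ := by
    rintro ω ⟨v, hv⟩
    by_contra hω
    simp only [Set.mem_iUnion, Set.mem_union, not_exists, not_or] at hω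
    choose i hi using fun j => exists_bracket (ν j) hM (v j)
    obtain ⟨h1, h2⟩ := hω i
    have hloV : lo i ⊆ {x | f x ≤ v} := fun x hx j => (hi j).1 (hx j)
    have hupV : {x | f x ≤ v} ⊆ up i := fun x hx j => (hi j).2 (hx j)
    -- The two boxes around the orthant differ by at most one slab for each coordinate.
    have hdiff : μ.real (up i) ≤ μ.real (lo i) + k / M := by
      have hslab : ∀ j, μ.real ((fun x => f x j) ⁻¹' (upperBracket (ν j) (((i j : ℕ) + 1) / M) \
          lowerBracket (ν j) ((i j : ℕ) / M))) ≤ 1 / M := by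
        intro j
        have e1 := map_measureReal_apply (μ := μ) (hfj j)
          ((measurableSet_upperBracket (ν j) (((i j : ℕ) + 1) / M)).diff
          (measurableSet_lowerBracket (ν j) ((i j : ℕ) / M)))
        rw [← e1]
        change (ν j).real _ ≤ _
        rw [measureReal_sdiff ((hi j).1.trans (hi j).2) (measurableSet_lowerBracket _ _)]
        have e2 := measureReal_upperBracket_le (ν j) (c := ((i j : ℕ) + 1) / M) (by positivity)
        have e3 := le_measureReal_lowerBracket (ν j) (c := (i j : ℕ) / M) (by
          rw [div_le_one hM']
          exact_mod_cast Nat.lt_succ_iff.mp (i j).2)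
        rw [add_div] at e2
        rw [add_div]
        linarith
      have hcov : up i ⊆ lo i ∪ ⋃ j, ((fun x => f x j) ⁻¹'
          (upperBracket (ν j) (((i j : ℕ) + 1) / M) \ lowerBracket (ν j) ((i j : ℕ) / M))) := by
        intro x hx
        by_cases hxl : x ∈ lo i
        · exact Or.inl hxl
        · right
          simp only [hlo, Set.mem_ofPred_eq, not_forall] at hxl
          obtain ⟨j, hj⟩ := hxl
          exact Set.mem_iUnion.mpr ⟨j, hx j, hj⟩
      calc μ.real (up i) ≤ _ := measureReal_mono hcov
        _ ≤ _ := measureReal_union_le _ _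
        _ ≤ μ.real (lo i) + ∑ _j : Fin k, 1 / (M : ℝ) := by
          gcongr
          exact (measureReal_iUnion_fintype_le _).trans (sum_le_sum fun j _ => hslab j)
        _ = _ := by simp [div_eq_mul_inv]
    have hF1 : μ.real (lo i) ≤ μ.real {x | f x ≤ v} := measureReal_mono hloV
    have hF2 : μ.real {x | f x ≤ v} ≤ μ.real (up i) := measureReal_mono hupV
    simp only [hbad, Set.mem_ofPred_eq, not_le] at h1 h2
    have c1 : (#{i ∈ range m | f (ω i) ≤ v} : ℝ) ≤ cnt (up i) ω := by
      exact_mod_cast hcnt1 _ ω v hupV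
    have c2 : (m : ℝ) ≤ #{i ∈ range m | f (ω i) ≤ v} + cnt (lo i)ᶜ ω := by
      exact_mod_cast hcnt2 _ ω v ((compl_compl (lo i)).subset.trans hloV)
    rw [probReal_compl_eq_one_sub (hlom i)] at h2
    refine absurd hv (not_lt.mpr ?_)
    rw [abs_le]
    constructor
    · have : (μ.real (lo i) - η) ≤ (#{i ∈ range m | f (ω i) ≤ v} : ℝ) / m := by
        rw [le_div_iff₀ hm']; linarith
      linarith
    · have : (#{i ∈ range m | f (ω i) ≤ v} : ℝ) / m ≤ μ.real (up i) + η := by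
        rw [div_le_iff₀ hm']; linarith
      linarith
  have hb : ∀ S, MeasurableSet S → P (bad S) ≤ ENNReal.ofReal (Real.exp (-2 * m * η ^ 2)) :=
    fun S hS => by
      rw [← ENNReal.ofReal_toReal (measure_ne_top P (bad S))]
      exact ENNReal.ofReal_le_ofReal (measureReal_card_ge_le μ hS hm hη)
  refine (measure_mono hsub).trans ((measure_iUnion_fintype_le _ _).trans ?_)
  calc ∑ i, P (bad (up i) ∪ bad (lo i)ᶜ)
      ≤ ∑ _i : Fin k → Fin (M + 1), ENNReal.ofReal (2 * Real.exp (-2 * m * η ^ 2)) := by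
        refine sum_le_sum fun i _ => (measure_union_le _ _).trans ?_
        rw [two_mul, ENNReal.ofReal_add (Real.exp_nonneg _) (Real.exp_nonneg _)]
        exact add_le_add (hb _ (hupm i)) (hb _ (hlom i).compl)
    _ = _ := by
        rw [sum_const, card_univ, Fintype.card_fun, Fintype.card_fin, Fintype.card_fin,
          ← ENNReal.ofReal_nsmul, nsmul_eq_mul]
        congr 1
        push_cast
        ring

/-- Independent draws from a distribution without atoms are distinct. -/
theorem measure_exists_eq (hf : Measurable f) (h0 : ∀ x, μ (f ⁻¹' {x}) = 0) :
    (Measure.infinitePi fun _ : ℕ => μ) {ω | ∃ i j, i ≠ j ∧ f (ω i) = f (ω j)} = 0 := by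
  set P := Measure.infinitePi fun _ : ℕ => μ
  simp only [Set.ofPred_exists]
  refine measure_iUnion_null fun i => measure_iUnion_null fun j => ?_
  by_cases hij : i = j
  · simp [hij]
  have hind : IndepFun (fun ω : ℕ → X => ω i) (fun ω => ω j) P :=
    (iIndepFun_infinitePi (P := fun _ : ℕ => μ) (X := fun _ x => x)
      fun _ => measurable_id).indepFun hij
  rw [indepFun_iff_map_prod_eq_prod_map_map (measurable_pi_apply i).aemeasurable
    (measurable_pi_apply j).aemeasurable] at hind
  have hmeas : MeasurableSet {z : X × X | f z.1 = f z.2} :=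
    measurableSet_eq_fun (hf.comp measurable_fst) (hf.comp measurable_snd)
  have h1 : P {ω | i ≠ j ∧ f (ω i) = f (ω j)} =
      P.map (fun ω => (ω i, ω j)) {z : X × X | f z.1 = f z.2} := by
    rw [Measure.map_apply ((measurable_pi_apply i).prodMk (measurable_pi_apply j)) hmeas]
    congr 1
    ext ω
    simp [hij]
  rw [h1, hind, Measure.infinitePi_map_eval, Measure.infinitePi_map_eval,
    Measure.measure_prod_null hmeas]
  refine Filter.Eventually.of_forall fun x => ?_
  rw [Pi.zero_apply, ← h0 (f x)]
  refine congrArg μ (Set.ext fun y => ?_)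
  simp [eq_comm]

end Empirical

/-! ### The size of the parameters -/

section Asymptotics

/-- What is required of `ℓ = log (1 / ε)` for `ε` to be small in terms of `k`. -/
structure Large (k : ℕ) (ℓ : ℝ) : Prop where
  six_mul_le : 6 * (k : ℝ) ≤ ℓ
  growth : 512 * (3 * ℓ) ^ (2 * k) ≤ (2 : ℝ) ^ (ℓ / (2 * k))

/-- A power of `ℓ` is eventually smaller than an exponential function. -/
theorem eventually_large {k : ℕ} (hk : 0 < k) : ∀ᶠ ℓ in Filter.atTop, Large k ℓ := by
  have hk' : (0 : ℝ) < k := by exact_mod_cast hk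
  have hb : 0 < Real.log 2 / (2 * k) := div_pos (Real.log_pos one_lt_two) (by positivity)
  have h := (isLittleO_pow_exp_pos_mul_atTop (2 * k) hb).bound
    (c := (512 * 3 ^ (2 * k))⁻¹) (by positivity)
  filter_upwards [h, Filter.eventually_ge_atTop (6 * (k : ℝ))] with ℓ h1 h2
  refine ⟨h2, ?_⟩
  have hℓ : 0 ≤ ℓ := le_trans (by positivity) h2
  rw [Real.norm_of_nonneg (by positivity), Real.norm_of_nonneg (by positivity),
    inv_mul_eq_div, le_div_iff₀ (by positivity)] at h1
  rw [Real.rpow_def_of_pos two_pos, mul_pow]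
  calc 512 * (3 ^ (2 * k) * ℓ ^ (2 * k)) = ℓ ^ (2 * k) * (512 * 3 ^ (2 * k)) := by ring
    _ ≤ _ := h1
    _ = _ := by congr 1; ring

section Bounds

variable {k : ℕ} {ε ℓ : ℝ}

theorem Large.le_pow (h : Large k ℓ) (hk : 0 < k) (hε : (2 : ℝ) ^ ℓ = 1 / ε) :
    512 * (3 * ℓ) ^ (2 * k) ≤ 1 / ε := by
  have hk' : (1 : ℝ) ≤ k := by exact_mod_cast hk
  have h6 := h.six_mul_le
  rw [← hε]
  refine h.growth.trans (Real.rpow_le_rpow_of_exponent_le one_le_two ?_)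
  rw [div_le_iff₀ (by positivity)]
  nlinarith

/-- The least `a` with `256 (a + 1) ^ (2 k) ≤ 2 ^ a ε` exceeds `log (1 / ε)` only by a small
factor. -/
theorem Large.exists_level (h : Large k ℓ) (hk : 0 < k) (hε0 : 0 < ε)
    (hε : (2 : ℝ) ^ ℓ = 1 / ε) : ∃ a : ℕ,
      (∀ x < a, (2 : ℝ) ^ x * ε < 256 * ((x : ℝ) + 1) ^ (2 * k)) ∧
      256 * ((a : ℝ) + 1) ^ (2 * k) ≤ 2 ^ a * ε ∧ (a : ℝ) ≤ ℓ * (1 + 1 / (2 * k)) := by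
  have hk' : (1 : ℝ) ≤ k := by exact_mod_cast hk
  have h6 := h.six_mul_le
  set z := ℓ * (1 + 1 / (2 * k)) with hz
  have hz2 : z ≤ 2 * ℓ := by
    have : 1 / (2 * (k : ℝ)) ≤ 1 := by
      rw [div_le_one (by positivity)]; linarith
    rw [hz]
    nlinarith
  have hz0 : 0 ≤ z := by
    rw [hz]; exact mul_nonneg (by linarith) (by positivity)
  set b := ⌊z⌋₊ with hb
  have hbz : (b : ℝ) ≤ z := Nat.floor_le hz0
  have hex : 256 * ((b : ℝ) + 1) ^ (2 * k) ≤ 2 ^ b * ε := by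
    have h1 : ((b : ℝ) + 1) ^ (2 * k) ≤ (3 * ℓ) ^ (2 * k) := by
      gcongr
      linarith
    have h2 : (2 : ℝ) ^ (z - 1) ≤ 2 ^ b := by
      rw [← Real.rpow_natCast]
      refine Real.rpow_le_rpow_of_exponent_le one_le_two ?_
      have := Nat.lt_floor_add_one z
      linarith
    have h3 : (2 : ℝ) ^ (z - 1) = (2 : ℝ) ^ (ℓ / (2 * k)) / (2 * ε) := by
      rw [show z - 1 = ℓ + ℓ / (2 * k) - 1 by rw [hz]; ring, Real.rpow_sub two_pos,
        Real.rpow_add two_pos, hε, Real.rpow_one]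
      field_simp
    have h4 : (2 : ℝ) ^ (ℓ / (2 * k)) / 2 ≤ 2 ^ b * ε := by
      calc (2 : ℝ) ^ (ℓ / (2 * k)) / 2 = (2 : ℝ) ^ (z - 1) * ε := by rw [h3]; field_simp
        _ ≤ _ := by gcongr
    have h5 := h.growth
    linarith
  classical
  have hex' : ∃ a : ℕ, 256 * ((a : ℝ) + 1) ^ (2 * k) ≤ 2 ^ a * ε := ⟨b, hex⟩
  refine ⟨Nat.find hex', fun x hx => not_le.mp (Nat.find_min hex' hx), Nat.find_spec hex', ?_⟩
  exact le_trans (by exact_mod_cast Nat.find_min' hex' hex) hbz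

/-- The level is at least `log (1 / ε)`, hence large in terms of `k`. -/
theorem Large.le_level (h : Large k ℓ) (hε0 : 0 < ε) (hε : (2 : ℝ) ^ ℓ = 1 / ε) {a : ℕ}
    (ha : 256 * ((a : ℝ) + 1) ^ (2 * k) ≤ 2 ^ a * ε) : 6 * k ≤ a := by
  have h1 : (1 : ℝ) ≤ ((a : ℝ) + 1) ^ (2 * k) := one_le_pow₀ (by linarith [Nat.cast_nonneg (α := ℝ) a])
  have h2 : (2 : ℝ) ^ ℓ ≤ (2 : ℝ) ^ (a : ℝ) := by
    rw [hε, Real.rpow_natCast, div_le_iff₀ hε0]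
    linarith
  have h3 := (Real.rpow_le_rpow_left_iff one_lt_two).mp h2
  have h4 := h.six_mul_le.trans h3
  exact_mod_cast h4

/-- The power in `roundError` grows slowly enough for `2 ^ c` to outweigh it. -/
theorem two_mul_pow_le {k a c : ℕ} (ha : 6 * k ≤ a) (hc : a ≤ c) :
    2 * (c + 2) ^ (2 * k) ≤ 3 * (c + 1) ^ (2 * k) := by
  have hc' : (6 : ℝ) * k ≤ c := by exact_mod_cast ha.trans hc
  have h1 := one_add_mul_le_pow (a := -1 / ((c : ℝ) + 2)) (by
    rw [le_div_iff₀ (by positivity)]; linarith [Nat.cast_nonneg (α := ℝ) c]) (2 * k)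
  have e1 : 1 + -1 / ((c : ℝ) + 2) = (c + 1) / (c + 2) := by field_simp; ring
  have h2 : (2 : ℝ) / 3 ≤ 1 + ((2 * k : ℕ) : ℝ) * (-1 / ((c : ℝ) + 2)) := by
    push_cast
    have : 2 * (k : ℝ) / (c + 2) ≤ 1 / 3 := by
      rw [div_le_div_iff₀ (by positivity) (by positivity)]
      linarith
    have e2 : 2 * (k : ℝ) * (-1 / (c + 2)) = -(2 * k / (c + 2)) := by ring
    rw [e2]
    linarith
  have h3 := h2.trans h1
  rw [e1, div_pow, le_div_iff₀ (by positivity)] at h3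
  have h4 : (2 : ℝ) * ((c : ℝ) + 2) ^ (2 * k) ≤ 3 * ((c : ℝ) + 1) ^ (2 * k) := by linarith
  exact_mod_cast h4

/-- The size of the quantization: as `a` exceeds `ℓ = log (1 / ε)` by a factor of at most
`1 + 1 / (2 k)`, the power `a ^ (2 k)` is at most `3 ℓ ^ (2 k)`. -/
theorem Large.two_pow_le (h : Large k ℓ) (hk : 0 < k) (hε0 : 0 < ε) {a : ℕ} (ha0 : 0 < a)
    (ha1 : ∀ x < a, (2 : ℝ) ^ x * ε < 256 * ((x : ℝ) + 1) ^ (2 * k))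
    (ha3 : (a : ℝ) ≤ ℓ * (1 + 1 / (2 * k))) : (2 : ℝ) ^ a ≤ 1536 * (ℓ ^ (2 * k) / ε) := by
  have hk' : (1 : ℝ) ≤ k := by exact_mod_cast hk
  have hℓ : 0 ≤ ℓ := le_trans (by positivity) h.six_mul_le
  obtain ⟨b, rfl⟩ : ∃ b, a = b + 1 := ⟨a - 1, by omega⟩
  have h1 := ha1 b (by omega)
  have h2 : ((b : ℝ) + 1) ^ (2 * k) ≤ 3 * ℓ ^ (2 * k) := by
    have h3 : (1 + 1 / (2 * (k : ℝ))) ^ (2 * k) ≤ 3 := by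
      calc (1 + 1 / (2 * (k : ℝ))) ^ (2 * k) ≤ Real.exp (1 / (2 * k)) ^ (2 * k) := by
            gcongr
            rw [add_comm]
            exact Real.add_one_le_exp _
        _ = Real.exp 1 := by
            rw [← Real.exp_nat_mul]
            congr 1
            push_cast
            field_simp
        _ ≤ 3 := Real.exp_one_lt_three.le
    calc ((b : ℝ) + 1) ^ (2 * k) ≤ (ℓ * (1 + 1 / (2 * k))) ^ (2 * k) := by
          gcongr
          exact_mod_cast ha3
      _ = ℓ ^ (2 * k) * (1 + 1 / (2 * (k : ℝ))) ^ (2 * k) := mul_pow _ _ _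
      _ ≤ ℓ ^ (2 * k) * 3 := by gcongr
      _ = _ := by ring
  rw [mul_div_assoc', le_div_iff₀ hε0, pow_succ]
  linarith

/-- The value of `p` that `confidenceProg` finds, for `z = ε δ`. -/
theorem exists_confidence {z : ℝ} (hz : 0 < z) : ∃ p : ℕ,
    (∀ x < p, (2 : ℝ) ^ x * z < k) ∧ (k : ℝ) ≤ 2 ^ p * z := by
  classical
  have hex : ∃ p : ℕ, (k : ℝ) ≤ 2 ^ p * z := by
    obtain ⟨p, hp⟩ := pow_unbounded_of_one_lt (k / z) (one_lt_two (α := ℝ))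
    exact ⟨p, by rw [div_lt_iff₀ hz] at hp; exact hp.le⟩
  exact ⟨Nat.find hex, fun x hx => not_le.mp (Nat.find_min hex hx), Nat.find_spec hex⟩

/-- The confidence parameter is at most twice `log (k / (ε δ))`. -/
theorem confidence_le {z : ℝ} (hz : 0 < z) (hzk : 2 * z ≤ k) {p : ℕ}
    (hp : ∀ x < p, (2 : ℝ) ^ x * z < k) : (p : ℝ) ≤ 2 * Real.logb 2 (k / z) := by
  have h1 : 1 ≤ Real.logb 2 (k / z) := by
    rw [Real.le_logb_iff_rpow_le one_lt_two (div_pos (by linarith) hz), Real.rpow_one,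
      le_div_iff₀ hz]
    exact hzk
  rcases Nat.eq_zero_or_pos p with rfl | h0
  · push_cast; linarith
  · have h2 := hp (p - 1) (by omega)
    have h3 : ((p - 1 : ℕ) : ℝ) ≤ Real.logb 2 (k / z) := by
      rw [Real.le_logb_iff_rpow_le one_lt_two (div_pos (by linarith) hz), Real.rpow_natCast,
        le_div_iff₀ hz]
      exact h2.le
    rw [Nat.cast_sub h0] at h3
    push_cast at h3
    linarith

/-- The value of `r` that `countProg` finds. -/
theorem exists_count {p a : ℕ} (hε0 : 0 < ε) : ∃ r : ℕ,
    (∀ x < r, ((16 ^ x * 2 ^ a : ℕ) : ℝ) * ε * ε < 32 * (k * p)) ∧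
    32 * ((k : ℝ) * p) ≤ ((16 ^ r * 2 ^ a : ℕ) : ℝ) * ε * ε := by
  classical
  have hex : ∃ r : ℕ, 32 * ((k : ℝ) * p) ≤ ((16 ^ r * 2 ^ a : ℕ) : ℝ) * ε * ε := by
    obtain ⟨r, hr⟩ := pow_unbounded_of_one_lt (32 * ((k : ℝ) * p) / (2 ^ a * ε * ε))
      (by norm_num : (1 : ℝ) < 16)
    refine ⟨r, ?_⟩
    rw [div_lt_iff₀ (by positivity)] at hr
    push_cast
    linarith
  exact ⟨Nat.find hex, fun x hx => not_le.mp (Nat.find_min hex hx), Nat.find_spec hex⟩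

/-- The size of the sample exceeds what is needed by a factor of at most `16`, unless the smallest
possible size `2 ^ a` suffices. -/
theorem count_le {p a r : ℕ} (hε0 : 0 < ε) (ha : (2 : ℝ) ^ a * ε ^ 2 ≤ 512 * (k * p))
    (hr : ∀ x < r, ((16 ^ x * 2 ^ a : ℕ) : ℝ) * ε * ε < 32 * (k * p)) :
    ((16 ^ r * 2 ^ a : ℕ) : ℝ) ≤ 512 * (k * p) / ε ^ 2 := by
  rw [le_div_iff₀ (by positivity)]
  rcases Nat.eq_zero_or_pos r with rfl | h0
  · push_cast
    linarith
  · obtain ⟨q, rfl⟩ : ∃ q, r = q + 1 := ⟨r - 1, by omega⟩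
    have := hr q (by omega)
    push_cast at this ⊢
    rw [pow_succ]
    linarith

/-- The failure probability, with `m` draws, `4 k / ε` quantiles and deviation `ε / 4`: each of the
`k` coordinates contributes `5 k / ε` boxes and a factor `exp (- 4 p)`, where `exp (- p)` is at most
`ε δ / k`. -/
theorem failure_le (hk : 0 < k) {δ : ℝ} (hε0 : 0 < ε) (hε1 : ε ≤ 1 / 64) (hδ0 : 0 < δ)
    (hδ1 : δ < 1) {p m : ℕ} (hp : (k : ℝ) ≤ 2 ^ p * ε * δ)
    (hm : 32 * ((k : ℝ) * p) ≤ m * ε * ε) :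
    2 * ((⌈4 * k / ε⌉₊ : ℝ) + 1) ^ k * Real.exp (-2 * m * (ε / 4) ^ 2) ≤ δ := by
  have hk' : (1 : ℝ) ≤ k := by exact_mod_cast hk
  have h1 : (⌈4 * k / ε⌉₊ : ℝ) + 1 ≤ 5 * k / ε := by
    have := Nat.ceil_lt_add_one (a := 4 * k / ε) (by positivity)
    have h2 : 2 ≤ k / ε := by
      rw [le_div_iff₀ hε0]; linarith
    have e1 : 5 * k / ε = 4 * k / ε + k / ε := by ring
    rw [e1]
    linarith
  have h2 : Real.exp (-2 * m * (ε / 4) ^ 2) ≤ (ε * δ / k) ^ (4 * k) := by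
    have h3 : Real.exp (-(p : ℝ)) ≤ ε * δ / k := by
      have h4 : (2 : ℝ) ^ p ≤ Real.exp p := by
        rw [← mul_one (p : ℝ), Real.exp_nat_mul]
        gcongr
        have := Real.add_one_le_exp (1 : ℝ)
        linarith
      rw [Real.exp_neg, inv_eq_one_div, div_le_div_iff₀ (Real.exp_pos _) (by positivity)]
      calc 1 * (k : ℝ) ≤ 2 ^ p * ε * δ := by linarith
        _ ≤ Real.exp p * ε * δ := by gcongr
        _ = _ := by ring
    calc Real.exp (-2 * m * (ε / 4) ^ 2) ≤ Real.exp (((4 * k : ℕ) : ℝ) * -(p : ℝ)) := by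
          apply Real.exp_le_exp.mpr
          push_cast
          linarith
      _ = Real.exp (-(p : ℝ)) ^ (4 * k) := Real.exp_nat_mul _ _
      _ ≤ _ := by gcongr
  set x := 5 * ε ^ 3 * δ ^ 4 / k ^ 3 with hx
  have hx1 : x ≤ δ / 2 := by
    have h5 : ε ^ 3 ≤ (1 / 64) ^ 3 := by gcongr
    have h6 : δ ^ 4 ≤ δ := by
      calc δ ^ 4 = δ * δ ^ 3 := by ring
        _ ≤ δ * 1 := by gcongr; exact pow_le_one₀ hδ0.le hδ1.le
        _ = δ := mul_one _
    have h7 : (1 : ℝ) ≤ k ^ 3 := one_le_pow₀ hk'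
    calc x ≤ 5 * ε ^ 3 * δ ^ 4 := div_le_self (by positivity) h7
      _ ≤ 5 * (1 / 64) ^ 3 * δ := by gcongr
      _ ≤ δ / 2 := by linarith
  calc 2 * ((⌈4 * k / ε⌉₊ : ℝ) + 1) ^ k * Real.exp (-2 * m * (ε / 4) ^ 2)
      ≤ 2 * (5 * k / ε) ^ k * (ε * δ / k) ^ (4 * k) := by gcongr
    _ = 2 * x ^ k := by
      rw [pow_mul, mul_assoc, ← mul_pow, hx]
      congr 2
      field_simp
    _ ≤ 2 * x := by
      gcongr
      exact pow_le_of_le_one (by positivity) (hx1.trans (by linarith)) (by omega)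
    _ ≤ δ := by linarith

end Bounds

end Asymptotics

section Asymptotics

/-- The running time.  The factor `(a + 1) ^ (k + 1)` in `roundCost` is at most `1 / ε`, which leaves
`k * N * (2 ^ a) ^ 2 / ε` for the time of the thinning. -/
theorem Large.time_le {k : ℕ} {ε ℓ δ : ℝ} (h : Large k ℓ) (hk : 0 < k) (hε0 : 0 < ε)
    (hε : (2 : ℝ) ^ ℓ = 1 / ε) (hδ0 : 0 < δ) (hδ1 : δ < 1) {n T a p r t : ℕ} (hn : n ≤ T)
    (ha : (2 : ℝ) ^ a ≤ 1536 * (ℓ ^ (2 * k) / ε)) (ha' : (a : ℝ) + 1 ≤ 3 * ℓ)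
    (hp : (p : ℝ) ≤ 2 * Real.logb 2 (k / (ε * δ)))
    (hN : ((16 ^ r * 2 ^ a : ℕ) : ℝ) ≤ 512 * (k * p) / ε ^ 2)
    (ht : t ≤ 16 ^ r * 2 ^ a * (n + T) + 101000 * (k * (16 ^ r * roundCost k a))) :
    (t : ℝ) ≤ 10 ^ 15 * (T * (k / ε ^ 2) * Real.logb 2 (k / (ε * δ)) +
      (k : ℝ) ^ 2 / ε ^ 5 * ℓ ^ (6 * k) * Real.logb 2 (1 / (ε * δ))) := by
  have hk' : (1 : ℝ) ≤ k := by exact_mod_cast hk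
  have h6 := h.six_mul_le
  have hℓ : 1 ≤ ℓ := by linarith
  set Λ := Real.logb 2 (k / (ε * δ)) with hΛ
  set Λ' := Real.logb 2 (1 / (ε * δ)) with hΛ'
  set N : ℝ := ((16 ^ r * 2 ^ a : ℕ) : ℝ) with hNdef
  have hP := h.le_pow hk hε
  have hP1 : (3 * ℓ) ^ (2 * k) ≤ 1 / ε := by
    have : 0 ≤ (3 * ℓ) ^ (2 * k) := by positivity
    linarith
  have hkε : (k : ℝ) ≤ 1 / ε := by
    have h1 : 3 * ℓ ≤ (3 * ℓ) ^ (2 * k) := le_self_pow₀ (by linarith) (by omega)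
    linarith
  have hεδ : 1 / ε ≤ 1 / (ε * δ) := by
    apply one_div_le_one_div_of_le (by positivity)
    nlinarith
  have hΛ'0 : 0 ≤ Λ' := Real.logb_nonneg one_lt_two (hk'.trans (hkε.trans hεδ))
  have hΛΛ' : Λ ≤ 2 * Λ' := by
    have h1 : (k : ℝ) / (ε * δ) ≤ (1 / (ε * δ)) ^ 2 := by
      rw [sq, div_eq_mul_one_div]
      gcongr
      exact hkε.trans hεδ
    have h2 := Real.logb_le_logb_of_le one_lt_two (by positivity) h1
    rw [Real.logb_pow] at h2
    exact_mod_cast h2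
  have hp0 : (0 : ℝ) ≤ p := Nat.cast_nonneg _
  have hΛ0 : 0 ≤ Λ := by linarith
  have hN1 : N ≤ 1024 * (k * Λ) / ε ^ 2 := by
    refine hN.trans ?_
    gcongr ?_ / _
    nlinarith
  have hN2 : N ≤ 2048 * (k * Λ') / ε ^ 2 := by
    refine hN1.trans ?_
    gcongr ?_ / _
    nlinarith
  have hN0 : 0 ≤ N := Nat.cast_nonneg _
  have hcost : ((16 ^ r * roundCost k a : ℕ) : ℝ) = N * (((a : ℝ) + 1) ^ (k + 1) * (2 ^ a) ^ 2) := by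
    rw [hNdef, roundCost]
    push_cast
    rw [show (8 : ℝ) = 2 ^ 3 by norm_num, ← pow_mul, ← pow_mul, mul_comm 3, pow_mul]
    ring
  have hpow : ((a : ℝ) + 1) ^ (k + 1) ≤ 1 / ε := by
    refine le_trans ?_ hP1
    calc ((a : ℝ) + 1) ^ (k + 1) ≤ (3 * ℓ) ^ (k + 1) := by gcongr
      _ ≤ (3 * ℓ) ^ (2 * k) := pow_le_pow_right₀ (by linarith) (by omega)
  have htr : (t : ℝ) ≤ N * (n + T) + 101000 * (k * (N * (((a : ℝ) + 1) ^ (k + 1) * (2 ^ a) ^ 2))) := by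
    rw [← hcost, hNdef]
    exact_mod_cast ht
  have hn' : (n : ℝ) ≤ T := by exact_mod_cast hn
  have hT0 : (0 : ℝ) ≤ T := Nat.cast_nonneg _
  have b1 : N * (n + T) ≤ 2048 * (T * (k / ε ^ 2) * Λ) := by
    calc N * (n + T) ≤ 1024 * (k * Λ) / ε ^ 2 * (T + T) := by gcongr
      _ = _ := by ring
  have hℓpow : (ℓ ^ (2 * k)) ^ 2 ≤ ℓ ^ (6 * k) := by
    rw [← pow_mul]
    exact pow_le_pow_right₀ hℓ (by omega)
  have b2 : k * (N * (((a : ℝ) + 1) ^ (k + 1) * (2 ^ a) ^ 2)) ≤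
      2048 * 1536 ^ 2 * ((k : ℝ) ^ 2 / ε ^ 5 * ℓ ^ (6 * k) * Λ') := by
    calc k * (N * (((a : ℝ) + 1) ^ (k + 1) * (2 ^ a) ^ 2))
        ≤ k * (2048 * (k * Λ') / ε ^ 2 * (1 / ε * (1536 * (ℓ ^ (2 * k) / ε)) ^ 2)) := by gcongr
      _ = 2048 * 1536 ^ 2 * ((k : ℝ) ^ 2 / ε ^ 5 * (ℓ ^ (2 * k)) ^ 2 * Λ') := by
        field_simp
      _ ≤ _ := by gcongr
  have c1 : 0 ≤ T * (k / ε ^ 2) * Λ := by positivity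
  have c2 : 0 ≤ (k : ℝ) ^ 2 / ε ^ 5 * ℓ ^ (6 * k) * Λ' := by positivity
  linarith

end Asymptotics

/-! ### Quantizations -/

section Final

variable {k : ℕ}

open Classical in
theorem orthantFraction_range_map (m : ℕ) (Q : ℕ → Fin k → ℝ) (v : Fin k → ℝ) :
    orthantFraction ((Multiset.range m).map Q) v = (#{u ∈ range m | Q u ≤ v} : ℝ) / m := by
  rw [orthantFraction, Multiset.filter_map, Multiset.card_map, Multiset.card_map,
    Multiset.card_range]
  rfl

variable {X : Type*} [MeasurableSpace X]

/-- A thinned sample is a quantization unless the sample deviates from its distribution. -/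
theorem Thinned.isQuantization {m n : ℕ} {ε : ℝ} (hm : 0 < m) {F : (Fin k → ℝ) → ℝ}
    {Q' Q : ℕ → Fin k → ℝ} (h : Thinned m n (ε / 2) Q' Q)
    (hF : ∀ v, |orthantFraction ((Multiset.range n).map Q) v - F v| ≤ ε / 2) :
    IsQuantization ε F ((Multiset.range m).map Q') := by
  classical
  obtain ⟨τ, -, -, -, h4⟩ := h
  refine ⟨fun h0 => ?_, fun v => ?_⟩
  · have := congrArg Multiset.card h0
    simp at this
    omega
  · have h1 := h4 v
    have h2 := hF v
    rw [orthantFraction_range_map] at h2 ⊢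
    rw [abs_le] at h1 h2 ⊢
    constructor <;> linarith

theorem Thinned.nodup {m n : ℕ} {E : ℝ} {Q' Q : ℕ → Fin k → ℝ} (h : Thinned m n E Q' Q)
    (hQ : ∀ i j, i ≠ j → Q i ≠ Q j) : ((Multiset.range m).map Q').Nodup := by
  obtain ⟨τ, -, h2, h3, -⟩ := h
  refine (Multiset.nodup_range m).map_on fun u hu u' hu' he => ?_
  rw [Multiset.mem_range] at hu hu'
  rw [h3 u hu, h3 u' hu'] at he
  by_contra hne
  exact hQ _ _ (fun h' => hne (h2 u hu u' hu' h')) he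

/-- What the program computes, for inputs with small `ε`: it fails only if the sample deviates from
its distribution by more than `ε / 2`, or if two draws from a distribution without atoms agree. -/
theorem quantProg_spec {ε : ℝ} (hk : 0 < k) (hε0 : 0 < ε) (hℓ : Large k (Real.logb 2 (1 / ε)))
    (μ : Measure X) [IsProbabilityMeasure μ] {f : X → Fin k → ℝ} (hf : Measurable f) {δ : ℝ}
    (hδ0 : 0 < δ) (hδ1 : δ < 1) {n T : ℕ} (hn : n ≤ T) :
    ∃ R : (ℕ → X) → Multiset (Fin k → ℝ),
      (∀ ω, ∃ t : ℕ, Outputs quantProg f n T ε δ ω t (R ω) ∧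
        (t : ℝ) ≤ 10 ^ 15 * ((T : ℝ) * ((k : ℝ) / ε ^ 2) * Real.logb 2 (k / (ε * δ))
          + (k : ℝ) ^ 2 / ε ^ 5 * Real.logb 2 (1 / ε) ^ (6 * k) * Real.logb 2 (1 / (ε * δ)))) ∧
      (∀ ω, (storage (R ω) : ℝ) ≤
        10 ^ 15 * ((k : ℝ) ^ 2 / ε * Real.logb 2 (1 / ε) ^ (2 * k))) ∧
      Measure.infinitePi (fun _ : ℕ => μ)
        {ω | ¬ (IsQuantization ε (fun v => (μ {x | f x ≤ v}).toReal) (R ω) ∧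
          ((∀ x, μ (f ⁻¹' {x}) = 0) → (R ω).Nodup))} ≤ ENNReal.ofReal δ := by
  classical
  set ℓ := Real.logb 2 (1 / ε) with hℓdef
  have hk' : (1 : ℝ) ≤ k := by exact_mod_cast hk
  have hε : (2 : ℝ) ^ ℓ = 1 / ε := Real.rpow_logb two_pos (by norm_num) (by positivity)
  have h6 := hℓ.six_mul_le
  have hε1 : ε ≤ 1 / 64 := by
    have h1 : (2 : ℝ) ^ (6 : ℝ) ≤ 1 / ε := by
      rw [← hε]
      exact Real.rpow_le_rpow_of_exponent_le one_le_two (by linarith)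
    rw [show (6 : ℝ) = (6 : ℕ) by norm_num, Real.rpow_natCast, le_div_iff₀ hε0] at h1
    linarith
  obtain ⟨a, ha1, ha2, ha3⟩ := hℓ.exists_level hk hε0 hε
  have ha6 := hℓ.le_level hε0 hε ha2
  have ha0 : 0 < a := by omega
  obtain ⟨p, hp1, hp2⟩ := exists_confidence (k := k) (mul_pos hε0 hδ0)
  simp only [← mul_assoc] at hp1 hp2
  obtain ⟨r, hr1, hr2⟩ := exists_count (k := k) (p := p) (a := a) hε0
  have hpow := hℓ.two_pow_le hk hε0 ha0 ha1 ha3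
  have hp : (p : ℝ) ≤ 2 * Real.logb 2 (k / (ε * δ)) :=
    confidence_le (mul_pos hε0 hδ0) (by nlinarith) (by simpa only [← mul_assoc] using hp1)
  have hp0 : 1 ≤ p := by
    by_contra hp0
    obtain rfl : p = 0 := by omega
    rw [pow_zero, one_mul] at hp2
    nlinarith
  have hp0' : (1 : ℝ) ≤ p := by exact_mod_cast hp0
  have ha' : (a : ℝ) + 1 ≤ 3 * ℓ := by
    have : 1 / (2 * (k : ℝ)) ≤ 1 := by
      rw [div_le_one (by positivity)]; linarith
    nlinarith
  -- Already `2 ^ a` draws are affordable, since `2 ^ a * ε ^ 2` is bounded for small `ε`.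
  have hN : ((16 ^ r * 2 ^ a : ℕ) : ℝ) ≤ 512 * (k * p) / ε ^ 2 := by
    refine count_le hε0 ?_ hr1
    have h1 : ℓ ^ (2 * k) * 512 ≤ 1 / ε := by
      refine le_trans ?_ (hℓ.le_pow hk hε)
      rw [mul_comm]
      gcongr
      all_goals linarith
    have h2 : 1536 * (ℓ ^ (2 * k) / ε) * ε ^ 2 ≤ 3 := by
      rw [le_div_iff₀ hε0] at h1
      have e1 : 1536 * (ℓ ^ (2 * k) / ε) * ε ^ 2 = 3 * (ℓ ^ (2 * k) * 512 * ε) := by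
        field_simp
        ring
      rw [e1]
      linarith
    calc (2 : ℝ) ^ a * ε ^ 2 ≤ 1536 * (ℓ ^ (2 * k) / ε) * ε ^ 2 := by gcongr
      _ ≤ 3 := h2
      _ ≤ 512 * (1 * 1) := by norm_num
      _ ≤ _ := by gcongr
  set N := 16 ^ r * 2 ^ a with hNdef
  have hN0 : 0 < N := by positivity
  have hrun : ∀ ω : ℕ → X, ∃ R : Multiset (Fin k → ℝ), (∃ t, Outputs quantProg f n T ε δ ω t R ∧
      t ≤ N * (n + T) + 101000 * (k * (16 ^ r * roundCost k a))) ∧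
      ∃ Q' : ℕ → Fin k → ℝ, R = (Multiset.range (2 ^ a)).map Q' ∧
        Thinned (2 ^ a) N (ε / 2) Q' (fun i => f (ω i)) := by
    intro ω
    obtain ⟨t, s', hx, ht, Q', hout, hth⟩ := wp_quantProg (e := ⟨f, n, T, ω⟩) hk ha0 hε0.le
      (by linarith) ha1 ha2 hp1 hp2 hr1 hr2 (fun c hc => two_mul_pow_le ha6 hc)
    exact ⟨output k s', ⟨t, ⟨s', hx, rfl⟩, ht⟩, Q', hout, hth⟩
  choose R hR Q' hQ' hth using hrun
  refine ⟨R, fun ω => ?_, fun ω => ?_, ?_⟩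
  · obtain ⟨t, hout, ht⟩ := hR ω
    exact ⟨t, hout, hℓ.time_le hk hε0 hε hδ0 hδ1 hn hpow ha' hp hN ht⟩
  · rw [hQ' ω, storage, Multiset.card_map, Multiset.card_range]
    push_cast
    have hℓ0 : 0 ≤ ℓ := by linarith
    have hx0 : 0 ≤ (k : ℝ) ^ 2 / ε * ℓ ^ (2 * k) := by positivity
    calc (2 : ℝ) ^ a * k ≤ 1536 * (ℓ ^ (2 * k) / ε) * (k * k) :=
          mul_le_mul hpow (by nlinarith) (by positivity) (by positivity)
      _ = 1536 * ((k : ℝ) ^ 2 / ε * ℓ ^ (2 * k)) := by ring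
      _ ≤ _ := by linarith
  · -- A quarter of `ε` is spent on the brackets, another quarter on Hoeffding's inequality.
    set M := ⌈4 * k / ε⌉₊ with hM
    have hM0 : 0 < M := Nat.ceil_pos.mpr (by positivity)
    have hMk : (k : ℝ) / M + ε / 4 ≤ ε / 2 := by
      have h1 : 4 * k / ε ≤ M := Nat.le_ceil _
      have h2 : (k : ℝ) / M ≤ ε / 4 := by
        rw [div_le_iff₀ (by exact_mod_cast hM0)]
        rw [div_le_iff₀ hε0] at h1
        linarith
      linarith
    have hdev := measure_exists_deviation_le μ hf hN0 hM0 (by positivity : 0 ≤ ε / 4)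
    set B1 : Set (ℕ → X) := {ω | ∃ v, k / M + ε / 4 <
      |(#{i ∈ range N | f (ω i) ≤ v} : ℝ) / N - μ.real {x | f x ≤ v}|} with hB1
    have hfail := failure_le hk hε0 hε1 hδ0 hδ1 hp2 hr2
    have hB1' : Measure.infinitePi (fun _ : ℕ => μ) B1 ≤ ENNReal.ofReal δ :=
      hdev.trans (ENNReal.ofReal_le_ofReal hfail)
    have hquant : ∀ ω, ω ∉ B1 →
        IsQuantization ε (fun v => (μ {x | f x ≤ v}).toReal) (R ω) := by
      intro ω hω
      rw [hQ' ω]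
      refine (hth ω).isQuantization (by positivity) fun v => ?_
      rw [orthantFraction_range_map]
      by_contra hcon
      exact hω ⟨v, hMk.trans_lt (not_le.mp hcon)⟩
    by_cases h0 : ∀ x, μ (f ⁻¹' {x}) = 0
    · set B2 : Set (ℕ → X) := {ω | ∃ i j, i ≠ j ∧ f (ω i) = f (ω j)} with hB2
      have hB2' : Measure.infinitePi (fun _ : ℕ => μ) B2 = 0 := measure_exists_eq μ hf h0
      refine (measure_mono (t := B1 ∪ B2) fun ω hω => ?_).trans
        ((measure_union_le _ _).trans (by rw [hB2', add_zero]; exact hB1'))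
      by_contra hcon
      rw [Set.mem_union, not_or] at hcon
      refine hω ⟨hquant ω hcon.1, fun _ => ?_⟩
      rw [hQ' ω]
      exact (hth ω).nodup fun i j hij he => hcon.2 ⟨i, j, hij, he⟩
    · refine (measure_mono fun ω hω => ?_).trans hB1'
      by_contra hcon
      exact hω ⟨hquant ω hcon, fun h => absurd h h0⟩

end Final

end RealRAM

theorem mainTheorem2 :
    ∃ C : ℝ, 0 < C ∧ ∃ prog : RealRAM.Prog,
      ∀ k : ℕ, 1 ≤ k → ∃ ε₀ : ℝ, 0 < ε₀ ∧ ε₀ < 1 ∧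
        ∀ ε : ℝ, 0 < ε → ε ≤ ε₀ →
        ∀ (n d : ℕ) (μP : Measure (Fin n → EuclideanSpace ℝ (Fin d))) [IsProbabilityMeasure μP]
          (f : (Fin n → EuclideanSpace ℝ (Fin d)) → (Fin k → ℝ)), Measurable f →
          -- existence of a small quantization
          (∃ R : Multiset (Fin k → ℝ),
            IsQuantization ε (orthantCDF μP f) R ∧
            ((∀ x, μP (f ⁻¹' {x}) = 0) → R.Nodup) ∧
            (storage R : ℝ) ≤ C * ((k : ℝ) ^ 2 / ε * Real.logb 2 (1 / ε) ^ (2 * k))) ∧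
          -- its randomized construction; `T` is the time to evaluate `f` on `n` points
          (∀ (δ : ℝ), 0 < δ → δ < 1 → ∀ T : ℕ, n ≤ T →
            ∃ R : (ℕ → Fin n → EuclideanSpace ℝ (Fin d)) → Multiset (Fin k → ℝ),
              (∀ ω, ∃ t : ℕ, RealRAM.Outputs prog f n T ε δ ω t (R ω) ∧
                (t : ℝ) ≤ C * ((T : ℝ) * ((k : ℝ) / ε ^ 2) * Real.logb 2 (k / (ε * δ))
                  + (k : ℝ) ^ 2 / ε ^ 5 * Real.logb 2 (1 / ε) ^ (6 * k)
                    * Real.logb 2 (1 / (ε * δ)))) ∧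
              (∀ ω, (storage (R ω) : ℝ) ≤
                C * ((k : ℝ) ^ 2 / ε * Real.logb 2 (1 / ε) ^ (2 * k))) ∧
              Measure.infinitePi (fun _ : ℕ => μP)
                {ω | ¬ (IsQuantization ε (orthantCDF μP f) (R ω) ∧
                  ((∀ x, μP (f ⁻¹' {x}) = 0) → (R ω).Nodup))} ≤ ENNReal.ofReal δ) := by
  refine ⟨10 ^ 15, by positivity, RealRAM.quantProg, fun k hk => ?_⟩
  obtain ⟨b, hb⟩ := Filter.eventually_atTop.mp (RealRAM.eventually_large hk)
  refine ⟨2 ^ (-(max b 1)), by positivity, ?_, fun ε hε0 hε n d μP _ f hf => ?_⟩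
  · rw [Real.rpow_lt_one_iff_of_pos two_pos]
    exact Or.inl ⟨one_lt_two, by linarith [le_max_right b 1]⟩
  have hℓ : RealRAM.Large k (Real.logb 2 (1 / ε)) := by
    refine hb _ ((le_max_left b 1).trans ?_)
    rw [Real.le_logb_iff_rpow_le one_lt_two (by positivity), le_div_iff₀ hε0]
    calc (2 : ℝ) ^ (max b 1) * ε ≤ 2 ^ (max b 1) * 2 ^ (-(max b 1)) := by gcongr
      _ = 1 := by rw [← Real.rpow_add two_pos, add_neg_cancel, Real.rpow_zero]
  refine ⟨?_, fun δ hδ0 hδ1 T hT => RealRAM.quantProg_spec hk hε0 hℓ μP hf hδ0 hδ1 hT⟩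
  -- With probability at least `1 / 2` the program finds a quantization, so there is one.
  obtain ⟨R, -, hsize, hprob⟩ := RealRAM.quantProg_spec hk hε0 hℓ μP hf
    (by norm_num : (0 : ℝ) < 1 / 2) (by norm_num) (le_refl n)
  obtain ⟨ω, hω⟩ : ∃ ω, IsQuantization ε (orthantCDF μP f) (R ω) ∧
      ((∀ x, μP (f ⁻¹' {x}) = 0) → (R ω).Nodup) := by
    by_contra hcon
    push Not at hcon
    have huniv : {ω | ¬ (IsQuantization ε (fun v => (μP {x | f x ≤ v}).toReal) (R ω) ∧
        ((∀ x, μP (f ⁻¹' {x}) = 0) → (R ω).Nodup))} = Set.univ :=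
      Set.eq_univ_of_forall fun ω h => (hcon ω h.1).2 (h.2 (hcon ω h.1).1)
    rw [huniv, measure_univ, ← ENNReal.ofReal_one] at hprob
    rw [ENNReal.ofReal_le_ofReal_iff (by norm_num)] at hprob
    norm_num at hprob
  exact ⟨R ω, hω.1, hω.2, hsize ω⟩
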